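/- For $g\ge 1$ let $\Sigma_g$ be the closed connected orientable surface of genus $g$, obtained from a $4g$-gon by gluing its sides according to the boundary word $a_1b_1a_1^{-1}b_1^{-1}\cdots a_gb_ga_g^{-1}b_g^{-1}$. Its base point is the image of the vertices. The sides give the standard simple loops $a_1,b_1,\dots,a_g,b_g$ at the base point, and we use the same letters for their classes in $\pi_1(\Sigma_g)$. For an element $w$ of a group generated by $x_1,\dots,x_n$, the syllable length $\ell(w)$ is the least $s\ge 1$ such that $w=x_{i_1}^{m_1}\cdots x_{i_s}^{m_s}$ for some indices $1\le i_j\le n$ and integers $m_j$ (zero exponents are allowed, so $\ell(1)=1$). Let $n\ge 1$ and let $F_n$ be the subgroup of $\pi_1(\Sigma_n)$ generated by $a_1,\dots,a_n$. Then $F_n$ is free with basis $a_1,\dots,a_n$. Let $k\ge 0$, let $r_1,\dots,r_k\in F_n$ be arbitrary, let $\ell=\ell(r_1)+\cdots+\ell(r_k)$ be the sum of their syllable lengths with respect to $a_1,\dots,a_n$, and let $h=n+\ell-k$. Then $h\ge n$, and there is exactly one homomorphism $\Phi:\pi_1(\Sigma_h)\to\pi_1(\Sigma_n)$ with $\Phi(a_j)=a_j$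 for $1\le j\le n$ and $\Phi(\alpha)=1$ for every $\alpha\in\{a_{n+1},\dots,a_h,b_1,\dots,b_h\}$. Moreover, there are loops $R_1,\dots,R_k$ on $\Sigma_h$, based at the base point, such that (a) each $R_i$ is a simple loop; (b) each $R_i$ is freely homotopic to a simple closed curve that intersects $a_h$ at exactly one point, and transversely there; (c) $\Phi([R_i])=r_i$ for each $i$, where $[R_i]\in\pi_1(\Sigma_h)$ is the homotopy class of $R_i$. Here curves are continuous, and two curves intersect transversely at a point if some chart of the surface centred at that point takes them to the two coordinate axes. -/

import Mathlib

open scoped unitInterval Real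

namespace SurfaceLoops

/-- The closed unit disc, used as the closed `4g`-gon. -/
abbrev Disc : Type := Metric.closedBall (0 : ℂ) 1

/-- The point with parameter `t ∈ [0,1]` on the `k`-th of the `4g` boundary edges of the disc. The
edges are the circular arcs between consecutive `4g`-th roots of unity, numbered from `0` and
traversed counterclockwise. -/
noncomputable def edgePoint (g k : ℕ) (t : I) : Disc :=
  ⟨(Circle.exp (2 * π * ((k + (t : ℝ)) / (4 * g))) : ℂ), by
    rw [mem_closedBall_zero_iff, Circle.norm_coe]⟩

/-- The side pairing of the `4g`-gon with boundary word
`a₁ b₁ a₁⁻¹ b₁⁻¹ ⋯ a_g b_g a_g⁻¹ b_g⁻¹`. -/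
inductive Glue (g : ℕ) : Disc → Disc → Prop
  | a (i : Fin g) (t : I) :
      Glue g (edgePoint g (4 * (i : ℕ)) t) (edgePoint g (4 * (i : ℕ) + 2) (σ t))
  | b (i : Fin g) (t : I) :
      Glue g (edgePoint g (4 * (i : ℕ) + 1) t) (edgePoint g (4 * (i : ℕ) + 3) (σ t))

/-- The standard closed connected orientable surface of genus `g ≥ 1`: the quotient space of the
`4g`-gon by the side pairing (with the quotient topology). -/
abbrev Surface (g : ℕ) : Type := Quot (Glue g)

/-- The base point: the image of the vertices of the polygon. -/
noncomputable def basePoint (g : ℕ) : Surface g := Quot.mk _ (edgePoint g 0 0)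

theorem edgePoint_one (g k : ℕ) : edgePoint g k 1 = edgePoint g (k + 1) 0 := by
  apply Subtype.ext
  simp [edgePoint]

theorem continuous_edgePoint (g k : ℕ) : Continuous (edgePoint g k) := by
  unfold edgePoint
  fun_prop

/-- In each block of four edges, all five vertices are identified. -/
theorem vertex_block (g : ℕ) (i : Fin g) :
    (Quot.mk (Glue g) (edgePoint g (4 * (i : ℕ) + 1) 0) =
        Quot.mk (Glue g) (edgePoint g (4 * (i : ℕ)) 0)) ∧
      (Quot.mk (Glue g) (edgePoint g (4 * (i : ℕ) + 2) 0) =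
        Quot.mk (Glue g) (edgePoint g (4 * (i : ℕ)) 0)) ∧
      (Quot.mk (Glue g) (edgePoint g (4 * (i : ℕ) + 4) 0) =
        Quot.mk (Glue g) (edgePoint g (4 * (i : ℕ)) 0)) := by
  have a0 := Quot.sound (Glue.a i 0)
  have a1 := Quot.sound (Glue.a i 1)
  have b0 := Quot.sound (Glue.b i 0)
  have b1 := Quot.sound (Glue.b i 1)
  simp only [unitInterval.symm_zero, unitInterval.symm_one, edgePoint_one, add_assoc,
    Nat.reduceAdd] at a0 a1 b0 b1
  exact ⟨a1.trans (b1.trans a0.symm), b1.trans a0.symm, b0.symm.trans (a1.trans (b1.trans a0.symm))⟩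

theorem vertex_four_mul (g : ℕ) : ∀ m : ℕ, m ≤ g →
    Quot.mk (Glue g) (edgePoint g (4 * m) 0) = basePoint g
  | 0, _ => rfl
  | m + 1, hm => (vertex_block g ⟨m, hm⟩).2.2.trans (vertex_four_mul g m (by omega))

/-- The standard simple loop `a_{i+1}` on the surface: the image of an edge labelled `a_{i+1}`. -/
noncomputable def aLoop (g : ℕ) (i : Fin g) : Path (basePoint g) (basePoint g) where
  toFun t := Quot.mk _ (edgePoint g (4 * (i : ℕ)) t)
  continuous_toFun := continuous_quot_mk.comp (continuous_edgePoint g _)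
  source' := vertex_four_mul g i i.2.le
  target' := by
    rw [edgePoint_one, (vertex_block g i).1]
    exact vertex_four_mul g i i.2.le

/-- The standard simple loop `b_{i+1}` on the surface: the image of an edge labelled `b_{i+1}`. -/
noncomputable def bLoop (g : ℕ) (i : Fin g) : Path (basePoint g) (basePoint g) where
  toFun t := Quot.mk _ (edgePoint g (4 * (i : ℕ) + 1) t)
  continuous_toFun := continuous_quot_mk.comp (continuous_edgePoint g _)
  source' := by
    rw [(vertex_block g i).1]
    exact vertex_four_mul g i i.2.le
  target' := by
    rw [edgePoint_one, (vertex_block g i).2.1]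
    exact vertex_four_mul g i i.2.le

/-- `π₁(Σ_g)`, based at the vertex. -/
abbrev PiOne (g : ℕ) : Type := FundamentalGroup (Surface g) (basePoint g)

/-- The homotopy class of a loop based at the vertex. -/
noncomputable def loopClass {g : ℕ} (p : Path (basePoint g) (basePoint g)) : PiOne g :=
  FundamentalGroup.fromPath (Path.Homotopic.Quotient.mk p)

/-- The class of `a_{i+1}` in `π₁(Σ_g)`. -/
noncomputable def aClass (g : ℕ) (i : Fin g) : PiOne g := loopClass (aLoop g i)

/-- The class of `b_{i+1}` in `π₁(Σ_g)`. -/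
noncomputable def bClass (g : ℕ) (i : Fin g) : PiOne g := loopClass (bLoop g i)

/-- The syllable length of `w` with respect to a finite family `x`: the least `s ≥ 1` such that
`w = x_{i₁}^{m₁} ⋯ x_{i_s}^{m_s}` with integers `m_j`. The exponents may vanish, so the
identity has syllable length `1`. -/
noncomputable def syllableLength {G : Type*} [Group G] {n : ℕ} (x : Fin n → G) (w : G) : ℕ :=
  sInf {s | 1 ≤ s ∧ ∃ (i : Fin s → Fin n) (m : Fin s → ℤ),
    w = (List.ofFn fun j => x (i j) ^ m j).prod}

section Curves

variable {X : Type*} [TopologicalSpace X]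

/-- A loop is simple if it is injective apart from the coincidence of its two end points. -/
def IsSimpleLoop {x : X} (p : Path x x) : Prop :=
  ∀ s t : I, p s = p t → s = t ∨ (s = 0 ∧ t = 1) ∨ (s = 1 ∧ t = 0)

/-- Free homotopy of loops: a homotopy through loops whose base point may move. -/
def FreelyHomotopic {x y : X} (p : Path x x) (q : Path y y) : Prop :=
  ∃ H : C(I × I, X), (∀ t, H (0, t) = p t) ∧ (∀ t, H (1, t) = q t) ∧
    ∀ s, H (s, 0) = H (s, 1)

/-- The subsets (curves) `A` and `B` of a surface intersect transversely at `z`: in some chart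
centred at `z` they are the two coordinate axes. -/
def TransverseAt (A B : Set X) (z : X) : Prop :=
  ∃ e : OpenPartialHomeomorph X (ℝ × ℝ), z ∈ e.source ∧ e z = (0, 0) ∧
    ∀ x ∈ e.source, (x ∈ A ↔ (e x).2 = 0) ∧ (x ∈ B ↔ (e x).1 = 0)

/-- `A` and `B` intersect at exactly one point, and transversely there. -/
def MeetTransverselyOnce (A B : Set X) : Prop :=
  ∃ z, A ∩ B = {z} ∧ TransverseAt A B z

end Curves

/-- The conditions defining the homomorphism `Φ : π₁(Σ_h) → π₁(Σ_n)`: `a_j ↦ a_j` for `j ≤ n`,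
while `a_{n+1}, …, a_h` and `b_1, …, b_h` go to `1`. -/
def IsCollapse {n h : ℕ} (hnh : n ≤ h) (Φ : PiOne h →* PiOne n) : Prop :=
  (∀ j : Fin n, Φ (aClass h (Fin.castLE hnh j)) = aClass n j) ∧
    (∀ j : Fin h, n ≤ (j : ℕ) → Φ (aClass h j) = 1) ∧
    ∀ j : Fin h, Φ (bClass h j) = 1

end SurfaceLoops

/-!
The loops `R_i` are found as images of the single loop `b_h` under homeomorphisms of `Σ_h`. Let `Ψ`
be a homeomorphism which fixes the base point and the loop `a_h` pointwise, and let `C` be the curve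
dual to `a_h`, a simple closed curve which is freely homotopic to `b_h` and crosses `a_h` once. Then
`Ψ (b_h)` is simple, and it is freely homotopic to the simple curve `Ψ (C)`, which still crosses
`a_h = Ψ (a_h)` once and transversely (`exists_dual_curve`, `exists_loop_of_homeomorph`). So the
first two conditions hold automatically, and only `Φ (Ψ_* b_h) = r_i` has to be arranged.

The homeomorphisms `Ψ` are products of Dehn twists along annuli which are made of one or two strips
of parallel chords of the polygon (`StripChain`, `StripAnnulus.twist`, `exists_twist_a`,
`exists_twist_two`). A twist multiplies the loop of an edge crossed by the annulus by a power of the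
class of a closed chain of chords. A chord from the first vertex to another one represents an
initial part of the boundary word, and once a homomorphism makes `a_l` and `b_l` commute for all `l`,
every complete block of this word disappears (`map_chordCls_zero`). Hence the effect of the twists
is easy to compute after composition with `Φ`.

* If `n < h`, then `Φ (a_h) = 1`, and a twist along an annulus which crosses `b_j` and `b_h`
  changes the value at `b_h` from `w` to `w * a_j ^ m`. This realises every word
  (`realizable_of_mem_closure`), whatever its length.
* If `n = h`, then all the syllable lengths are `1`, so that each `r_i` is a power of one `a_j`.
  Powers are realised by three twists (`exists_homeomorph_pow`).

`Φ` is unique because the `a_j` and `b_j` generate `π₁(Σ_h)` (`piOne_hom_ext`). In place of the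
theorem of Seifert and van Kampen, this uses that `Σ_h` is covered by the interior of the polygon,
neighbourhoods of the open sides, and a neighbourhood of the vertex, each of which is contracted by
a deformation that lifts to the polygon (`eq_top_of_locally_mem`). `Φ` exists because `Σ_h` maps
onto a bouquet of `h` circles, by a map which takes the `a_j` to the circles and the `b_j` to the
common point (`petalMap`). The same map shows that the `a_j` are a basis of a free group: the
bouquet has a covering whose fibre is the free group and whose monodromy consists of the left
translations, and this is pulled back to the surface (`cover`, `injective_lift_of_circle`).

In Mathlib's fundamental group, `p * q` is the class of `q` followed by `p`.
-/

namespace SurfaceLoops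

/-! ### The polygon and its chords -/

/-- The point of the boundary circle with parameter `a`, in the scale in which the `4g` edges have
length `1`; thus the `k`-th edge consists of the points with parameter in `[k, k + 1]`. -/
noncomputable def bdPt (g : ℕ) (a : ℝ) : Disc :=
  ⟨(Circle.exp (2 * π * (a / (4 * g))) : ℂ), by rw [mem_closedBall_zero_iff, Circle.norm_coe]⟩

theorem edgePoint_eq_bdPt (g k : ℕ) (t : I) : edgePoint g k t = bdPt g (k + t) := rfl

@[fun_prop]
theorem continuous_bdPt (g : ℕ) : Continuous (bdPt g) := by
  unfold bdPt
  fun_prop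

theorem norm_bdPt (g : ℕ) (a : ℝ) : ‖(bdPt g a : ℂ)‖ = 1 := Circle.norm_coe _

theorem bdPt_eq_bdPt_iff {g : ℕ} (hg : 0 < g) {a b : ℝ} :
    bdPt g a = bdPt g b ↔ ∃ m : ℤ, a = b + m * (4 * g) := by
  have hg' : (g : ℝ) ≠ 0 := by positivity
  rw [Subtype.ext_iff]
  simp only [bdPt, Circle.coe_inj, Circle.exp_eq_exp]
  refine exists_congr fun m => ?_
  constructor
  · intro h
    field_simp at h
    nlinarith [h]
  · rintro rfl
    field_simp

theorem bdPt_add_period {g : ℕ} (hg : 0 < g) (a : ℝ) : bdPt g (a + 4 * g) = bdPt g a :=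
  (bdPt_eq_bdPt_iff hg).2 ⟨1, by simp⟩

/-- A boundary point lies on only one half-open edge, and has a unique parameter there. -/
theorem bdPt_inj {g : ℕ} (hg : 0 < g) {k l : ℕ} (hk : k < 4 * g) (hl : l < 4 * g) {s t : ℝ}
    (hs : 0 ≤ s) (hs1 : s < 1) (ht : 0 ≤ t) (ht1 : t < 1) (h : bdPt g (k + s) = bdPt g (l + t)) :
    k = l ∧ s = t := by
  obtain ⟨m, hm⟩ := (bdPt_eq_bdPt_iff hg).1 h
  have hk' : (k : ℝ) + 1 ≤ 4 * g := by exact_mod_cast hk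
  have hl' : (l : ℝ) + 1 ≤ 4 * g := by exact_mod_cast hl
  have hg' : (0 : ℝ) < g := by positivity
  have hm0 : m = 0 := by
    by_contra hne
    rcases lt_or_gt_of_ne hne with h0 | h0
    · have : (m : ℝ) ≤ -1 := by exact_mod_cast Int.le_sub_one_of_lt h0
      nlinarith [(k : ℕ).cast_nonneg (α := ℝ)]
    · have : (1 : ℝ) ≤ m := by exact_mod_cast h0
      nlinarith [(l : ℕ).cast_nonneg (α := ℝ)]
  subst hm0
  have hkl : k = l := by
    have h1 : (k : ℝ) < l + 1 := by push_cast at hm; linarith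
    have h2 : (l : ℝ) < k + 1 := by push_cast at hm; linarith
    have h1' : k < l + 1 := by exact_mod_cast h1
    have h2' : l < k + 1 := by exact_mod_cast h2
    omega
  subst hkl
  exact ⟨rfl, by push_cast at hm; linarith⟩

/-- Polar coordinates on the polygon, the angle being measured by an edge and a parameter on it. -/
theorem exists_polar {g : ℕ} (hg : 0 < g) (z : Disc) :
    ∃ k : ℕ, k < 4 * g ∧ ∃ t : ℝ, 0 ≤ t ∧ t < 1 ∧ (z : ℂ) = ‖(z : ℂ)‖ * (bdPt g (k + t) : ℂ) := by
  have hg' : (0 : ℝ) < g := by positivity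
  obtain ⟨a, ha0, ha1, ha⟩ : ∃ a : ℝ, 0 ≤ a ∧ a < 4 * g ∧ (z : ℂ) = ‖(z : ℂ)‖ * (bdPt g a : ℂ) := by
    set x : ℝ := Complex.arg z / (2 * π) * (4 * g) with hx
    refine ⟨toIcoMod (by positivity : (0 : ℝ) < 4 * g) 0 x, (toIcoMod_mem_Ico' _ x).1,
      (toIcoMod_mem_Ico' _ x).2, ?_⟩
    have hb : bdPt g (toIcoMod (by positivity : (0 : ℝ) < 4 * g) 0 x) = bdPt g x :=
      (bdPt_eq_bdPt_iff hg).2 ⟨-toIcoDiv (by positivity : (0 : ℝ) < 4 * g) 0 x, by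
        rw [toIcoMod]; simp [sub_eq_add_neg]⟩
    rw [hb]
    have : 2 * π * (x / (4 * g)) = Complex.arg z := by
      rw [hx]; field_simp
    simp only [bdPt, this, Circle.coe_exp]
    exact (Complex.norm_mul_exp_arg_mul_I _).symm
  refine ⟨⌊a⌋₊, ?_, a - ⌊a⌋₊, sub_nonneg.2 (Nat.floor_le ha0), ?_, ?_⟩
  · exact (Nat.floor_lt ha0).2 (by exact_mod_cast ha1)
  · linarith [Nat.lt_floor_add_one a]
  · rw [add_sub_cancel]
    exact ha

/-- The point dividing the straight segment from `z` to `w` in the ratio `u : 1 - u`. -/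
noncomputable def lerp (z w : Disc) (u : I) : Disc :=
  ⟨(1 - (u : ℝ)) • (z : ℂ) + (u : ℝ) • (w : ℂ),
    (convex_closedBall (0 : ℂ) 1) z.2 w.2 (sub_nonneg.2 u.2.2) u.2.1 (by ring)⟩

@[fun_prop]
theorem Continuous.lerp {X : Type*} [TopologicalSpace X] {f f' : X → Disc} {u : X → I}
    (hf : Continuous f) (hf' : Continuous f') (hu : Continuous u) :
    Continuous fun x => lerp (f x) (f' x) (u x) := by
  unfold SurfaceLoops.lerp
  fun_prop

@[simp] theorem lerp_zero (z w : Disc) : lerp z w 0 = z := by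
  apply Subtype.ext; simp [lerp]

@[simp] theorem lerp_one (z w : Disc) : lerp z w 1 = w := by
  apply Subtype.ext; simp [lerp]

theorem lerp_symm (z w : Disc) (u : I) : lerp z w (σ u) = lerp w z u := by
  apply Subtype.ext; simp [lerp, add_comm]

/-- The chord of the disc from the boundary point `μ + η` to the boundary point `μ - η`. For fixed
`μ` all these chords are parallel. -/
noncomputable def chord (g : ℕ) (μ η : ℝ) (u : I) : Disc := lerp (bdPt g (μ + η)) (bdPt g (μ - η)) u

theorem chord_neg (g : ℕ) (μ η : ℝ) (u : I) : chord g μ (-η) u = chord g μ η (σ u) := by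
  rw [chord, chord, lerp_symm, sub_neg_eq_add, ← sub_eq_add_neg]

@[simp] theorem chord_zero (g : ℕ) (μ η : ℝ) : chord g μ η 0 = bdPt g (μ + η) := by simp [chord]

@[simp] theorem chord_one (g : ℕ) (μ η : ℝ) : chord g μ η 1 = bdPt g (μ - η) := by simp [chord]

@[fun_prop]
theorem Continuous.chord {X : Type*} [TopologicalSpace X] {η : X → ℝ} {u : X → I} (g : ℕ) (μ : ℝ)
    (hf : Continuous η) (hu : Continuous u) : Continuous fun x => chord g μ (η x) (u x) := by
  unfold SurfaceLoops.chord
  fun_prop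

/-- The coordinate of a point of the disc with respect to the axis through the boundary point
`μ`. -/
noncomputable def rot (g : ℕ) (μ : ℝ) (z : Disc) : ℂ :=
  (z : ℂ) * (Circle.exp (-(2 * π * (μ / (4 * g)))) : ℂ)

@[fun_prop]
theorem continuous_rot (g : ℕ) (μ : ℝ) : Continuous (rot g μ) := by
  unfold rot
  fun_prop

theorem norm_rot (g : ℕ) (μ : ℝ) (z : Disc) : ‖rot g μ z‖ = ‖(z : ℂ)‖ := by
  rw [rot, norm_mul, Circle.norm_coe, mul_one]

theorem norm_disc_le (z : Disc) : ‖(z : ℂ)‖ ≤ 1 := mem_closedBall_zero_iff.1 z.2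

theorem rot_injective (g : ℕ) (μ : ℝ) : Function.Injective (rot g μ) := by
  intro z w h
  exact Subtype.ext (mul_right_cancel₀ (Circle.coe_ne_zero _) h)

theorem rot_bdPt (g : ℕ) (μ a : ℝ) :
    rot g μ (bdPt g a) = (Circle.exp (2 * π * ((a - μ) / (4 * g))) : ℂ) := by
  simp only [rot, bdPt, ← Circle.coe_mul, ← Circle.exp_add]
  congr 2
  ring

theorem exp_re (x : ℝ) : ((Circle.exp x : ℂ)).re = Real.cos x := by
  rw [Circle.coe_exp, Complex.exp_ofReal_mul_I_re]

theorem exp_im (x : ℝ) : ((Circle.exp x : ℂ)).im = Real.sin x := by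
  rw [Circle.coe_exp, Complex.exp_ofReal_mul_I_im]

theorem rot_chord_re (g : ℕ) (μ η : ℝ) (u : I) :
    (rot g μ (chord g μ η u)).re = Real.cos (2 * π * (η / (4 * g))) := by
  have : rot g μ (chord g μ η u) = (1 - (u : ℝ)) • rot g μ (bdPt g (μ + η)) +
      (u : ℝ) • rot g μ (bdPt g (μ - η)) := by
    simp only [rot, chord, lerp, Complex.real_smul]; ring
  rw [this, rot_bdPt, rot_bdPt, Complex.add_re, Complex.smul_re, Complex.smul_re, exp_re, exp_re,
    show μ + η - μ = η by ring, show μ - η - μ = -η by ring,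
    show 2 * π * (-η / (4 * g)) = -(2 * π * (η / (4 * g))) by ring, Real.cos_neg]
  simp only [smul_eq_mul]; ring

theorem rot_chord_im (g : ℕ) (μ η : ℝ) (u : I) :
    (rot g μ (chord g μ η u)).im = (1 - 2 * u) * Real.sin (2 * π * (η / (4 * g))) := by
  have : rot g μ (chord g μ η u) = (1 - (u : ℝ)) • rot g μ (bdPt g (μ + η)) +
      (u : ℝ) • rot g μ (bdPt g (μ - η)) := by
    simp only [rot, chord, lerp, Complex.real_smul]; ring
  rw [this, rot_bdPt, rot_bdPt, Complex.add_im, Complex.smul_im, Complex.smul_im, exp_im, exp_im,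
    show μ + η - μ = η by ring, show μ - η - μ = -η by ring,
    show 2 * π * (-η / (4 * g)) = -(2 * π * (η / (4 * g))) by ring, Real.sin_neg]
  simp only [smul_eq_mul]; ring

/-- The half-angle `η ∈ [0, 2g]` of the chord through `z` that is perpendicular to the axis through
the boundary point `μ`. -/
noncomputable def halfAngle (g : ℕ) (μ : ℝ) (z : Disc) : ℝ :=
  Real.arccos (rot g μ z).re * (2 * g / π)

@[fun_prop]
theorem continuous_halfAngle (g : ℕ) (μ : ℝ) : Continuous (halfAngle g μ) := by
  unfold halfAngle
  fun_prop

theorem halfAngle_nonneg (g : ℕ) (μ : ℝ) (z : Disc) : 0 ≤ halfAngle g μ z :=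
  mul_nonneg (Real.arccos_nonneg _) (by positivity)

theorem halfAngle_chord {g : ℕ} (hg : 0 < g) (μ : ℝ) {η : ℝ} (h : |η| ≤ 2 * g) (u : I) :
    halfAngle g μ (chord g μ η u) = |η| := by
  have hg' : (0 : ℝ) < g := by positivity
  rw [halfAngle, rot_chord_re, ← Real.cos_abs, Real.arccos_cos (abs_nonneg _)]
  · rw [abs_mul, abs_div, abs_of_pos (by positivity : 0 < 2 * π), abs_of_pos (by positivity :
      (0 : ℝ) < 4 * g)]
    field_simp
    ring
  · rw [abs_mul, abs_div, abs_of_pos (by positivity : 0 < 2 * π), abs_of_pos (by positivity :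
      (0 : ℝ) < 4 * g)]
    calc 2 * π * (|η| / (4 * g)) ≤ 2 * π * (2 * g / (4 * g)) := by gcongr
      _ = π := by field_simp; norm_num

theorem halfAngle_bdPt {g : ℕ} (hg : 0 < g) (μ : ℝ) {a : ℝ} (h : |a - μ| ≤ 2 * g) :
    halfAngle g μ (bdPt g a) = |a - μ| := by
  have := halfAngle_chord hg μ h 0
  rwa [chord_zero, add_sub_cancel] at this

theorem angle_halfAngle {g : ℕ} (hg : 0 < g) (μ : ℝ) (z : Disc) :
    2 * π * (halfAngle g μ z / (4 * g)) = Real.arccos (rot g μ z).re := by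
  have hg' : (0 : ℝ) < g := by positivity
  rw [halfAngle]
  field_simp
  ring

/-- The position of `z` on the chord through `z` perpendicular to the axis through `μ`. -/
noncomputable def chordParam (g : ℕ) (μ : ℝ) (z : Disc) : ℝ :=
  (1 - (rot g μ z).im / Real.sin (2 * π * (halfAngle g μ z / (4 * g)))) / 2

theorem sin_angle_pos {g : ℕ} (hg : 0 < g) {η : ℝ} (h0 : 0 < η) (h1 : η < 2 * g) :
    0 < Real.sin (2 * π * (η / (4 * g))) := by
  have hg' : (0 : ℝ) < g := by positivity
  apply Real.sin_pos_of_pos_of_lt_pi (by positivity)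
  calc 2 * π * (η / (4 * g)) < 2 * π * (2 * g / (4 * g)) := by gcongr
    _ = π := by field_simp; norm_num

theorem chordParam_chord {g : ℕ} (hg : 0 < g) (μ : ℝ) {η : ℝ} (h0 : 0 < η) (h1 : η < 2 * g)
    (u : I) : chordParam g μ (chord g μ η u) = u := by
  have := (sin_angle_pos hg h0 h1).ne'
  rw [chordParam, rot_chord_im, halfAngle_chord hg μ (by rw [abs_of_pos h0]; exact h1.le),
    abs_of_pos h0, mul_div_cancel_right₀ _ this]
  ring

theorem continuousOn_chordParam {g : ℕ} (hg : 0 < g) (μ : ℝ) :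
    ContinuousOn (chordParam g μ) {z | 0 < halfAngle g μ z ∧ halfAngle g μ z < 2 * g} := by
  unfold chordParam
  refine ((continuous_const.continuousOn.sub (ContinuousOn.div ?_ ?_ ?_)).div_const _)
  · exact (Complex.continuous_im.comp (continuous_rot g μ)).continuousOn
  · exact (by fun_prop : Continuous fun z =>
      Real.sin (2 * π * (halfAngle g μ z / (4 * g)))).continuousOn
  · rintro z ⟨h0, h1⟩
    exact (sin_angle_pos hg h0 h1).ne'

theorem exists_eq_chord {g : ℕ} (hg : 0 < g) (μ : ℝ) (z : Disc) :
    ∃ u : I, z = chord g μ (halfAngle g μ z) u := by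
  have hnorm : (rot g μ z).re ^ 2 + (rot g μ z).im ^ 2 ≤ 1 := by
    have h := norm_disc_le z
    rw [← norm_rot g μ] at h
    have h2 : ‖rot g μ z‖ ^ 2 ≤ 1 := pow_le_one₀ (norm_nonneg _) h
    rw [← Complex.normSq_eq_norm_sq, Complex.normSq_apply] at h2
    linarith
  set x := (rot g μ z).re with hx
  set y := (rot g μ z).im with hy
  have hx1 : -1 ≤ x := by nlinarith [sq_nonneg y]
  have hx2 : x ≤ 1 := by nlinarith [sq_nonneg y]
  set s := Real.sin (2 * π * (halfAngle g μ z / (4 * g))) with hs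
  have hs' : s = Real.sqrt (1 - x ^ 2) := by
    rw [hs, angle_halfAngle hg, Real.sin_arccos]
  have hys : |y| ≤ s := by
    rw [hs']
    exact Real.abs_le_sqrt (by linarith)
  have key : ∀ u : I, (1 - 2 * (u : ℝ)) * s = y → z = chord g μ (halfAngle g μ z) u := by
    intro u hu
    apply rot_injective g μ
    apply Complex.ext
    · rw [rot_chord_re, angle_halfAngle hg, Real.cos_arccos hx1 hx2]
    · rw [rot_chord_im, ← hs, hu]
  rcases (abs_nonneg y |>.trans hys).eq_or_lt with h0 | h0
  · refine ⟨0, key 0 ?_⟩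
    rw [← h0] at hys ⊢
    rw [abs_nonpos_iff.1 hys]; simp
  · have := abs_le.1 hys
    have h1 : y / s ≤ 1 := (div_le_one h0).2 this.2
    have h2 : -1 ≤ y / s := by rw [le_div_iff₀ h0]; linarith
    refine ⟨⟨(1 - y / s) / 2, by constructor <;> linarith⟩, key _ ?_⟩
    field_simp
    ring

theorem norm_chord_lt_one {g : ℕ} (hg : 0 < g) (μ : ℝ) {η : ℝ} (h0 : 0 < η) (h1 : η < 2 * g)
    {u : I} (hu0 : 0 < u) (hu1 : u < 1) : ‖(chord g μ η u : ℂ)‖ < 1 := by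
  rw [← norm_rot g μ, ← sq_lt_one_iff₀ (norm_nonneg _), ← Complex.normSq_eq_norm_sq,
    Complex.normSq_apply, rot_chord_re, rot_chord_im]
  have hs := sin_angle_pos hg h0 h1
  have hu0' : (0 : ℝ) < u := hu0
  have hu1' : (u : ℝ) < 1 := hu1
  have := Real.sin_sq_add_cos_sq (2 * π * (η / (4 * g)))
  nlinarith [mul_pos (mul_pos hs hs) (mul_pos hu0' (sub_pos.2 hu1'))]

/-! ### The side pairing -/

/-- The edge that is glued to the `k`-th edge. -/
def opp (k : ℕ) : ℕ := if k % 4 < 2 then k + 2 else k - 2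

theorem opp_opp (k : ℕ) : opp (opp k) = k := by
  unfold opp; split_ifs <;> omega

theorem opp_lt {g k : ℕ} (hk : k < 4 * g) : opp k < 4 * g := by
  unfold opp; split_ifs <;> omega

/-- The vertices of the polygon. -/
def IsVertex (g : ℕ) (z : Disc) : Prop := ∃ k : ℕ, z = bdPt g k

/-- Two points in the interior of a pair of glued edges that are identified with each other. -/
def IsPartner (g : ℕ) (z w : Disc) : Prop :=
  ∃ k : ℕ, k < 4 * g ∧ ∃ t : ℝ, 0 < t ∧ t < 1 ∧ z = bdPt g (k + t) ∧ w = bdPt g (opp k + (1 - t))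

theorem IsPartner.symm {g : ℕ} {z w : Disc} (h : IsPartner g z w) : IsPartner g w z := by
  obtain ⟨k, hk, t, h0, h1, rfl, rfl⟩ := h
  exact ⟨opp k, opp_lt hk, 1 - t, by linarith, by linarith, rfl, by rw [opp_opp]; congr 2; ring⟩

theorem IsPartner.norm_left {g : ℕ} {z w : Disc} (h : IsPartner g z w) : ‖(z : ℂ)‖ = 1 := by
  obtain ⟨k, hk, t, h0, h1, rfl, rfl⟩ := h
  exact norm_bdPt _ _

theorem IsVertex.norm {g : ℕ} {z : Disc} (h : IsVertex g z) : ‖(z : ℂ)‖ = 1 := by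
  obtain ⟨k, rfl⟩ := h
  exact norm_bdPt _ _

theorem bdPt_natCast_mod {g : ℕ} (hg : 0 < g) (k : ℕ) : bdPt g (k % (4 * g) : ℕ) = bdPt g k := by
  refine (bdPt_eq_bdPt_iff hg).2 ⟨-((k / (4 * g) : ℕ) : ℤ), ?_⟩
  have : ((k % (4 * g) + 4 * g * (k / (4 * g)) : ℕ) : ℝ) = k := by rw [Nat.mod_add_div]
  generalize k / (4 * g) = m at this ⊢
  push_cast at this ⊢
  linarith

theorem not_isVertex_bdPt {g : ℕ} (hg : 0 < g) {k : ℕ} (hk : k < 4 * g) {t : ℝ} (h0 : 0 < t)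
    (h1 : t < 1) : ¬ IsVertex g (bdPt g (k + t)) := by
  rintro ⟨l, hl⟩
  rw [← bdPt_natCast_mod hg, ← add_zero ((l % (4 * g) : ℕ) : ℝ)] at hl
  exact h0.ne' (bdPt_inj hg hk (Nat.mod_lt _ (by omega)) h0.le h1 le_rfl one_pos hl).2

theorem IsPartner.not_isVertex {g : ℕ} (hg : 0 < g) {z w : Disc} (h : IsPartner g z w) :
    ¬ IsVertex g z := by
  obtain ⟨k, hk, t, h0, h1, rfl, rfl⟩ := h
  exact not_isVertex_bdPt hg hk h0 h1

/-- The side pairing identifies all the vertices. -/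
theorem mk_bdPt_natCast {g : ℕ} (hg : 0 < g) (k : ℕ) :
    Quot.mk (Glue g) (bdPt g k) = basePoint g := by
  have aux : ∀ k : ℕ, Quot.mk (Glue g) (bdPt g k) = Quot.mk (Glue g) (edgePoint g k 0) := by
    intro k; rw [edgePoint_eq_bdPt]; simp
  rw [← bdPt_natCast_mod hg, aux]
  have hlt : k % (4 * g) < 4 * g := Nat.mod_lt _ (by omega)
  generalize k % (4 * g) = l at hlt
  obtain ⟨m, r, hr, rfl⟩ : ∃ m r, r < 4 ∧ l = 4 * m + r := ⟨l / 4, l % 4, by omega, by omega⟩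
  have hm : m < g := by omega
  have h4 := vertex_four_mul g m hm.le
  obtain ⟨h1, h2, h3⟩ := vertex_block g ⟨m, hm⟩
  have b0 := Quot.sound (Glue.b ⟨m, hm⟩ 0)
  simp only [unitInterval.symm_zero, edgePoint_one, add_assoc, Nat.reduceAdd] at b0
  simp only at h1 h2 h3
  interval_cases r
  · exact h4
  · exact h1.trans h4
  · exact h2.trans h4
  · have b1 := Quot.sound (Glue.b ⟨m, hm⟩ 1)
    simp only [unitInterval.symm_one, edgePoint_one, add_assoc, Nat.reduceAdd] at b1
    exact b1.symm.trans (h2.trans h4)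

theorem mk_edgePoint_opp {g k : ℕ} (hk : k < 4 * g) (t : I) :
    Quot.mk (Glue g) (edgePoint g (opp k) (σ t)) = Quot.mk (Glue g) (edgePoint g k t) := by
  obtain ⟨m, r, hr, rfl⟩ : ∃ m r, r < 4 ∧ k = 4 * m + r := ⟨k / 4, k % 4, by omega, by omega⟩
  have hm : m < g := by omega
  have hopp : opp (4 * m + r) = 4 * m + (if r < 2 then r + 2 else r - 2) := by
    unfold opp; split_ifs <;> omega
  rw [hopp]
  interval_cases r
  · exact (Quot.sound (Glue.a ⟨m, hm⟩ t)).symm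
  · exact (Quot.sound (Glue.b ⟨m, hm⟩ t)).symm
  · have := Quot.sound (Glue.a ⟨m, hm⟩ (σ t))
    rwa [unitInterval.symm_symm] at this
  · have := Quot.sound (Glue.b ⟨m, hm⟩ (σ t))
    rwa [unitInterval.symm_symm] at this

theorem glue_cases {g : ℕ} {z w : Disc} (h : Glue g z w) :
    ∃ k, k < 4 * g ∧ ∃ t : I, z = edgePoint g k t ∧ w = edgePoint g (opp k) (σ t) := by
  cases h with
  | a i t => exact ⟨4 * i, by omega, t, rfl, by congr 1; unfold opp; split_ifs <;> omega⟩
  | b i t => exact ⟨4 * i + 1, by omega, t, rfl, by congr 1; unfold opp; split_ifs <;> omega⟩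

theorem Glue.partner_or_vertex {g : ℕ} {z w : Disc} (h : Glue g z w) :
    IsPartner g z w ∨ (IsVertex g z ∧ IsVertex g w) := by
  obtain ⟨k, hk, t, rfl, rfl⟩ := glue_cases h
  rcases eq_or_ne t 0 with rfl | h0
  · refine Or.inr ⟨⟨k, ?_⟩, ⟨opp k + 1, ?_⟩⟩
    · simp [edgePoint_eq_bdPt]
    · simp [edgePoint_eq_bdPt]
  rcases eq_or_ne t 1 with rfl | h1
  · refine Or.inr ⟨⟨k + 1, ?_⟩, ⟨opp k, ?_⟩⟩
    · simp [edgePoint_eq_bdPt]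
    · simp [edgePoint_eq_bdPt]
  exact Or.inl ⟨k, hk, t, unitInterval.pos_iff_ne_zero.2 h0, unitInterval.lt_one_iff_ne_one.2 h1,
    rfl, rfl⟩

/-- Two points of the polygon are identified only if they are equal, or partners on two glued
edges, or both vertices. -/
theorem mk_eq_mk {g : ℕ} (hg : 0 < g) {z w : Disc}
    (h : Quot.mk (Glue g) z = Quot.mk (Glue g) w) :
    z = w ∨ IsPartner g z w ∨ (IsVertex g z ∧ IsVertex g w) := by
  have h' := Quot.eqvGen_exact h
  induction h' with
  | rel x y hxy => exact Or.inr hxy.partner_or_vertex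
  | refl x => exact Or.inl rfl
  | symm x y hxy ih =>
    rcases ih h.symm with ih | ih | ih
    · exact Or.inl ih.symm
    · exact Or.inr (Or.inl ih.symm)
    · exact Or.inr (Or.inr ih.symm)
  | trans x y z hxy hyz ih1 ih2 =>
    rcases ih1 (Quot.eqvGen_sound hxy) with rfl | h1 | h1
    · exact ih2 h
    · rcases ih2 (Quot.eqvGen_sound hyz) with rfl | h2 | h2
      · exact Or.inr (Or.inl h1)
      · obtain ⟨k, hk, t, ht0, ht1, rfl, hy⟩ := h1
        obtain ⟨l, hl, s, hs0, hs1, hy', rfl⟩ := h2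
        rw [hy] at hy'
        obtain ⟨rfl, rfl⟩ := bdPt_inj hg (opp_lt hk) hl (by linarith) (by linarith) hs0.le hs1 hy'
        left
        rw [opp_opp, sub_sub_cancel]
      · exact absurd h2.1 (h1.symm.not_isVertex hg)
    · rcases ih2 (Quot.eqvGen_sound hyz) with rfl | h2 | h2
      · exact Or.inr (Or.inr h1)
      · exact absurd h1.2 (h2.not_isVertex hg)
      · exact Or.inr (Or.inr ⟨h1.1, h2.2⟩)

theorem eq_of_mk_eq_mk {g : ℕ} (hg : 0 < g) {z w : Disc} (hz : ‖(z : ℂ)‖ < 1)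
    (h : Quot.mk (Glue g) z = Quot.mk (Glue g) w) : z = w := by
  rcases mk_eq_mk hg h with h | h | h
  · exact h
  · exact absurd h.norm_left hz.ne
  · exact absurd h.1.norm hz.ne

/-- The two preimages of a point in the interior of an edge. -/
theorem eq_or_eq_of_mk_eq_mk_bdPt {g : ℕ} (hg : 0 < g) {k : ℕ} (hk : k < 4 * g) {t : ℝ}
    (h0 : 0 < t) (h1 : t < 1) {z : Disc}
    (h : Quot.mk (Glue g) (bdPt g (k + t)) = Quot.mk (Glue g) z) :
    z = bdPt g (k + t) ∨ z = bdPt g (opp k + (1 - t)) := by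
  rcases mk_eq_mk hg h with h | h | h
  · exact Or.inl h.symm
  · obtain ⟨l, hl, s, hs0, hs1, h', rfl⟩ := h
    obtain ⟨rfl, rfl⟩ := bdPt_inj hg hk hl h0.le h1 hs0.le hs1 h'
    exact Or.inr rfl
  · exact absurd h.1 (not_isVertex_bdPt hg hk h0 h1)

/-! ### Classes of chords in the fundamental group -/

section PathClasses

open FundamentalGroup

variable {X Y Z : Type*} [TopologicalSpace X] [TopologicalSpace Y] [TopologicalSpace Z]

instance : ContractibleSpace Disc :=
  (convex_closedBall (0 : ℂ) 1).contractibleSpace ⟨0, by simp⟩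

instance : ContractibleSpace I := (convex_Icc (0 : ℝ) 1).contractibleSpace ⟨0, by simp⟩

instance : ContractibleSpace (I × ℝ) :=
  have : ContractibleSpace ((Set.Icc (0 : ℝ) 1 ×ˢ Set.univ : Set (ℝ × ℝ))) :=
    ((convex_Icc (0 : ℝ) 1).prod convex_univ).contractibleSpace ⟨(0, 0), by simp⟩
  ((Homeomorph.Set.prod _ _).trans
    ((Homeomorph.refl I).prodCongr (Homeomorph.Set.univ ℝ))).symm.contractibleSpace

/-- If `F : Y → X` maps the two points `y₀` and `y₁` of the simply connected space `Y` to the base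
point `x`, then all paths from `y₀` to `y₁` have the same class in `π₁(X, x)`; this is that
class. -/
noncomputable def pathCls [SimplyConnectedSpace Y] (F : C(Y, X)) {x : X} {y₀ y₁ : Y}
    (h₀ : F y₀ = x) (h₁ : F y₁ = x) : FundamentalGroup X x :=
  fromPath (Path.Homotopic.Quotient.mk
    (((PathConnectedSpace.somePath y₀ y₁).map F.continuous).cast h₀.symm h₁.symm))

variable [SimplyConnectedSpace Y] (F : C(Y, X)) {x : X} {y₀ y₁ y₂ : Y}

/-- Every loop that lifts to a path from `y₀` to `y₁` has the class `pathCls F h₀ h₁`. -/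
theorem fromPath_eq_pathCls (h₀ : F y₀ = x) (h₁ : F y₁ = x) (L : Path x x) (p : Path y₀ y₁)
    (h : ∀ t, L t = F (p t)) :
    fromPath (Path.Homotopic.Quotient.mk L) = pathCls F h₀ h₁ := by
  have hL : L = (p.map F.continuous).cast h₀.symm h₁.symm := Path.ext (funext h)
  rw [hL]
  exact Path.Homotopic.Quotient.eq.2
    (((SimplyConnectedSpace.paths_homotopic _ _).map F).pathCast _ _)

/-- In Mathlib's fundamental group `p * q` is the class of `q` followed by `p`. -/
theorem pathCls_mul (h₀ : F y₀ = x) (h₁ : F y₁ = x) (h₂ : F y₂ = x) :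
    pathCls F h₁ h₂ * pathCls F h₀ h₁ = pathCls F h₀ h₂ := by
  set p := PathConnectedSpace.somePath y₀ y₁
  set q := PathConnectedSpace.somePath y₁ y₂
  rw [← fromPath_eq_pathCls F h₀ h₂ ((((p.trans q)).map F.continuous).cast h₀.symm h₂.symm)
    (p.trans q) (fun _ => rfl), pathCls, pathCls, FundamentalGroup.mul_def]
  refine (Path.Homotopic.Quotient.mk_trans _ _).symm.trans (congrArg _ ?_)
  subst h₁
  rw [Path.map_trans]
  rfl

theorem pathCls_self (h₀ : F y₀ = x) (h₀' : F y₀ = x) : pathCls F h₀ h₀' = 1 :=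
  mul_left_cancel ((pathCls_mul F h₀ h₀' h₀').trans (mul_one _).symm)

theorem pathCls_inv (h₀ : F y₀ = x) (h₁ : F y₁ = x) :
    (pathCls F h₀ h₁)⁻¹ = pathCls F h₁ h₀ := by
  rw [inv_eq_iff_mul_eq_one, pathCls_mul, pathCls_self]

theorem mapOfEq_fromPath (f : C(X, Z)) {z : Z} (hf : f x = z) (L : Path x x) :
    mapOfEq f hf (fromPath (Path.Homotopic.Quotient.mk L)) =
      fromPath (Path.Homotopic.Quotient.mk ((L.map f.continuous).cast hf.symm hf.symm)) := by
  rw [mapOfEq_apply]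
  rfl

end PathClasses

/-- The projection of the polygon onto the surface. -/
def proj (g : ℕ) : C(Disc, Surface g) := ⟨Quot.mk _, continuous_quot_mk⟩

theorem proj_bdPt {g : ℕ} (hg : 0 < g) (k : ℕ) : proj g (bdPt g k) = basePoint g :=
  mk_bdPt_natCast hg k

/-- The class in `π₁(Σ_g)` of the chord of the polygon from the vertex `k` to the vertex `l`. -/
noncomputable def chordCls {g : ℕ} (hg : 0 < g) (k l : ℕ) : PiOne g :=
  pathCls (proj g) (proj_bdPt hg k) (proj_bdPt hg l)

/-- Classes of chords compose in the order of Mathlib's fundamental group: the right factor is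
traversed first. -/
theorem chordCls_mul {g : ℕ} (hg : 0 < g) (k l m : ℕ) :
    chordCls hg l m * chordCls hg k l = chordCls hg k m := pathCls_mul _ _ _ _

theorem chordCls_inv {g : ℕ} (hg : 0 < g) (k l : ℕ) : (chordCls hg k l)⁻¹ = chordCls hg l k :=
  pathCls_inv _ _ _

/-- The `k`-th edge as a path in the polygon. -/
noncomputable def edgePath (g k : ℕ) : Path (bdPt g k) (bdPt g (k + 1 : ℕ)) where
  toFun t := edgePoint g k t
  continuous_toFun := continuous_edgePoint g k
  source' := by simp [edgePoint_eq_bdPt]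
  target' := by simp [edgePoint_eq_bdPt]

theorem chordCls_a {g : ℕ} (hg : 0 < g) (i : Fin g) :
    chordCls hg (4 * i) (4 * i + 1) = aClass g i :=
  (fromPath_eq_pathCls (proj g) _ _ (aLoop g i) (edgePath g (4 * i)) fun _ => rfl).symm

theorem chordCls_b {g : ℕ} (hg : 0 < g) (i : Fin g) :
    chordCls hg (4 * i + 1) (4 * i + 2) = bClass g i :=
  (fromPath_eq_pathCls (proj g) _ _ (bLoop g i) (edgePath g (4 * i + 1)) fun _ => rfl).symm

theorem chordCls_a' {g : ℕ} (hg : 0 < g) (i : Fin g) :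
    chordCls hg (4 * i + 2) (4 * i + 3) = (aClass g i)⁻¹ := by
  rw [← chordCls_inv, inv_inj]
  exact (fromPath_eq_pathCls (proj g) _ _ (aLoop g i) (edgePath g (4 * i + 2)).symm fun t =>
    Quot.sound (Glue.a i t)).symm

theorem chordCls_b' {g : ℕ} (hg : 0 < g) (i : Fin g) :
    chordCls hg (4 * i + 3) (4 * i + 4) = (bClass g i)⁻¹ := by
  rw [← chordCls_inv, inv_inj]
  exact (fromPath_eq_pathCls (proj g) _ _ (bLoop g i) (edgePath g (4 * i + 3)).symm fun t =>
    Quot.sound (Glue.b i t)).symm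

section Commuting

variable {g : ℕ} (hg : 0 < g) {G : Type*} [Group G] (ρ : PiOne g →* G)

/-- If the images of `a_i` and `b_i` commute, then the blocks `a_i b_i a_i⁻¹ b_i⁻¹` of the boundary
word have trivial image. Hence so has a chord from the vertex `0` to the end of a block, and the
image of the chord to any other vertex depends only on `a_i` and `b_i` for the block of that
vertex. -/
theorem map_chordCls_zero (m : ℕ) (hm : m ≤ g)
    (h : ∀ i : Fin g, (i : ℕ) < m → Commute (ρ (aClass g i)) (ρ (bClass g i))) :
    ρ (chordCls hg 0 (4 * m)) = 1 := by
  induction m with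
  | zero => rw [chordCls, Nat.mul_zero, pathCls_self, map_one]
  | succ m ih =>
    have ih := ih (by omega) fun i hi => h i (by omega)
    have hc := h ⟨m, hm⟩ (Nat.lt_succ_self m)
    rw [show 4 * (m + 1) = 4 * m + 4 by ring, ← chordCls_mul hg 0 (4 * m + 3),
      ← chordCls_mul hg 0 (4 * m + 2), ← chordCls_mul hg 0 (4 * m + 1), ← chordCls_mul hg 0 (4 * m),
      map_mul, map_mul, map_mul, map_mul, ih, chordCls_a hg ⟨m, hm⟩, chordCls_b hg ⟨m, hm⟩,
      chordCls_a' hg ⟨m, hm⟩, chordCls_b' hg ⟨m, hm⟩, map_inv, map_inv, mul_one, ← hc.eq,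
      inv_mul_cancel_left, inv_mul_cancel]

variable (i : Fin g) (h : ∀ j : Fin g, (j : ℕ) < i → Commute (ρ (aClass g j)) (ρ (bClass g j)))

include h

theorem map_chordCls_one : ρ (chordCls hg 0 (4 * i + 1)) = ρ (aClass g i) := by
  rw [← chordCls_mul hg 0 (4 * i), map_mul, map_chordCls_zero hg ρ i i.2.le h, chordCls_a, mul_one]

theorem map_chordCls_two :
    ρ (chordCls hg 0 (4 * i + 2)) = ρ (bClass g i) * ρ (aClass g i) := by
  rw [← chordCls_mul hg 0 (4 * i + 1), map_mul, map_chordCls_one hg ρ i h, chordCls_b]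

theorem map_chordCls_three :
    ρ (chordCls hg 0 (4 * i + 3)) = (ρ (aClass g i))⁻¹ * (ρ (bClass g i) * ρ (aClass g i)) := by
  rw [← chordCls_mul hg 0 (4 * i + 2), map_mul, map_chordCls_two hg ρ i h, chordCls_a', map_inv]

end Commuting

/-! ### Dehn twists along annuli made of strips -/

section Twist

open Topology

theorem periodic_int {X : Type*} {Λ : I × ℝ → X} (hper : ∀ t v, Λ (t, v + 1) = Λ (t, v)) (t : I)
    (v : ℝ) (m : ℤ) : Λ (t, v + m) = Λ (t, v) := by
  have h : Function.Periodic (fun v => Λ (t, v)) 1 := fun v => hper t v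
  simpa using h.int_mul m v

/-- A continuous function on a compact space mapped into a Hausdorff space induces a continuous
function on the image. -/
theorem continuousOn_range_of_comp {K D X : Type*} [TopologicalSpace K] [CompactSpace K]
    [TopologicalSpace D] [T2Space D] [TopologicalSpace X] {c : K → D} (hc : Continuous c)
    {f : D → X} (hf : Continuous (f ∘ c)) : ContinuousOn f (Set.range c) := by
  rw [continuousOn_iff_isClosed]
  intro t ht
  refine ⟨c '' ((f ∘ c) ⁻¹' t), ((ht.preimage hf).isCompact.image hc).isClosed, ?_⟩
  ext z
  constructor
  · rintro ⟨h1, x, rfl⟩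
    exact ⟨⟨x, h1, rfl⟩, x, rfl⟩
  · rintro ⟨⟨x, hx, rfl⟩, -⟩
    exact ⟨hx, x, rfl⟩

variable {D X ι : Type*} [TopologicalSpace D] [T2Space D] [TopologicalSpace X] [Finite ι]

/-- The data of an annulus `Λ` in the quotient space `X` of `D` (with the circle parametrised by
`ℝ / ℤ`) which is covered by finitely many strips `c k` in `D`. The strips may only be glued to each
other along their ends, and the open annulus has to be open. -/
structure StripAnnulus (q : C(D, X)) (ι : Type*) where
  /-- The strips. -/
  c : ι → C(I × I, D)
  /-- The position of the points of a strip on the circle. -/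
  w : ι → I → ℝ
  /-- The annulus, as a map that is periodic in the second variable. -/
  Λ : C(I × ℝ, X)
  /-- The union of the strips without the boundary of the annulus. -/
  S : Set D
  continuous_w : ∀ k, Continuous (w k)
  periodic : ∀ t v, Λ (t, v + 1) = Λ (t, v)
  proj_c : ∀ k t u, q (c k (t, u)) = Λ (t, w k u)
  exists_w : ∀ v : ℝ, ∃ k u, ∃ m : ℤ, v = w k u + m
  isOpen_S : IsOpen S
  mem_S : ∀ z, z ∈ S ↔ ∃ k t u, 0 < t ∧ t < 1 ∧ z = c k (t, u)
  inj : ∀ k t u k' t' u', 0 < t → t < 1 → c k (t, u) = c k' (t', u') → t' = t ∧ k' = k ∧ u' = u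
  saturated : ∀ k t u z, 0 < t → t < 1 → q (c k (t, u)) = q z →
    ∃ k' u', z = c k' (t, u') ∧ ∃ m : ℤ, w k' u' = w k u + m

namespace StripAnnulus

variable {q : C(D, X)} (A : StripAnnulus q ι)

omit [T2Space D] [Finite ι] in
/-- On the open annulus, `Λ` is injective up to the period. -/
theorem Λ_inj {t t' : I} {v v' : ℝ} (h0 : 0 < t) (h1 : t < 1) (h : A.Λ (t, v) = A.Λ (t', v')) :
    t' = t ∧ ∃ m : ℤ, v' = v + m := by
  obtain ⟨k, u, m, rfl⟩ := A.exists_w v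
  obtain ⟨k', u', m', rfl⟩ := A.exists_w v'
  rw [periodic_int A.periodic, periodic_int A.periodic, ← A.proj_c, ← A.proj_c] at h
  obtain ⟨k'', u'', h2, m'', h3⟩ := A.saturated _ _ _ _ h0 h1 h
  obtain ⟨rfl, rfl, rfl⟩ := A.inj _ _ _ _ _ _ h0 h1 h2.symm
  exact ⟨rfl, m'' + m' - m, by rw [h3]; push_cast; ring⟩

omit [T2Space D] [Finite ι] in
theorem proj_mem {z : D} {t : I} {v : ℝ} (h0 : 0 < t) (h1 : t < 1) (h : A.Λ (t, v) = q z) :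
    z ∈ A.S := by
  obtain ⟨k, u, m, rfl⟩ := A.exists_w v
  rw [periodic_int A.periodic, ← A.proj_c] at h
  obtain ⟨k', u', rfl, -⟩ := A.saturated _ _ _ _ h0 h1 h
  exact (A.mem_S _).2 ⟨_, _, _, h0, h1, rfl⟩

open Classical in
/-- The `m`-fold Dehn twist along an annulus, as a function. -/
noncomputable def twistFun (m : ℤ) (x : X) : X :=
  if h : ∃ p : I × ℝ, 0 < p.1 ∧ p.1 < 1 ∧ x = A.Λ p then
    A.Λ (h.choose.1, h.choose.2 + m * h.choose.1) else x

omit [T2Space D] [Finite ι] in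
theorem twistFun_proj (m : ℤ) {z : D} (hz : z ∉ A.S) : A.twistFun m (q z) = q z := by
  refine dif_neg ?_
  rintro ⟨p, h0, h1, h⟩
  exact hz (A.proj_mem h0 h1 h.symm)

omit [T2Space D] [Finite ι] in
/-- The formula for the twist holds on the closed annulus: at its two boundary circles it rotates by
whole turns, and so it is compatible with the identity outside. -/
theorem twistFun_Λ (m : ℤ) (t : I) (v : ℝ) : A.twistFun m (A.Λ (t, v)) = A.Λ (t, v + m * t) := by
  by_cases ht : 0 < t ∧ t < 1
  · have h : ∃ p : I × ℝ, 0 < p.1 ∧ p.1 < 1 ∧ A.Λ (t, v) = A.Λ p := ⟨(t, v), ht.1, ht.2, rfl⟩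
    rw [twistFun, dif_pos h]
    obtain ⟨h3, n, h4⟩ : h.choose.1 = t ∧ ∃ n : ℤ, h.choose.2 = v + n :=
      A.Λ_inj ht.1 ht.2 h.choose_spec.2.2
    rw [h3, h4, show v + n + m * (t : ℝ) = v + m * t + n by ring, periodic_int A.periodic]
  · obtain ⟨k, u, n, rfl⟩ := A.exists_w v
    have hS : A.c k (t, u) ∉ A.S := by
      rw [A.mem_S]
      rintro ⟨k', t', u', h0, h1, h⟩
      obtain ⟨rfl, -⟩ := A.inj _ _ _ _ _ _ h0 h1 h.symm
      exact ht ⟨h0, h1⟩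
    rw [periodic_int A.periodic, ← A.proj_c, A.twistFun_proj m hS, A.proj_c]
    have ht' : t = 0 ∨ t = 1 := by
      rcases eq_or_ne t 0 with h | h
      · exact Or.inl h
      · refine Or.inr (by_contra fun h' => ht ⟨unitInterval.pos_iff_ne_zero.2 h,
          unitInterval.lt_one_iff_ne_one.2 h'⟩)
    rcases ht' with rfl | rfl
    · simp only [Set.Icc.coe_zero, mul_zero, add_zero]
      rw [periodic_int A.periodic]
    · simp only [Set.Icc.coe_one, mul_one]
      rw [periodic_int A.periodic, periodic_int A.periodic]

/-- The twist is continuous because it is the identity outside the open annulus and continuous on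
each of the finitely many closed strips. -/
theorem continuous_twistFun (hq : IsQuotientMap q) (m : ℤ) : Continuous (A.twistFun m) := by
  rw [hq.continuous_iff]
  let s : Option ι → Set D := fun o => o.elim A.Sᶜ fun k => Set.range (A.c k)
  have hs : LocallyFinite s := locallyFinite_of_finite s
  refine hs.continuous (Set.eq_univ_of_forall fun z => ?_) ?_ ?_
  · by_cases hz : z ∈ A.S
    · obtain ⟨k, t, u, -, -, rfl⟩ := (A.mem_S z).1 hz
      exact Set.mem_iUnion.2 ⟨some k, ⟨(t, u), rfl⟩⟩
    · exact Set.mem_iUnion.2 ⟨none, hz⟩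
  · rintro (_ | k)
    · exact A.isOpen_S.isClosed_compl
    · exact (isCompact_range (A.c k).continuous).isClosed
  · rintro (_ | k)
    · exact q.continuous.continuousOn.congr fun z hz => A.twistFun_proj m hz
    · refine continuousOn_range_of_comp (A.c k).continuous ?_
      have : (A.twistFun m ∘ q) ∘ A.c k = fun p : I × I => A.Λ (p.1, A.w k p.2 + m * p.1) := by
        funext ⟨t, u⟩
        simp only [Function.comp_apply, A.proj_c, A.twistFun_Λ]
      rw [this]
      have := A.continuous_w k
      fun_prop

omit [T2Space D] [Finite ι] in
theorem twistFun_neg (hq : IsQuotientMap q) (m : ℤ) (x : X) :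
    A.twistFun (-m) (A.twistFun m x) = x := by
  obtain ⟨z, rfl⟩ := hq.surjective x
  by_cases hz : z ∈ A.S
  · obtain ⟨k, t, u, -, -, rfl⟩ := (A.mem_S z).1 hz
    rw [A.proj_c, A.twistFun_Λ, A.twistFun_Λ]
    push_cast
    rw [neg_mul, add_neg_cancel_right]
  · rw [A.twistFun_proj _ hz, A.twistFun_proj _ hz]

/-- The `m`-fold Dehn twist along an annulus: on the annulus, the circle with parameter `t` is
rotated by `m t` full turns. -/
noncomputable def twist (hq : IsQuotientMap q) (m : ℤ) : X ≃ₜ X where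
  toFun := A.twistFun m
  invFun := A.twistFun (-m)
  left_inv := A.twistFun_neg hq m
  right_inv x := by simpa using A.twistFun_neg hq (-m) x
  continuous_toFun := A.continuous_twistFun hq m
  continuous_invFun := A.continuous_twistFun hq (-m)

theorem twist_Λ (hq : IsQuotientMap q) (m : ℤ) (t : I) (v : ℝ) :
    A.twist hq m (A.Λ (t, v)) = A.Λ (t, v + m * t) := A.twistFun_Λ m t v

theorem twist_proj (hq : IsQuotientMap q) (m : ℤ) {z : D} (hz : z ∉ A.S) :
    A.twist hq m (q z) = q z := A.twistFun_proj m hz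

open FundamentalGroup

omit [T2Space D] [Finite ι] in
/-- The class of a circle of the annulus through the base point, run through `m` times. -/
theorem pathCls_Λ_zpow {x : X} {t : I} {v : ℝ} (h : ∀ m : ℤ, A.Λ (t, v + m) = x) (m : ℤ) :
    pathCls A.Λ (y₀ := (t, v)) (y₁ := (t, v + m)) (by simpa using h 0) (h m) =
      pathCls A.Λ (y₀ := (t, v)) (y₁ := (t, v + 1)) (by simpa using h 0)
        (by simpa using h 1) ^ m := by
  have shift : ∀ (a b c d : ℝ) (ha : A.Λ (t, a) = x) (hb : A.Λ (t, b) = x) (hc : A.Λ (t, c) = x)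
      (hd : A.Λ (t, d) = x) (n : ℤ), c = a + n → d = b + n →
      pathCls A.Λ hc hd = pathCls A.Λ ha hb := by
    rintro a b c d ha hb hc hd n rfl rfl
    let F : C(I × ℝ, I × ℝ) := ⟨fun p => (p.1, p.2 + n), by fun_prop⟩
    let p : Path (t, a) (t, b) := PathConnectedSpace.somePath _ _
    rw [← fromPath_eq_pathCls A.Λ ha hb ((p.map A.Λ.continuous).cast ha.symm hb.symm) p
      fun _ => rfl]
    refine (fromPath_eq_pathCls A.Λ hc hd _ (p.map F.continuous) fun s => ?_).symm
    exact (periodic_int A.periodic _ _ n).symm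
  have hnat : ∀ n : ℕ, pathCls A.Λ (y₀ := (t, v)) (y₁ := (t, v + n)) (by simpa using h 0)
      (by simpa using h n) = pathCls A.Λ (y₀ := (t, v)) (y₁ := (t, v + 1)) (by simpa using h 0)
        (by simpa using h 1) ^ n := by
    intro n
    induction n with
    | zero =>
      rw [pow_zero]
      simp only [Nat.cast_zero, add_zero]
      exact pathCls_self _ _ _
    | succ n ih =>
      rw [pow_succ', ← ih, ← pathCls_mul A.Λ _ (by simpa using h n : A.Λ (t, v + n) = x)]
      congr 1
      exact shift _ _ _ _ _ _ _ _ n rfl (by push_cast; ring)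
  obtain ⟨n, rfl | rfl⟩ := m.eq_nat_or_neg
  · simpa using hnat n
  · rw [zpow_neg, zpow_natCast, ← hnat n, pathCls_inv]
    exact (shift _ _ _ _ _ _ _ _ (-n) (by push_cast; ring) (by push_cast; ring))

/-- The effect of a Dehn twist on a loop that crosses the annulus once, along the segment with
position `v`: the loop is followed by `m` turns along the circle with parameter `1`, which passes
through the base point. -/
theorem mapOfEq_twist (hq : IsQuotientMap q) (m : ℤ) {x : X} (hx : A.twist hq m x = x) {v : ℝ}
    (h0 : A.Λ (0, v) = x) (h1 : A.Λ (1, v) = x) (L : Path x x) (hL : ∀ t, L t = A.Λ (t, v)) :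
    mapOfEq (A.twist hq m : C(X, X)) hx (fromPath (Path.Homotopic.Quotient.mk L)) =
      pathCls A.Λ h1 ((A.periodic 1 v).trans h1) ^ m *
        fromPath (Path.Homotopic.Quotient.mk L) := by
  have h : ∀ m : ℤ, A.Λ (1, v + m) = x := fun m => (periodic_int A.periodic _ _ m).trans h1
  let p : Path ((0 : I), v) ((1 : I), v) :=
    ⟨⟨fun t => (t, v), by fun_prop⟩, rfl, rfl⟩
  let p' : Path ((0 : I), v) ((1 : I), v + m) :=
    ⟨⟨fun t => (t, v + m * t), by fun_prop⟩, by simp, by simp⟩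
  rw [mapOfEq_fromPath, fromPath_eq_pathCls A.Λ h0 h1 L p hL,
    fromPath_eq_pathCls A.Λ h0 (h m) _ p' (fun t => ?_), ← A.pathCls_Λ_zpow h m, pathCls_mul]
  change A.twist hq m (L t) = _
  rw [hL, A.twist_Λ]
  rfl

omit [T2Space D] [Finite ι] in
/-- The class of the part of a circle of the annulus inside one strip. -/
theorem pathCls_strip [SimplyConnectedSpace D] {x : X} (k : ι) (t : I) (n : ℤ) {a b : ℝ}
    (ha : a = A.w k 0 + n) (hb : b = A.w k 1 + n)
    (h0 : A.Λ (t, a) = x) (h1 : A.Λ (t, b) = x)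
    (h0' : q (A.c k (t, 0)) = x) (h1' : q (A.c k (t, 1)) = x) :
    pathCls A.Λ h0 h1 = pathCls q h0' h1' := by
  subst ha hb
  have := A.continuous_w k
  let p : Path (A.c k (t, 0)) (A.c k (t, 1)) := ⟨⟨fun u => A.c k (t, u), by fun_prop⟩, rfl, rfl⟩
  let p' : Path (t, A.w k 0 + n) (t, A.w k 1 + n) :=
    ⟨⟨fun u => (t, A.w k u + n), by fun_prop⟩, rfl, rfl⟩
  rw [← fromPath_eq_pathCls q h0' h1' ((p.map q.continuous).cast h0'.symm h1'.symm) p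
    fun _ => rfl]
  refine (fromPath_eq_pathCls A.Λ h0 h1 _ p' fun u => ?_).symm
  change q (A.c k (t, u)) = A.Λ (t, A.w k u + n)
  rw [periodic_int A.periodic, A.proj_c]

end StripAnnulus

end Twist

/-! ### Annuli in the surface -/

section SurfaceAnnuli

open Topology

theorem isQuotientMap_proj (g : ℕ) : IsQuotientMap (proj g) := isQuotientMap_quot_mk

/-- A chord that does not degenerate to a point is traversed injectively. -/
theorem chord_param_inj {g : ℕ} (hg : 0 < g) (μ : ℝ) {η : ℝ} (h0 : 0 < |η|)
    (h1 : |η| < 2 * g) {u v : I} (h : chord g μ η u = chord g μ η v) : u = v := by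
  rcases lt_or_gt_of_ne (abs_pos.1 h0) with hη | hη
  · rw [abs_of_neg hη] at h0 h1
    have hn : ∀ u, chord g μ η u = chord g μ (-η) (σ u) := fun u => by
      rw [chord_neg, unitInterval.symm_symm]
    rw [hn u, hn v] at h
    have h' := congrArg (chordParam g μ) h
    rw [chordParam_chord hg μ h0 h1, chordParam_chord hg μ h0 h1] at h'
    exact unitInterval.symm_bijective.1 (Subtype.ext h')
  · rw [abs_of_pos hη] at h0 h1
    have h' := congrArg (chordParam g μ) h
    rw [chordParam_chord hg μ h0 h1, chordParam_chord hg μ h0 h1] at h'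
    exact Subtype.ext h'

theorem norm_chord_lt_one' {g : ℕ} (hg : 0 < g) (μ : ℝ) {η : ℝ} (h0 : 0 < |η|)
    (h1 : |η| < 2 * g) {u : I} (hu0 : 0 < u) (hu1 : u < 1) : ‖(chord g μ η u : ℂ)‖ < 1 := by
  rcases lt_or_gt_of_ne (abs_pos.1 h0) with hη | hη
  · rw [abs_of_neg hη] at h0 h1
    rw [← neg_neg η, chord_neg]
    refine norm_chord_lt_one hg μ h0 h1 ?_ ?_
    · rw [unitInterval.pos_iff_ne_zero]
      intro h
      exact hu1.ne (by simpa using congrArg σ h)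
    · rw [unitInterval.lt_one_iff_ne_one]
      intro h
      exact hu0.ne' (by simpa using congrArg σ h)
  · rw [abs_of_pos hη] at h0 h1
    exact norm_chord_lt_one hg μ h0 h1 hu0 hu1

/-- A closed chain of parallel strips in the `4g`-gon. The `k`-th strip consists of the chords
perpendicular to the axis through `μ` with (signed) half-angle `η k - t`, for `0 ≤ t ≤ 1`. It ends
on the edge `e k` (one of the edges that are labelled by a letter, not by its inverse), and the next
strip begins on the edge `e k + 2` that is glued to it. -/
structure StripChain (g : ℕ) (ι : Type*) where
  /-- The axis. -/
  μ : ℝ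
  /-- The half-angles at `t = 0`. -/
  η : ι → ℝ
  /-- The edges crossed by the chain. -/
  e : ι → ℕ
  /-- The strip that follows a given strip. -/
  next : Equiv.Perm ι
  e_lt : ∀ k, e k < 4 * g
  e_mod : ∀ k, e k % 4 < 2
  add_η : ∀ k, μ + η (next k) = e k + 3
  sub_η : ∀ k, μ - η k = e k
  η_sign : ∀ k, 1 ≤ η k ∨ η k ≤ 0
  η_le : ∀ k, η k ≤ 2 * g ∧ 1 - η k ≤ 2 * g
  η_inj : ∀ k k' (t t' : ℝ), 0 < t → t < 1 → 0 ≤ t' → t' ≤ 1 → |η k - t| = |η k' - t'| →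
    k' = k ∧ t' = t

namespace StripChain

variable {g : ℕ} {ι : Type*} (K : StripChain g ι)

theorem abs_le (k : ι) {t : ℝ} (h0 : 0 ≤ t) (h1 : t ≤ 1) : |K.η k - t| ≤ 2 * g := by
  have := K.η_le k
  rw [_root_.abs_le]
  constructor <;> linarith

theorem abs_pos (k : ι) {t : ℝ} (h0 : 0 < t) (h1 : t < 1) : 0 < |K.η k - t| := by
  rw [_root_.abs_pos]
  rcases K.η_sign k with h | h
  · linarith
  · exact (by linarith : K.η k - t < 0).ne

theorem abs_lt (k : ι) {t : ℝ} (h0 : 0 < t) (h1 : t < 1) : |K.η k - t| < 2 * g := by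
  have := K.η_le k
  rw [_root_.abs_lt]
  constructor <;> linarith

theorem opp_e (k : ι) : opp (K.e k) = K.e k + 2 := by
  have := K.e_mod k
  unfold opp; split_ifs; rfl

/-- The strips of the chain. -/
noncomputable def strip (k : ι) : C(I × I, Disc) :=
  ⟨fun p => chord g K.μ (K.η k - p.1) p.2, by fun_prop⟩

theorem strip_apply (k : ι) (t u : I) : K.strip k (t, u) = chord g K.μ (K.η k - t) u := rfl

theorem strip_one (k : ι) (t : I) : K.strip k (t, 1) = edgePoint g (K.e k) t := by
  rw [strip_apply, chord_one, edgePoint_eq_bdPt]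
  congr 1
  linarith [K.sub_η k]

theorem strip_next_zero (k : ι) (t : I) :
    K.strip (K.next k) (t, 0) = edgePoint g (opp (K.e k)) (σ t) := by
  rw [strip_apply, chord_zero, edgePoint_eq_bdPt, K.opp_e]
  congr 1
  push_cast
  rw [unitInterval.coe_symm_eq]
  linarith [K.add_η k]

theorem proj_strip_next (k : ι) (t : I) :
    proj g (K.strip (K.next k) (t, 0)) = proj g (K.strip k (t, 1)) := by
  rw [strip_one, strip_next_zero]
  exact mk_edgePoint_opp (K.e_lt k) t

/-- The union of the strips without the boundary of the annulus. -/
def carrier : Set Disc := {z | ∃ k, ∃ t u : I, 0 < t ∧ t < 1 ∧ z = K.strip k (t, u)}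

/-- Membership in the open annulus is a condition on the half-angle alone, because the strips
consist of whole chords. -/
theorem mem_carrier_iff (hg : 0 < g) (z : Disc) :
    z ∈ K.carrier ↔ ∃ k, ∃ t : ℝ, 0 < t ∧ t < 1 ∧ halfAngle g K.μ z = |K.η k - t| := by
  constructor
  · rintro ⟨k, t, u, h0, h1, rfl⟩
    exact ⟨k, t, h0, h1, halfAngle_chord hg _ (K.abs_le k t.2.1 t.2.2) _⟩
  · rintro ⟨k, t, h0, h1, h⟩
    obtain ⟨u, hu⟩ := exists_eq_chord hg K.μ z
    rw [h] at hu
    rcases abs_choice (K.η k - t) with h' | h'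
    · rw [h'] at hu
      exact ⟨k, ⟨t, h0.le, h1.le⟩, u, h0, h1, hu⟩
    · rw [h', chord_neg] at hu
      exact ⟨k, ⟨t, h0.le, h1.le⟩, σ u, h0, h1, hu⟩

theorem isOpen_carrier (hg : 0 < g) : IsOpen K.carrier := by
  have hset : IsOpen {H : ℝ | ∃ k, ∃ t : ℝ, 0 < t ∧ t < 1 ∧ H = |K.η k - t|} := by
    have : {H : ℝ | ∃ k, ∃ t : ℝ, 0 < t ∧ t < 1 ∧ H = |K.η k - t|} =
        ⋃ k, if 1 ≤ K.η k then Set.Ioo (K.η k - 1) (K.η k) else Set.Ioo (-K.η k) (1 - K.η k) := by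
      ext H
      simp only [Set.mem_ofPred_eq, Set.mem_iUnion]
      refine exists_congr fun k => ?_
      split_ifs with h
      · constructor
        · rintro ⟨t, h0, h1, rfl⟩
          rw [abs_of_pos (by linarith)]
          constructor <;> linarith
        · rintro ⟨h0, h1⟩
          exact ⟨K.η k - H, by linarith, by linarith, by rw [abs_of_pos] <;> linarith⟩
      · have h := (K.η_sign k).resolve_left h
        constructor
        · rintro ⟨t, h0, h1, rfl⟩
          rw [abs_of_neg (by linarith)]
          constructor <;> linarith
        · rintro ⟨h0, h1⟩
          exact ⟨K.η k + H, by linarith, by linarith, by rw [abs_of_neg] <;> linarith⟩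
    rw [this]
    refine isOpen_iUnion fun k => ?_
    split_ifs <;> exact isOpen_Ioo
  have : K.carrier = halfAngle g K.μ ⁻¹' {H : ℝ | ∃ k, ∃ t : ℝ, 0 < t ∧ t < 1 ∧ H = |K.η k - t|} :=
    Set.ext fun z => K.mem_carrier_iff hg z
  rw [this]
  exact hset.preimage (continuous_halfAngle g K.μ)

theorem strip_inj (hg : 0 < g) (k : ι) (t u : I) (k' : ι) (t' u' : I) (h0 : 0 < t) (h1 : t < 1)
    (h : K.strip k (t, u) = K.strip k' (t', u')) : t' = t ∧ k' = k ∧ u' = u := by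
  have hH := congrArg (halfAngle g K.μ) h
  rw [strip_apply, strip_apply, halfAngle_chord hg _ (K.abs_le k t.2.1 t.2.2),
    halfAngle_chord hg _ (K.abs_le k' t'.2.1 t'.2.2)] at hH
  obtain ⟨rfl, ht⟩ := K.η_inj k k' t t' h0 h1 t'.2.1 t'.2.2 hH
  obtain rfl := Subtype.ext ht
  exact ⟨rfl, rfl, (chord_param_inj hg K.μ (K.abs_pos _ h0 h1) (K.abs_lt _ h0 h1) h).symm⟩

/-- The strips of a chain are glued to other points of the polygon only along their ends, each one
to the next one. -/
theorem eq_of_proj_eq (hg : 0 < g) (k : ι) (t u : I) (z : Disc) (h0 : 0 < t) (h1 : t < 1)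
    (h : proj g (K.strip k (t, u)) = proj g z) :
    z = K.strip k (t, u) ∨ (u = 0 ∧ z = K.strip (K.next.symm k) (t, 1)) ∨
      (u = 1 ∧ z = K.strip (K.next k) (t, 0)) := by
  rcases eq_or_ne u 0 with rfl | hu0
  · obtain ⟨l, rfl⟩ := K.next.surjective k
    rw [K.next.symm_apply_apply, K.strip_next_zero, K.strip_one]
    rw [K.strip_next_zero] at h
    have h0' : (0 : ℝ) < t := h0
    have h1' : (t : ℝ) < 1 := h1
    rcases eq_or_eq_of_mk_eq_mk_bdPt hg (opp_lt (K.e_lt l)) (t := σ t)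
      (by rw [unitInterval.coe_symm_eq]; linarith) (by rw [unitInterval.coe_symm_eq]; linarith) h
      with h | h
    · exact Or.inl h
    · refine Or.inr (Or.inl ⟨rfl, ?_⟩)
      rw [h, opp_opp, edgePoint_eq_bdPt, unitInterval.coe_symm_eq, sub_sub_cancel]
  rcases eq_or_ne u 1 with rfl | hu1
  · rw [K.strip_next_zero, K.strip_one]
    rw [K.strip_one] at h
    rcases eq_or_eq_of_mk_eq_mk_bdPt hg (K.e_lt k) (t := t) h0 h1 h with h | h
    · exact Or.inl h
    · exact Or.inr (Or.inr ⟨rfl, h⟩)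
  · exact Or.inl (eq_of_mk_eq_mk hg (norm_chord_lt_one' hg K.μ (K.abs_pos k h0 h1)
      (K.abs_lt k h0 h1) (unitInterval.pos_iff_ne_zero.2 hu0)
      (unitInterval.lt_one_iff_ne_one.2 hu1)) h).symm

/-- The open annulus meets the boundary of the polygon only inside the edges crossed by the chain
and their partners. -/
theorem exists_of_mem_carrier (hg : 0 < g) {z : Disc} (hz : z ∈ K.carrier) (hn : ‖(z : ℂ)‖ = 1) :
    ∃ k m, (m = K.e k ∨ m = opp (K.e k)) ∧ m < 4 * g ∧
      ∃ r : ℝ, 0 < r ∧ r < 1 ∧ z = bdPt g (m + r) := by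
  obtain ⟨k, t, u, h0, h1, rfl⟩ := hz
  have h0' : (0 : ℝ) < t := h0
  have h1' : (t : ℝ) < 1 := h1
  rcases eq_or_ne u 0 with rfl | hu0
  · obtain ⟨k, rfl⟩ := K.next.surjective k
    exact ⟨k, _, Or.inr rfl, opp_lt (K.e_lt k), σ t, by rw [unitInterval.coe_symm_eq]; linarith,
      by rw [unitInterval.coe_symm_eq]; linarith, K.strip_next_zero k t⟩
  rcases eq_or_ne u 1 with rfl | hu1
  · exact ⟨k, _, Or.inl rfl, K.e_lt k, t, h0', h1', K.strip_one k t⟩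
  · exact absurd hn (norm_chord_lt_one' hg K.μ (K.abs_pos k h0 h1)
      (K.abs_lt k h0 h1) (unitInterval.pos_iff_ne_zero.2 hu0)
      (unitInterval.lt_one_iff_ne_one.2 hu1)).ne

theorem vertex_notMem_carrier (hg : 0 < g) {z : Disc} (hz : IsVertex g z) : z ∉ K.carrier := by
  intro h
  obtain ⟨k, m, -, hm, r, h0, h1, rfl⟩ := K.exists_of_mem_carrier hg h hz.norm
  exact not_isVertex_bdPt hg hm h0 h1 hz

theorem edgePoint_notMem_carrier (hg : 0 < g) {l : ℕ} (hl : l < 4 * g) (hl4 : l % 4 < 2)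
    (h : ∀ k, K.e k ≠ l) (s : I) : edgePoint g l s ∉ K.carrier := by
  intro hz
  rcases eq_or_ne s 1 with rfl | hs
  · rw [edgePoint_one] at hz
    exact K.vertex_notMem_carrier hg ⟨l + 1, by rw [edgePoint_eq_bdPt]; simp⟩ hz
  · obtain ⟨k, m, hm, hm4, r, h0, h1, hzr⟩ := K.exists_of_mem_carrier hg hz (norm_bdPt _ _)
    obtain ⟨rfl, -⟩ :=
      bdPt_inj hg hl hm4 s.2.1 (unitInterval.lt_one_iff_ne_one.2 hs) h0.le h1 hzr
    have h4 := K.e_mod k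
    rw [K.opp_e] at hm
    have := h k
    omega

/-- The annulus in the surface formed by a closed chain of strips. The circles of the annulus are
parametrised by `loop t` on `[0, 1]`; the strip `k` covers the arc of positions `w k`. -/
noncomputable def annulus (hg : 0 < g) (w : ι → I → ℝ) (loop : I → ℝ → Surface g)
    (hloop : ContinuousOn (Function.uncurry loop) (Set.univ ×ˢ Set.Icc 0 1))
    (h01 : ∀ t, loop t 0 = loop t 1) (hw : ∀ k, Continuous (w k))
    (hwI : ∀ k u, w k u ∈ Set.Icc (0 : ℝ) 1)
    (hcw : ∀ k t u, proj g (K.strip k (t, u)) = loop t (w k u))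
    (hw_next : ∀ k, ∃ m : ℤ, w (K.next k) 0 = w k 1 + m)
    (hsurj : ∀ v : ℝ, 0 ≤ v → v < 1 → ∃ k u, v = w k u) : StripAnnulus (proj g) ι where
  c := K.strip
  w := w
  Λ := ⟨fun p => loop p.1 (Int.fract p.2),
    (ContinuousOn.comp_fract (s := Prod.snd) (f := fun (p : I × ℝ) v => loop p.1 v)
      (hloop.comp (f := fun q : (I × ℝ) × ℝ => (q.1.1, q.2)) (by fun_prop)
        (fun q hq => ⟨trivial, hq.2⟩)) continuous_snd fun p => h01 p.1)⟩
  S := K.carrier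
  continuous_w := hw
  periodic t v := by simp
  proj_c k t u := by
    rw [hcw]
    rcases (hwI k u).2.lt_or_eq with h | h
    · exact (congrArg (loop t) (Int.fract_eq_self.2 ⟨(hwI k u).1, h⟩)).symm
    · change loop t (w k u) = loop t (Int.fract (w k u))
      rw [h, Int.fract_one, h01]
  exists_w v := by
    obtain ⟨k, u, h⟩ := hsurj (Int.fract v) (Int.fract_nonneg v) (Int.fract_lt_one v)
    exact ⟨k, u, ⌊v⌋, by rw [← h, Int.fract_add_floor]⟩
  isOpen_S := K.isOpen_carrier hg
  mem_S _ := Iff.rfl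
  inj := K.strip_inj hg
  saturated k t u z h0 h1 h := by
    rcases K.eq_of_proj_eq hg k t u z h0 h1 h with rfl | ⟨rfl, rfl⟩ | ⟨rfl, rfl⟩
    · exact ⟨k, u, rfl, 0, by simp⟩
    · obtain ⟨m, hm⟩ := hw_next (K.next.symm k)
      rw [K.next.apply_symm_apply] at hm
      exact ⟨_, _, rfl, -m, by rw [hm]; push_cast; ring⟩
    · exact ⟨_, _, rfl, hw_next k⟩

end StripChain

/-- The strip joining the edge `e + 2` to the edge `e`. -/
noncomputable def singleChain {g e : ℕ} (he : e < 4 * g) (he4 : e % 4 < 2) :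
    StripChain g Unit where
  μ := e + 3 / 2
  η _ := 3 / 2
  e _ := e
  next := Equiv.refl _
  e_lt _ := he
  e_mod _ := he4
  add_η _ := by ring
  sub_η _ := by ring
  η_sign _ := Or.inl (by norm_num)
  η_le _ := by
    have : (1 : ℝ) ≤ g := by exact_mod_cast (by omega : 1 ≤ g)
    constructor <;> linarith
  η_inj _ _ t t' h0 h1 h0' h1' h := by
    rw [abs_of_pos (by linarith), abs_of_pos (by linarith)] at h
    exact ⟨rfl, by linarith⟩

/-- The annulus formed by the strip joining the edge `e + 2` to the edge `e`. -/
noncomputable def singleAnnulus {g e : ℕ} (he : e < 4 * g) (he4 : e % 4 < 2) :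
    StripAnnulus (proj g) Unit :=
  (singleChain he he4).annulus (by omega) (fun _ u => u)
    (fun t v => proj g ((singleChain he he4).strip () (t, Set.projIcc 0 1 zero_le_one v)))
    (by
      apply Continuous.continuousOn
      unfold Function.uncurry
      fun_prop)
    (fun t => by
      rw [Set.projIcc_left, Set.projIcc_right]
      exact (singleChain he he4).proj_strip_next () t)
    (fun _ => by fun_prop) (fun _ u => u.2)
    (fun _ t u => by rw [Set.projIcc_val])
    (fun _ => ⟨-1, by simp⟩) (fun v h0 h1 => ⟨(), ⟨v, h0, h1.le⟩, rfl⟩)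

/-- The two strips joining the edge `f + 2` to the edge `e` and the edge `e + 2` to the edge `f`,
for two edges `e` and `f` in different blocks of the boundary word. -/
noncomputable def doubleChain {g e f : ℕ} (hf : f + 2 < 4 * g) (he4 : e % 4 < 2) (hf4 : f % 4 < 2)
    (hef : e + 3 ≤ f) : StripChain g Bool where
  μ := (e + f + 3) / 2
  η k := bif k then (e + 3 - f) / 2 else (f + 3 - e) / 2
  e k := bif k then f else e
  next := Equiv.boolNot
  e_lt k := by cases k <;> simp <;> omega
  e_mod k := by cases k <;> assumption
  add_η k := by cases k <;> simp <;> ring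
  sub_η k := by cases k <;> simp <;> ring
  η_sign k := by
    have : (e : ℝ) + 3 ≤ f := by exact_mod_cast hef
    cases k
    · left; simp; linarith
    · right; simp; linarith
  η_le k := by
    have : (e : ℝ) + 3 ≤ f := by exact_mod_cast hef
    have : (f : ℝ) + 3 ≤ 4 * g := by exact_mod_cast hf
    have : (0 : ℝ) ≤ e := by positivity
    cases k <;> simp only [cond_true, cond_false] <;> constructor <;> linarith
  η_inj k k' t t' h0 h1 h0' h1' h := by
    have : (e : ℝ) + 3 ≤ f := by exact_mod_cast hef
    cases k <;> cases k' <;> simp only [cond_true, cond_false] at h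
    · rw [abs_of_nonneg (by linarith), abs_of_nonneg (by linarith)] at h
      exact ⟨rfl, by linarith⟩
    · rw [abs_of_nonneg (by linarith), abs_of_nonpos (by linarith)] at h
      exfalso; linarith
    · rw [abs_of_nonpos (by linarith), abs_of_nonneg (by linarith)] at h
      exfalso; linarith
    · rw [abs_of_nonpos (by linarith), abs_of_nonpos (by linarith)] at h
      exact ⟨rfl, by linarith⟩

/-- The annulus formed by the strips joining the edge `f + 2` to the edge `e` and the edge `e + 2`
to the edge `f`. -/
noncomputable def doubleAnnulus {g e f : ℕ} (hf : f + 2 < 4 * g) (he4 : e % 4 < 2)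
    (hf4 : f % 4 < 2) (hef : e + 3 ≤ f) : StripAnnulus (proj g) Bool :=
  (doubleChain hf he4 hf4 hef).annulus (by omega) (fun k u => bif k then (1 + u) / 2 else u / 2)
    (fun t v => if v ≤ 1 / 2 then
      proj g ((doubleChain hf he4 hf4 hef).strip false (t, Set.projIcc 0 1 zero_le_one (2 * v)))
      else proj g ((doubleChain hf he4 hf4 hef).strip true
        (t, Set.projIcc 0 1 zero_le_one (2 * v - 1))))
    (by
      apply Continuous.continuousOn
      unfold Function.uncurry
      refine Continuous.if_le (by fun_prop) (by fun_prop) (by fun_prop) (by fun_prop) ?_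
      intro p hp
      have h1 : 2 * p.2 = 1 := by linarith
      rw [h1, sub_self, Set.projIcc_left, Set.projIcc_right]
      exact ((doubleChain hf he4 hf4 hef).proj_strip_next false p.1).symm)
    (fun t => by
      have h := (doubleChain hf he4 hf4 hef).proj_strip_next true t
      have e1 : Set.projIcc (0 : ℝ) 1 zero_le_one (2 * 0) = 0 := by
        rw [mul_zero, Set.projIcc_left]; rfl
      have e2 : Set.projIcc (0 : ℝ) 1 zero_le_one (2 * 1 - 1) = 1 := by
        norm_num
      rw [if_pos (by norm_num), if_neg (by norm_num), e1, e2]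
      exact h)
    (fun k => by cases k <;> simp only [cond_true, cond_false] <;> fun_prop)
    (fun k u => by
      have := u.2.1; have := u.2.2
      cases k <;> simp only [cond_true, cond_false] <;> constructor <;> linarith)
    (fun k t u => by
      have h0 := u.2.1; have h1 := u.2.2
      cases k
      · simp only [cond_false]
        rw [if_pos (by linarith), mul_div_cancel₀ _ two_ne_zero, Set.projIcc_val]
      · simp only [cond_true]
        split_ifs with h
        · have hu : u = 0 := Subtype.ext (by change (u : ℝ) = 0; linarith)
          subst hu
          have := (doubleChain hf he4 hf4 hef).proj_strip_next false t
          have e1 : Set.projIcc (0 : ℝ) 1 zero_le_one (2 * ((1 + ((0 : I) : ℝ)) / 2)) = 1 := by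
            norm_num
          rw [e1]
          exact this
        · rw [mul_div_cancel₀ _ two_ne_zero, add_sub_cancel_left, Set.projIcc_val])
    (fun k => by
      cases k
      · exact ⟨0, by change (1 + ((0 : I) : ℝ)) / 2 = ((1 : I) : ℝ) / 2 + (0 : ℤ); simp⟩
      · exact ⟨-1, by
        change ((0 : I) : ℝ) / 2 = (1 + ((1 : I) : ℝ)) / 2 + (-1 : ℤ); norm_num⟩)
    (fun v h0 h1 => by
      rcases le_or_gt v (1 / 2) with h | h
      · exact ⟨false, ⟨2 * v, by linarith, by linarith⟩, by simp⟩
      · exact ⟨true, ⟨2 * v - 1, by linarith, by linarith⟩, by simp⟩)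

end SurfaceAnnuli

/-! ### Action of the twists on the fundamental group -/

section SurfaceTwists

open Topology FundamentalGroup

/-- The automorphism of `π₁(Σ_g)` induced by a homeomorphism of the surface that fixes the base
point. -/
noncomputable def piOneMap {g : ℕ} (T : Surface g ≃ₜ Surface g)
    (hT : T (basePoint g) = basePoint g) : PiOne g →* PiOne g := mapOfEq (T : C(_, _)) hT

theorem piOneMap_loopClass_of_fixed {g : ℕ} (T : Surface g ≃ₜ Surface g)
    (hT : T (basePoint g) = basePoint g) (L : Path (basePoint g) (basePoint g))
    (hL : ∀ t, T (L t) = L t) : piOneMap T hT (loopClass L) = loopClass L := by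
  rw [loopClass, piOneMap, mapOfEq_fromPath]
  congr 2
  exact Path.ext (funext hL)

theorem piOneMap_trans {g : ℕ} (T U : Surface g ≃ₜ Surface g)
    (hT : T (basePoint g) = basePoint g) (hU : U (basePoint g) = basePoint g)
    (hTU : (T.trans U) (basePoint g) = basePoint g) (x : PiOne g) :
    piOneMap (T.trans U) hTU x = piOneMap U hU (piOneMap T hT x) := by
  induction x using Path.Homotopic.Quotient.ind with
  | mk L =>
    change piOneMap _ _ (fromPath _) = piOneMap _ _ (piOneMap _ _ (fromPath _))
    simp only [piOneMap, mapOfEq_fromPath]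
    rfl

variable {g : ℕ}

/-- The Dehn twists along a closed curve parallel to `a_i`. Only the loop `b_i` crosses the annulus,
which consists of the chords from one of the two edges `b_i` to the other. -/
theorem exists_twist_a (i : Fin g) (m : ℤ) :
    ∃ (T : Surface g ≃ₜ Surface g) (hT : T (basePoint g) = basePoint g),
      (∀ j t, T (aLoop g j t) = aLoop g j t) ∧
      (∀ j, j ≠ i → piOneMap T hT (bClass g j) = bClass g j) ∧
      piOneMap T hT (bClass g i) = aClass g i ^ m * bClass g i := by
  have hg : 0 < g := i.pos
  have he : 4 * (i : ℕ) + 1 < 4 * g := by omega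
  have he4 : (4 * (i : ℕ) + 1) % 4 < 2 := by omega
  set K := singleChain he he4
  set A := singleAnnulus he he4
  have hT : A.twist (isQuotientMap_proj g) m (basePoint g) = basePoint g :=
    A.twist_proj _ m (K.vertex_notMem_carrier hg ⟨0, by rw [edgePoint_eq_bdPt]; simp⟩)
  have hfix : ∀ l, l < 4 * g → l % 4 < 2 → l ≠ 4 * i + 1 → ∀ t,
      A.twist (isQuotientMap_proj g) m (proj g (edgePoint g l t)) = proj g (edgePoint g l t) :=
    fun l hl hl4 hli t => A.twist_proj _ m (K.edgePoint_notMem_carrier hg hl hl4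
      (fun _ => hli.symm) t)
  refine ⟨A.twist (isQuotientMap_proj g) m, hT, fun j t => hfix _ (by omega) (by omega)
    (by omega) t, fun j hj => piOneMap_loopClass_of_fixed _ hT _ fun t => hfix _ (by omega)
    (by omega) (by omega) t, ?_⟩
  have hL : ∀ t, bLoop g i t = A.Λ (t, 0) := by
    intro t
    have h1 := A.proj_c () t 1
    have h2 := A.periodic t 0
    rw [zero_add] at h2
    refine Eq.trans ?_ (h1.trans h2)
    exact congrArg (proj g) (K.strip_one () t).symm
  refine (A.mapOfEq_twist (isQuotientMap_proj g) m hT ((hL 0).symm.trans (bLoop g i).source)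
    ((hL 1).symm.trans (bLoop g i).target) (bLoop g i) hL).trans ?_
  have e0 : A.c () (1, 0) = bdPt g (4 * i + 3 : ℕ) := by
    refine (K.strip_next_zero () 1).trans ?_
    rw [unitInterval.symm_one, edgePoint_eq_bdPt, K.opp_e]
    simp [K, singleChain]
    ring_nf
  have e1 : A.c () (1, 1) = bdPt g (4 * i + 2 : ℕ) := by
    refine (K.strip_one () 1).trans ?_
    rw [edgePoint_eq_bdPt]
    simp [K, singleChain]
    ring_nf
  have := A.pathCls_strip (x := basePoint g) () 1 0 (a := 0) (b := 0 + 1)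
    (by change (0 : ℝ) = ((0 : I) : ℝ) + (0 : ℤ); simp)
    (by change (0 + 1 : ℝ) = ((1 : I) : ℝ) + (0 : ℤ); simp)
    ((hL 1).symm.trans (bLoop g i).target)
    ((A.periodic 1 0).trans ((hL 1).symm.trans (bLoop g i).target))
    (by rw [e0]; exact proj_bdPt hg _) (by rw [e1]; exact proj_bdPt hg _)
  rw [this]
  have h3 : pathCls (proj g) (x := basePoint g) (y₀ := A.c () (1, 0)) (y₁ := A.c () (1, 1))
      (by rw [e0]; exact proj_bdPt hg _) (by rw [e1]; exact proj_bdPt hg _) =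
        chordCls hg (4 * i + 3) (4 * i + 2) := by
    simp only [e0, e1]; rfl
  rw [h3, ← chordCls_inv, chordCls_a', inv_inv]
  rfl

/-- The Dehn twists along a closed curve that crosses the two edges `e` and `f` in different
blocks. They fix the loops of all other letters, and they move the loops of `e` and `f` by conjugate
elements, since both run once across the annulus, starting on it at different points. -/
theorem exists_twist_two (hg : 0 < g) {e f : ℕ} (hf : f + 2 < 4 * g) (he4 : e % 4 < 2)
    (hf4 : f % 4 < 2) (hef : e + 3 ≤ f) (m : ℤ) :
    ∃ (T : Surface g ≃ₜ Surface g) (hT : T (basePoint g) = basePoint g),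
      (∀ l, l < 4 * g → l % 4 < 2 → l ≠ e → l ≠ f →
        ∀ t, T (proj g (edgePoint g l t)) = proj g (edgePoint g l t)) ∧
      (∀ L : Path (basePoint g) (basePoint g), (∀ t, L t = proj g (edgePoint g f t)) →
        piOneMap T hT (loopClass L) =
          (chordCls hg (e + 2) (f + 1) * chordCls hg (f + 2) (e + 1)) ^ m * loopClass L) ∧
      ∀ L : Path (basePoint g) (basePoint g), (∀ t, L t = proj g (edgePoint g e t)) →
        piOneMap T hT (loopClass L) =
          (chordCls hg (f + 2) (e + 1) * chordCls hg (e + 2) (f + 1)) ^ m * loopClass L := by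
  set K := doubleChain hf he4 hf4 hef with hK
  set A := doubleAnnulus hf he4 hf4 hef with hA
  have hT : A.twist (isQuotientMap_proj g) m (basePoint g) = basePoint g :=
    A.twist_proj _ m (K.vertex_notMem_carrier hg ⟨0, by rw [edgePoint_eq_bdPt]; simp⟩)
  have hwf0 : A.w false 0 = 0 := by change ((0 : I) : ℝ) / 2 = 0; simp
  have hwf1 : A.w false 1 = 1 / 2 := by change ((1 : I) : ℝ) / 2 = 1 / 2; simp
  have hwt0 : A.w true 0 = 1 / 2 := by change (1 + ((0 : I) : ℝ)) / 2 = 1 / 2; simp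
  have hwt1 : A.w true 1 = 1 := by change (1 + ((1 : I) : ℝ)) / 2 = 1; norm_num
  have hLe : ∀ t, proj g (edgePoint g e t) = A.Λ (t, 1 / 2) := by
    intro t
    rw [← hwf1, ← A.proj_c]
    exact congrArg (proj g) (K.strip_one false t).symm
  have hLf : ∀ t, proj g (edgePoint g f t) = A.Λ (t, 0) := by
    intro t
    have h1 := A.proj_c true t 1
    have h2 := A.periodic t 0
    rw [zero_add] at h2
    rw [hwt1] at h1
    exact (congrArg (proj g) (K.strip_one true t).symm).trans (h1.trans h2)
  have hb : ∀ l : ℕ, proj g (edgePoint g l 1) = basePoint g := by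
    intro l
    rw [edgePoint_eq_bdPt, Set.Icc.coe_one, ← Nat.cast_add_one]
    exact proj_bdPt hg _
  have hb0 : ∀ l : ℕ, proj g (edgePoint g l 0) = basePoint g := by
    intro l
    rw [edgePoint_eq_bdPt, Set.Icc.coe_zero, add_zero]
    exact proj_bdPt hg _
  have h0 : A.Λ (1, 0) = basePoint g := (hLf 1).symm.trans (hb f)
  have h1 : A.Λ (1, 1 / 2) = basePoint g := (hLe 1).symm.trans (hb e)
  have h2 : A.Λ (1, 0 + 1) = basePoint g := (A.periodic 1 0).trans h0
  have h3 : A.Λ (1, 1 / 2 + 1) = basePoint g := (A.periodic 1 (1 / 2)).trans h1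
  -- The four corners of the strips at `t = 1`.
  have cf0 : A.c false (1, 0) = bdPt g (f + 2 : ℕ) := by
    refine (K.strip_next_zero true 1).trans ?_
    rw [unitInterval.symm_one, edgePoint_eq_bdPt, K.opp_e]
    simp [K, doubleChain]
  have cf1 : A.c false (1, 1) = bdPt g (e + 1 : ℕ) := by
    refine (K.strip_one false 1).trans ?_
    rw [edgePoint_eq_bdPt]
    simp [K, doubleChain]
  have ct0 : A.c true (1, 0) = bdPt g (e + 2 : ℕ) := by
    refine (K.strip_next_zero false 1).trans ?_
    rw [unitInterval.symm_one, edgePoint_eq_bdPt, K.opp_e]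
    simp [K, doubleChain]
  have ct1 : A.c true (1, 1) = bdPt g (f + 1 : ℕ) := by
    refine (K.strip_one true 1).trans ?_
    rw [edgePoint_eq_bdPt]
    simp [K, doubleChain]
  have sf : ∀ (n : ℤ) (a b : ℝ) (ha : A.Λ (1, a) = basePoint g) (hb : A.Λ (1, b) = basePoint g),
      a = n → b = 1 / 2 + n → pathCls A.Λ ha hb = chordCls hg (f + 2) (e + 1) := by
    intro n a b ha hb han hbn
    rw [A.pathCls_strip false 1 n (by rw [hwf0, zero_add, han]) (by rw [hwf1, hbn]) ha hb
      (by rw [cf0]; exact proj_bdPt hg _) (by rw [cf1]; exact proj_bdPt hg _)]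
    simp only [cf0, cf1]; rfl
  have st : ∀ (n : ℤ) (a b : ℝ) (ha : A.Λ (1, a) = basePoint g) (hb : A.Λ (1, b) = basePoint g),
      a = 1 / 2 + n → b = 1 + n → pathCls A.Λ ha hb = chordCls hg (e + 2) (f + 1) := by
    intro n a b ha hb han hbn
    rw [A.pathCls_strip true 1 n (by rw [hwt0, han]) (by rw [hwt1, hbn]) ha hb
      (by rw [ct0]; exact proj_bdPt hg _) (by rw [ct1]; exact proj_bdPt hg _)]
    simp only [ct0, ct1]; rfl
  refine ⟨A.twist (isQuotientMap_proj g) m, hT, fun l hl hl4 hle hlf t => ?_, fun L hL => ?_,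
    fun L hL => ?_⟩
  · refine A.twist_proj _ m (K.edgePoint_notMem_carrier hg hl hl4 (fun k => ?_) t)
    cases k
    · exact hle.symm
    · exact hlf.symm
  · refine (A.mapOfEq_twist (isQuotientMap_proj g) m hT ((hLf 0).symm.trans (hb0 f)) h0 L
      fun t => (hL t).trans (hLf t)).trans ?_
    rw [← pathCls_mul A.Λ h0 h1, sf 0 _ _ h0 h1 (by simp) (by simp),
      st 0 _ _ h1 _ (by simp) (by simp)]
    rfl
  · refine (A.mapOfEq_twist (isQuotientMap_proj g) m hT ((hLe 0).symm.trans (hb0 e)) h1 L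
      fun t => (hL t).trans (hLe t)).trans ?_
    rw [← pathCls_mul A.Λ h1 h2, st 0 _ _ h1 h2 (by simp) (by simp),
      sf 1 _ _ h2 _ (by simp) (by simp)]
    rfl

end SurfaceTwists

/-! ### The dual curve of a side -/

section DualCurve

open Topology

variable {g : ℕ}

theorem isSimpleLoop_bLoop (i : Fin g) : IsSimpleLoop (bLoop g i) := by
  have hg : 0 < g := i.pos
  have hk : 4 * (i : ℕ) + 1 < 4 * g := by omega
  have key : ∀ s t : I, s ≠ 0 → s ≠ 1 → bLoop g i s = bLoop g i t → s = t := by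
    intro s t h0 h1 h
    have h0' : (0 : ℝ) < s := unitInterval.pos_iff_ne_zero.2 h0
    have h1' : (s : ℝ) < 1 := unitInterval.lt_one_iff_ne_one.2 h1
    have ht : ∀ l r : ℕ, l < 4 * g → ∀ r : ℝ, 0 < r → r < 1 →
        edgePoint g (4 * i + 1) t = bdPt g (l + r) → 4 * (i : ℕ) + 1 = l ∧ t = r := by
      intro l _ hl r hr0 hr1 h
      rcases eq_or_ne t 1 with rfl | ht
      · rw [edgePoint_one] at h
        exact absurd ⟨_, by rw [← h, edgePoint_eq_bdPt, Set.Icc.coe_zero, add_zero]⟩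
          (not_isVertex_bdPt hg hl hr0 hr1)
      · exact bdPt_inj hg hk hl t.2.1 (unitInterval.lt_one_iff_ne_one.2 ht) hr0.le hr1 h
    rcases eq_or_eq_of_mk_eq_mk_bdPt hg hk h0' h1' h with h | h
    · exact Subtype.ext (ht _ 0 hk s h0' h1' h).2.symm
    · have := (ht _ 0 (opp_lt hk) (1 - s) (by linarith) (by linarith) h).1
      unfold opp at this
      split_ifs at this <;> omega
  intro s t h
  by_cases hs : s ≠ 0 ∧ s ≠ 1
  · exact Or.inl (key s t hs.1 hs.2 h)
  by_cases ht : t ≠ 0 ∧ t ≠ 1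
  · exact Or.inl (key t s ht.1 ht.2 h.symm).symm
  have hs' : s = 0 ∨ s = 1 := by tauto
  have ht' : t = 0 ∨ t = 1 := by tauto
  rcases hs' with rfl | rfl <;> rcases ht' with rfl | rfl <;> simp

/-- The parametrisation of a neighbourhood of the midpoint of an edge by a square in the annulus
that crosses this edge: the edge is the second coordinate axis, the core of the annulus is the
first. -/
noncomputable def crossChart {e : ℕ} (he : e < 4 * g) (he4 : e % 4 < 2) (p : ℝ × ℝ) : Surface g :=
  (singleAnnulus he he4).Λ (Set.projIcc 0 1 zero_le_one (1 / 2 + p.2), p.1)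

/-- The open square of side `1` centred at the origin. -/
def crossSquare : Set (ℝ × ℝ) := Set.Ioo (-(1 / 2)) (1 / 2) ×ˢ Set.Ioo (-(1 / 2)) (1 / 2)

theorem isOpen_crossSquare : IsOpen crossSquare := isOpen_Ioo.prod isOpen_Ioo

theorem coe_projIcc {p : ℝ × ℝ} (hp : p ∈ crossSquare) :
    ((Set.projIcc (0 : ℝ) 1 zero_le_one (1 / 2 + p.2) : I) : ℝ) = 1 / 2 + p.2 := by
  obtain ⟨-, h1, h2⟩ := hp
  rw [Set.projIcc_of_mem zero_le_one (⟨by linarith, by linarith⟩ : 1 / 2 + p.2 ∈ Set.Icc (0 : ℝ) 1)]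

theorem projIcc_mem {p : ℝ × ℝ} (hp : p ∈ crossSquare) :
    0 < Set.projIcc (0 : ℝ) 1 zero_le_one (1 / 2 + p.2) ∧
      Set.projIcc (0 : ℝ) 1 zero_le_one (1 / 2 + p.2) < 1 := by
  have h := coe_projIcc hp
  obtain ⟨-, h1, h2⟩ := hp
  constructor
  · rw [← Subtype.coe_lt_coe, h]; change (0 : ℝ) < _; linarith
  · rw [← Subtype.coe_lt_coe, h]; change _ < (1 : ℝ); linarith

variable {e : ℕ} (he : e < 4 * g) (he4 : e % 4 < 2)

theorem continuous_crossChart : Continuous (crossChart he he4) := by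
  unfold crossChart
  fun_prop

theorem injOn_crossChart : Set.InjOn (crossChart he he4) crossSquare := by
  intro p hp p' hp' h
  have hm := projIcc_mem hp
  obtain ⟨h1, m, h2⟩ := (singleAnnulus he he4).Λ_inj hm.1 hm.2 h
  have h1 := congrArg Subtype.val h1
  rw [coe_projIcc hp, coe_projIcc hp'] at h1
  obtain ⟨⟨a1, a2⟩, -⟩ := hp
  obtain ⟨⟨b1, b2⟩, -⟩ := hp'
  have hm1 : (m : ℝ) < 1 := by linarith
  have hm2 : (-1 : ℝ) < m := by linarith
  have hm0 : m = 0 := by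
    have h1 : m < 1 := by exact_mod_cast hm1
    have h2 : -1 < m := by exact_mod_cast hm2
    omega
  subst hm0
  exact Prod.ext (by rw [h2]; simp) (by linarith)

theorem singleAnnulus_proj (t u : I) :
    proj g (chord g (e + 3 / 2) (3 / 2 - t) u) = (singleAnnulus he he4).Λ (t, u) :=
  (singleAnnulus he he4).proj_c () t u

/-- The chart is an open map: the preimage of the image of `U` in the polygon consists of the part
of `U` on the strip and of its translate by one period, both described by the continuous coordinates
`chordParam` and `halfAngle` of the strip. -/
theorem isOpen_image_crossChart {U : Set (ℝ × ℝ)} (hU : IsOpen U) (hUs : U ⊆ crossSquare) :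
    IsOpen (crossChart he he4 '' U) := by
  have hg : 0 < g := by omega
  have hg1 : (1 : ℝ) ≤ g := by exact_mod_cast hg
  rw [← (isQuotientMap_proj g).isOpen_preimage]
  set μ : ℝ := e + 3 / 2 with hμ
  let V : Set Disc := halfAngle g μ ⁻¹' Set.Ioo (1 / 2) (3 / 2)
  have hV : IsOpen V := isOpen_Ioo.preimage (continuous_halfAngle g μ)
  let κ : Disc → ℝ × ℝ := fun z => (chordParam g μ z, 1 - halfAngle g μ z)
  have hκ : ContinuousOn κ V := by
    refine ContinuousOn.prodMk ((continuousOn_chordParam hg μ).mono ?_) (by fun_prop)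
    rintro z ⟨h1, h2⟩
    exact ⟨by linarith, by linarith⟩
  have hκ' : ContinuousOn (fun z => κ z - (1, 0)) V := hκ.sub continuousOn_const
  have hstrip : ∀ t u : I, 0 < t → t < 1 → ∀ z, z = chord g μ (3 / 2 - t) u →
      z ∈ V ∧ κ z = ((u : ℝ), (t : ℝ) - 1 / 2) := by
    rintro t u h0 h1 z rfl
    have h0' : (0 : ℝ) < t := h0
    have h1' : (t : ℝ) < 1 := h1
    have hH : halfAngle g μ (chord g μ (3 / 2 - t) u) = 3 / 2 - t := by
      rw [halfAngle_chord hg, abs_of_pos] <;> [linarith; skip]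
      rw [abs_of_pos] <;> linarith
    refine ⟨?_, ?_⟩
    · change _ ∈ Set.Ioo _ _
      rw [hH]; constructor <;> linarith
    · change (_, _) = _
      rw [hH, chordParam_chord hg _ (by linarith) (by linarith)]
      congr 1; ring
  have : proj g ⁻¹' (crossChart he he4 '' U) =
      (V ∩ κ ⁻¹' U) ∪ (V ∩ (fun z => κ z - (1, 0)) ⁻¹' U) := by
    ext z
    constructor
    · rintro ⟨p, hp, h⟩
      have hs := hUs hp
      have hm := projIcc_mem hs
      have hz := (singleAnnulus he he4).proj_mem hm.1 hm.2 h
      obtain ⟨⟨⟩, t, u, h0, h1, hz'⟩ := ((singleAnnulus he he4).mem_S z).1 hz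
      obtain ⟨hzV, hzκ⟩ := hstrip t u h0 h1 z hz'
      have h2 : (singleAnnulus he he4).Λ (t, u) = crossChart he he4 p := by
        rw [h, hz']; exact (singleAnnulus_proj he he4 t u).symm
      obtain ⟨h3, m, h4⟩ := (singleAnnulus he he4).Λ_inj h0 h1 h2
      have h3 := congrArg Subtype.val h3
      rw [coe_projIcc hs] at h3
      obtain ⟨⟨a1, a2⟩, -⟩ := hs
      have hu0 := u.2.1
      have hu1 := u.2.2
      have hm1 : (m : ℝ) < 1 := by linarith
      have hm2 : (-2 : ℝ) < m := by linarith
      have hm0 : m = 0 ∨ m = -1 := by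
        have h1 : m < 1 := by exact_mod_cast hm1
        have h2 : -2 < m := by exact_mod_cast hm2
        omega
      rcases hm0 with rfl | rfl
      · left
        refine ⟨hzV, ?_⟩
        change κ z ∈ U
        rw [hzκ]
        convert hp using 1
        exact Prod.ext (by rw [h4]; simp) (by change (t : ℝ) - 1 / 2 = p.2; linarith)
      · right
        refine ⟨hzV, ?_⟩
        change κ z - (1, 0) ∈ U
        rw [hzκ]
        convert hp using 1
        refine Prod.ext (by rw [h4]; simp [sub_eq_add_neg]) ?_
        change (t : ℝ) - 1 / 2 - 0 = p.2
        linarith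
    · have aux : ∀ z ∈ V, ∃ t u : I, 0 < t ∧ t < 1 ∧ z = chord g μ (3 / 2 - t) u := by
        rintro z ⟨h1, h2⟩
        obtain ⟨u, hu⟩ := exists_eq_chord hg μ z
        refine ⟨⟨3 / 2 - halfAngle g μ z, by linarith, by linarith⟩, u, ?_, ?_, ?_⟩
        · rw [← Subtype.coe_lt_coe]; change (0 : ℝ) < _; linarith
        · rw [← Subtype.coe_lt_coe]; change _ < (1 : ℝ); linarith
        · rw [sub_sub_cancel]; exact hu
      rintro (⟨hzV, hzU⟩ | ⟨hzV, hzU⟩)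
      · obtain ⟨t, u, h0, h1, rfl⟩ := aux z hzV
        refine ⟨_, hzU, ?_⟩
        rw [(hstrip t u h0 h1 _ rfl).2, singleAnnulus_proj he he4 t u, crossChart,
          add_sub_cancel, Set.projIcc_val]
      · obtain ⟨t, u, h0, h1, rfl⟩ := aux z hzV
        refine ⟨_, hzU, ?_⟩
        simp only
        rw [(hstrip t u h0 h1 _ rfl).2, singleAnnulus_proj he he4 t u, crossChart]
        simp only [Prod.mk_sub_mk, sub_zero, add_sub_cancel, Set.projIcc_val]
        rw [← (singleAnnulus he he4).periodic, sub_add_cancel]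
  rw [this]
  exact (hκ.isOpen_inter_preimage hV hU).union (hκ'.isOpen_inter_preimage hV hU)

/-- The chart of the surface around the midpoint of an edge. -/
noncomputable def crossHomeo : OpenPartialHomeomorph (ℝ × ℝ) (Surface g) :=
  OpenPartialHomeomorph.ofContinuousOpenRestrict
    ((injOn_crossChart he he4).toPartialEquiv (crossChart he he4) crossSquare)
    (continuous_crossChart he he4).continuousOn
    (by
      intro O hO
      obtain ⟨U, hU, rfl⟩ := isOpen_induced_iff.1 hO
      have : (crossSquare.domRestrict (crossChart he he4)) '' (Subtype.val ⁻¹' U) =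
          crossChart he he4 '' (crossSquare ∩ U) := by
        ext x
        constructor
        · rintro ⟨⟨p, hp⟩, hpU, rfl⟩
          exact ⟨p, ⟨hp, hpU⟩, rfl⟩
        · rintro ⟨p, ⟨hp, hpU⟩, rfl⟩
          exact ⟨⟨p, hp⟩, hpU, rfl⟩
      change IsOpen ((crossSquare.domRestrict (crossChart he he4)) '' (Subtype.val ⁻¹' U))
      rw [this]
      exact isOpen_image_crossChart he he4 (isOpen_crossSquare.inter hU) Set.inter_subset_left)
    isOpen_crossSquare

/-- The edge `a_i` has a dual curve: it is freely homotopic to `b_i`, and it is a single chord of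
the polygon. -/
theorem exists_dual_curve (i : Fin g) :
    ∃ (y : Surface g) (C : Path y y), IsSimpleLoop C ∧ FreelyHomotopic (bLoop g i) C ∧
      MeetTransverselyOnce (Set.range C) (Set.range (aLoop g i)) := by
  have hg : 0 < g := i.pos
  have he : 4 * (i : ℕ) < 4 * g := by omega
  have he4 : (4 * (i : ℕ)) % 4 < 2 := by omega
  set K := singleChain he he4 with hK
  set A := singleAnnulus he he4 with hA
  let half : I := ⟨1 / 2, by norm_num, by norm_num⟩
  have h0 : 0 < half := by rw [← Subtype.coe_lt_coe]; change (0 : ℝ) < 1 / 2; norm_num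
  have h1 : half < 1 := by rw [← Subtype.coe_lt_coe]; change (1 / 2 : ℝ) < 1; norm_num
  have hends : proj g (K.strip () (half, 0)) = proj g (K.strip () (half, 1)) :=
    K.proj_strip_next () half
  let C : Path (proj g (K.strip () (half, 1))) (proj g (K.strip () (half, 1))) :=
    { toFun := fun v => proj g (K.strip () (half, σ v))
      continuous_toFun := by fun_prop
      source' := by rw [unitInterval.symm_zero]
      target' := by rw [unitInterval.symm_one]; exact hends }
  have hCΛ : ∀ v, C v = A.Λ (half, (σ v : I)) := fun v => A.proj_c () half (σ v)
  have haΛ : ∀ t, aLoop g i t = A.Λ (t, 0) := by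
    intro t
    have h1 := A.proj_c () t 1
    have h2 := A.periodic t 0
    rw [zero_add] at h2
    refine Eq.trans ?_ (h1.trans h2)
    exact congrArg (proj g) (K.strip_one () t).symm
  refine ⟨_, C, ?_, ?_, A.Λ (half, 0), ?_, ?_⟩
  · intro s t h
    rcases K.eq_of_proj_eq hg () half (σ s) _ h0 h1 h with h | ⟨hs, h⟩ | ⟨hs, h⟩
    · left
      obtain ⟨-, -, h⟩ := K.strip_inj hg _ _ _ _ _ _ h0 h1 h
      exact unitInterval.symm_bijective.1 h
    · right; right
      obtain ⟨-, -, h⟩ := K.strip_inj hg _ _ _ _ _ _ h0 h1 h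
      exact ⟨by simpa using hs, by simpa using h.symm⟩
    · right; left
      obtain ⟨-, -, h⟩ := K.strip_inj hg _ _ _ _ _ _ h0 h1 h
      exact ⟨by simpa using hs, by simpa using h.symm⟩
  · -- The arcs from the edge `a_i` to its partner along the boundary are deformed into chords,
    -- while their end points move along the edges.
    let η : I → ℝ := fun s => 1 / 2 + s / 2
    let H : C(I × I, Surface g) :=
      ⟨fun p => proj g (lerp (bdPt g (4 * i + 3 / 2 - η p.1 + 2 * η p.1 * p.2))
        (chord g (4 * i + 3 / 2) (η p.1) (σ p.2)) p.1), by fun_prop⟩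
    refine ⟨H, fun t => ?_, fun t => ?_, fun s => ?_⟩
    · change proj g (lerp _ _ 0) = proj g (edgePoint g (4 * i + 1) t)
      rw [lerp_zero, edgePoint_eq_bdPt]
      congr 2
      simp only [η]
      push_cast
      ring
    · change proj g (lerp _ _ 1) = proj g (chord g (((4 * i : ℕ) : ℝ) + 3 / 2)
        (3 / 2 - ((half : I) : ℝ)) (σ t))
      rw [lerp_one]
      simp only [η, half]
      push_cast
      norm_num
    · change proj g (lerp _ _ s) = proj g (lerp _ _ s)
      have hl : ∀ z : Disc, lerp z z s = z := fun z => Subtype.ext (by simp [lerp, ← add_mul])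
      simp only [unitInterval.symm_zero, unitInterval.symm_one, chord_zero, chord_one,
        Set.Icc.coe_zero, Set.Icc.coe_one, mul_zero, add_zero, mul_one]
      rw [show (4 * (i : ℝ) + 3 / 2 - η s + 2 * η s) = 4 * i + 3 / 2 + η s by ring, hl, hl]
      have := mk_edgePoint_opp he (σ ⟨s / 2, by
        have := s.2.1; have := s.2.2; constructor <;> linarith⟩)
      have hopp : opp (4 * (i : ℕ)) = 4 * i + 2 := K.opp_e ()
      rw [hopp, edgePoint_eq_bdPt, edgePoint_eq_bdPt] at this
      refine Eq.trans (congrArg (proj g) ?_) (this.symm.trans (congrArg (proj g) ?_))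
      all_goals
        congr 1
        simp only [unitInterval.coe_symm_eq, η]
        push_cast
        ring
  · ext x
    constructor
    · rintro ⟨⟨s, rfl⟩, ⟨t, ht⟩⟩
      rw [hCΛ, haΛ] at ht
      obtain ⟨h, -⟩ := A.Λ_inj h0 h1 ht.symm
      rw [hCΛ, ← ht, h]
      rfl
    · rintro rfl
      exact ⟨⟨1, by rw [hCΛ]; simp⟩, ⟨half, haΛ half⟩⟩
  · let E := crossHomeo he he4
    have hE : ∀ p ∈ crossSquare, E.symm (crossChart he he4 p) = p := fun p hp => E.left_inv hp
    have hzero : ((0, 0) : ℝ × ℝ) ∈ crossSquare := by simp [crossSquare]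
    have hhalf : Set.projIcc (0 : ℝ) 1 zero_le_one (1 / 2 + 0) = half := by
      rw [add_zero]; exact Set.projIcc_of_mem _ half.2
    have hz : crossChart he he4 (0, 0) = A.Λ (half, 0) := by
      rw [crossChart, hhalf]
    refine ⟨E.symm, ?_, ?_, ?_⟩
    · rw [← hz]; exact E.map_source hzero
    · rw [← hz, hE _ hzero]
    · intro x hx
      obtain ⟨p, hp, rfl⟩ : x ∈ crossChart he he4 '' crossSquare := hx
      have hm := projIcc_mem hp
      rw [hE p hp]
      constructor
      · constructor
        · rintro ⟨s, hs⟩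
          rw [hCΛ] at hs
          obtain ⟨h, -⟩ := A.Λ_inj h0 h1 hs
          have h := congrArg Subtype.val h
          rw [coe_projIcc hp] at h
          change 1 / 2 + p.2 = 1 / 2 at h
          linarith
        · intro h
          have hc : crossChart he he4 p = A.Λ (half, p.1) := by rw [crossChart, h, hhalf]
          obtain ⟨⟨a1, a2⟩, -⟩ := hp
          rw [hc]
          rcases le_or_gt 0 p.1 with h' | h'
          · refine ⟨σ ⟨p.1, h', by linarith⟩, ?_⟩
            rw [hCΛ, unitInterval.symm_symm]
          · refine ⟨σ ⟨p.1 + 1, by linarith, by linarith⟩, ?_⟩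
            rw [hCΛ, unitInterval.symm_symm]
            exact A.periodic _ _
      · constructor
        · rintro ⟨t, ht⟩
          rw [haΛ] at ht
          obtain ⟨-, m, h⟩ := A.Λ_inj hm.1 hm.2 ht.symm
          obtain ⟨⟨a1, a2⟩, -⟩ := hp
          have hm1 : (m : ℝ) < 1 := by linarith
          have hm2 : (-1 : ℝ) < m := by linarith
          have hm0 : m = 0 := by
            have h1 : m < 1 := by exact_mod_cast hm1
            have h2 : -1 < m := by exact_mod_cast hm2
            omega
          subst hm0
          simpa using h.symm
        · intro h
          refine ⟨Set.projIcc 0 1 zero_le_one (1 / 2 + p.2), ?_⟩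
          rw [haΛ, crossChart, h]

end DualCurve

/-! ### A local criterion for generators of the fundamental group -/

section LocalCriterion

open FundamentalGroup

variable {X : Type*} [TopologicalSpace X]

/-- A subgroup `H` of `π₁(X, b)` is the whole group if one can choose a path class `τ x` from `b` to
each point `x` such that all sufficiently small paths `q`, from `x` to `y` say, satisfy
`τ x · q · (τ y)⁻¹ ∈ H`. -/
theorem eq_top_of_locally_mem {b : X} (H : Subgroup (FundamentalGroup X b))
    (τ : ∀ x, Path.Homotopic.Quotient b x) (hb : fromPath (τ b) ∈ H)
    (hloc : ∀ x, ∃ U, IsOpen U ∧ x ∈ U ∧ ∀ (y y' : X) (q : Path y y'), Set.range q ⊆ U →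
      fromPath (((τ y).trans (Path.Homotopic.Quotient.mk q)).trans (τ y').symm) ∈ H) : H = ⊤ := by
  rw [eq_top_iff]
  rintro x -
  obtain ⟨p, rfl⟩ := Path.Homotopic.Quotient.mk_surjective (x₀ := b) (x₁ := b) x
  choose U hUo hxU hU using hloc
  obtain ⟨t, ht0, htm, ⟨n, hn⟩, ht⟩ :=
    exists_monotone_Icc_subset_open_cover_unitInterval (c := fun x => p ⁻¹' U x)
      (fun x => (hUo x).preimage p.continuous) fun s _ => Set.mem_iUnion.2 ⟨p s, hxU _⟩
  have hmul : ∀ {x y z : X} (q : Path.Homotopic.Quotient x y) (q' : Path.Homotopic.Quotient y z),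
      fromPath (((τ x).trans (q.trans q')).trans (τ z).symm) =
        fromPath (((τ y).trans q').trans (τ z).symm) *
          fromPath (((τ x).trans q).trans (τ y).symm) := by
    intro x y z q q'
    rw [mul_def]
    have : ((τ y).symm).trans ((τ y).trans (q'.trans (τ z).symm)) = q'.trans (τ z).symm := by
      rw [← Path.Homotopic.Quotient.trans_assoc, Path.Homotopic.Quotient.symm_trans,
        Path.Homotopic.Quotient.refl_trans]
    simp only [Path.Homotopic.Quotient.trans_assoc, this]
  have key : ∀ m, fromPath (((τ (p (t 0))).trans
      (Path.Homotopic.Quotient.mk (p.subpath (t 0) (t m)))).trans (τ (p (t m))).symm) ∈ H := by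
    intro m
    induction m with
    | zero =>
      rw [Path.subpath_self, Path.Homotopic.Quotient.mk_refl, Path.Homotopic.Quotient.trans_refl,
        Path.Homotopic.Quotient.trans_symm]
      exact H.one_mem
    | succ m ih =>
      have h1 : Path.Homotopic.Quotient.mk (p.subpath (t 0) (t (m + 1))) =
          (Path.Homotopic.Quotient.mk (p.subpath (t 0) (t m))).trans
            (Path.Homotopic.Quotient.mk (p.subpath (t m) (t (m + 1)))) :=
        (Path.Homotopic.Quotient.eq.2 ⟨Path.Homotopy.subpathTransSubpath p _ _ _⟩).symm
      rw [h1, hmul]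
      refine H.mul_mem ?_ ih
      obtain ⟨x, hx⟩ := ht m
      apply hU x
      rw [Path.range_subpath_of_le _ _ _ (htm m.le_succ)]
      rintro _ ⟨s, hs, rfl⟩
      exact hx hs
  have := key n
  rw [ht0, hn n le_rfl, Path.subpath_zero_one] at this
  have haux : ∀ {x y : X} (hx : x = b) (hy : y = b),
      fromPath (((τ x).trans (Path.Homotopic.Quotient.mk (p.cast hx hy))).trans (τ y).symm) ∈ H →
      fromPath (((τ b).trans (Path.Homotopic.Quotient.mk p)).trans (τ b).symm) ∈ H := by
    rintro _ _ rfl rfl h; exact h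
  have := haux _ _ this
  have h2 : fromPath (((τ b).trans (Path.Homotopic.Quotient.mk p)).trans (τ b).symm) =
      (fromPath (τ b))⁻¹ * (fromPath (Path.Homotopic.Quotient.mk p) * fromPath (τ b)) := rfl
  rw [h2] at this
  exact (H.mul_mem_cancel_right hb).1 ((H.mul_mem_cancel_left (H.inv_mem hb)).1 this)

theorem trans_trans_symm_trans {x y z w : X} (u : Path.Homotopic.Quotient x z)
    (v : Path.Homotopic.Quotient y z) (q : Path.Homotopic.Quotient z w) :
    (u.trans q).trans (v.trans q).symm = u.trans v.symm := by
  have : (v.trans q).symm = q.symm.trans v.symm := by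
    obtain ⟨v, rfl⟩ := Path.Homotopic.Quotient.mk_surjective v
    obtain ⟨q, rfl⟩ := Path.Homotopic.Quotient.mk_surjective q
    rw [← Path.Homotopic.Quotient.mk_trans, ← Path.Homotopic.Quotient.mk_symm, Path.trans_symm]
    rfl
  rw [this, Path.Homotopic.Quotient.trans_assoc, ← Path.Homotopic.Quotient.trans_assoc q,
    Path.Homotopic.Quotient.trans_symm, Path.Homotopic.Quotient.refl_trans]

theorem trans_symm_mem {b x : X} {H : Subgroup (FundamentalGroup X b)}
    {u v w : Path.Homotopic.Quotient b x} (h : fromPath (u.trans v.symm) ∈ H)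
    (h' : fromPath (v.trans w.symm) ∈ H) : fromPath (u.trans w.symm) ∈ H := by
  have : fromPath (u.trans w.symm) = fromPath (v.trans w.symm) * fromPath (u.trans v.symm) := by
    rw [mul_def]
    change u.trans w.symm = (u.trans v.symm).trans (v.trans w.symm)
    rw [Path.Homotopic.Quotient.trans_assoc, ← Path.Homotopic.Quotient.trans_assoc v.symm,
      Path.Homotopic.Quotient.symm_trans, Path.Homotopic.Quotient.refl_trans]
  exact this ▸ H.mul_mem h' h

/-- Two ways around the boundary of a square. -/
theorem homotopic_of_square (Γ : C(I × I, X)) {x x' c c' : X} (q : Path x x') (r : Path x' c')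
    (m : Path x c) (r' : Path c c') (hq : ∀ t, q t = Γ (t, 0)) (hr : ∀ s, r s = Γ (1, s))
    (hm : ∀ s, m s = Γ (0, s)) (hr' : ∀ t, r' t = Γ (t, 1)) :
    (q.trans r).Homotopic (m.trans r') := by
  let e : Path ((0, 0) : I × I) (1, 0) := ⟨⟨fun t => (t, 0), by fun_prop⟩, rfl, rfl⟩
  let e₁ : Path ((1, 0) : I × I) (1, 1) := ⟨⟨fun t => (1, t), by fun_prop⟩, rfl, rfl⟩
  let e₂ : Path ((0, 0) : I × I) (0, 1) := ⟨⟨fun t => (0, t), by fun_prop⟩, rfl, rfl⟩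
  let e₃ : Path ((0, 1) : I × I) (1, 1) := ⟨⟨fun t => (t, 1), by fun_prop⟩, rfl, rfl⟩
  obtain rfl : Γ (0, 0) = x := by rw [← hq, q.source]
  obtain rfl : Γ (1, 0) = x' := by rw [← hq, q.target]
  obtain rfl : Γ (0, 1) = c := by rw [← hm, m.target]
  obtain rfl : Γ (1, 1) = c' := by rw [← hr, r.target]
  obtain rfl : q = e.map Γ.continuous := Path.ext (funext hq)
  obtain rfl : r = e₁.map Γ.continuous := Path.ext (funext hr)
  obtain rfl : m = e₂.map Γ.continuous := Path.ext (funext hm)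
  obtain rfl : r' = e₃.map Γ.continuous := Path.ext (funext hr')
  rw [← Path.map_trans, ← Path.map_trans]
  exact (SimplyConnectedSpace.paths_homotopic _ _).map Γ

end LocalCriterion

/-! ### The neighbourhood of the vertex -/

section VertexStar

variable {g : ℕ} (hg : 0 < g)

include hg in
theorem bdPt_pow (a : ℝ) : (bdPt g a : ℂ) ^ (4 * g) = (Circle.exp (2 * π * a) : ℂ) := by
  have hg' : (0 : ℝ) < g := by exact_mod_cast hg
  rw [bdPt, ← Circle.coe_pow, ← Circle.exp_natCast_mul]
  congr 2
  push_cast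
  field_simp

include hg in
theorem bdPt_pow_natCast_add (k : ℕ) (t : ℝ) :
    (bdPt g (k + t) : ℂ) ^ (4 * g) = (Circle.exp (2 * π * t) : ℂ) := by
  rw [bdPt_pow hg]
  exact congrArg _ (Circle.exp_eq_exp.2 ⟨k, by push_cast; ring⟩)

include hg in
/-- In terms of the power `z ^ (4 * g)`, which wraps each edge once around the circle, the side
pairing is complex conjugation. -/
theorem IsPartner.pow_eq {z z' : Disc} (h : IsPartner g z z') :
    (z' : ℂ) ^ (4 * g) = starRingEnd ℂ ((z : ℂ) ^ (4 * g)) := by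
  obtain ⟨k, hk, t, h0, h1, rfl, rfl⟩ := h
  have h2 : ((opp k : ℕ) : ℝ) + (1 - t) = (opp k + 1 : ℕ) + (-t) := by push_cast; ring
  rw [h2, bdPt_pow_natCast_add hg, bdPt_pow_natCast_add hg, mul_neg, Circle.exp_neg,
    Circle.coe_inv_eq_conj]

include hg in
theorem IsVertex.pow_eq {z : Disc} (h : IsVertex g z) : (z : ℂ) ^ (4 * g) = 1 := by
  obtain ⟨k, rfl⟩ := h
  have := bdPt_pow_natCast_add hg k 0
  simpa using this

/-- The union of the open sectors around the vertices of the polygon. -/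
def vertexStar (g : ℕ) : Set Disc := {z | (z : ℂ) ^ (4 * g) ∈ Complex.slitPlane}

theorem isOpen_vertexStar (g : ℕ) : IsOpen (vertexStar g) :=
  Complex.isOpen_slitPlane.preimage (by fun_prop)

include hg in
theorem ne_zero_of_mem_vertexStar {z : Disc} (hz : z ∈ vertexStar g) : (z : ℂ) ≠ 0 := by
  intro h
  apply Complex.slitPlane_ne_zero hz
  rw [h, zero_pow (by omega)]

include hg in
theorem mem_vertexStar_of_mk_eq_mk {z z' : Disc} (hz : z ∈ vertexStar g)
    (h : proj g z = proj g z') : z' ∈ vertexStar g := by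
  rcases mk_eq_mk hg h with rfl | h | ⟨-, h⟩
  · exact hz
  · unfold vertexStar
    rw [Set.mem_ofPred_eq, h.pow_eq hg]
    obtain ⟨h1, h2⟩ := Complex.mem_slitPlane_iff_arg.1 hz
    refine Complex.mem_slitPlane_iff_arg.2 ⟨?_, by simpa using h2⟩
    rw [Complex.arg_conj, if_neg h1]
    have := Complex.neg_pi_lt_arg ((z : ℂ) ^ (4 * g))
    linarith
  · unfold vertexStar
    rw [Set.mem_ofPred_eq, h.pow_eq hg]
    exact Complex.one_mem_slitPlane

/-- The deformation of the sectors around the vertices which moves each point radially to the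
boundary while turning it into the nearest vertex. -/
noncomputable def toVertex (g : ℕ) (z : Disc) (s : I) : Disc :=
  ⟨(((1 - s) * ‖(z : ℂ)‖ + s : ℝ) : ℂ) * ((z : ℂ) * ((‖(z : ℂ)‖⁻¹ : ℝ) : ℂ)) *
    (Circle.exp (-(s * (Complex.arg ((z : ℂ) ^ (4 * g)) / (4 * g)))) : ℂ), by
    have h0 := s.2.1
    have h1 := s.2.2
    have hz := norm_disc_le z
    have hz0 := norm_nonneg (z : ℂ)
    have h2 : ‖(z : ℂ) * ((‖(z : ℂ)‖⁻¹ : ℝ) : ℂ)‖ ≤ 1 := by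
      rw [norm_mul, Complex.norm_real, norm_inv, norm_norm]
      exact mul_inv_le_one
    rw [mem_closedBall_zero_iff, norm_mul, norm_mul, Circle.norm_coe, mul_one, Complex.norm_real,
      Real.norm_of_nonneg (by nlinarith)]
    refine mul_le_one₀ (by nlinarith) (norm_nonneg _) h2⟩

include hg in
theorem continuousOn_toVertex :
    ContinuousOn (Function.uncurry (toVertex g)) (vertexStar g ×ˢ Set.univ) := by
  rw [continuousOn_iff_continuous_domRestrict]
  refine Continuous.subtype_mk ?_ _
  have harg : Continuous fun p : (vertexStar g ×ˢ (Set.univ : Set I) : Set (Disc × I)) =>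
      Complex.arg ((p.1.1 : ℂ) ^ (4 * g)) := by
    rw [continuous_iff_continuousAt]
    rintro ⟨⟨z, s⟩, hz, -⟩
    exact ContinuousAt.comp (g := Complex.arg) (Complex.continuousAt_arg hz)
      (Continuous.continuousAt (by fun_prop))
  have hnorm : Continuous fun p : (vertexStar g ×ˢ (Set.univ : Set I) : Set (Disc × I)) =>
      ‖(p.1.1 : ℂ)‖⁻¹ :=
    Continuous.inv₀ (by fun_prop) fun p => norm_ne_zero_iff.2 (ne_zero_of_mem_vertexStar hg p.2.1)
  fun_prop

include hg in
theorem toVertex_zero {z : Disc} (hz : z ∈ vertexStar g) : toVertex g z 0 = z := by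
  have := norm_ne_zero_iff.2 (ne_zero_of_mem_vertexStar hg hz)
  apply Subtype.ext
  have h2 : ((‖(z : ℂ)‖ : ℝ) : ℂ) ≠ 0 := by exact_mod_cast this
  simp only [toVertex, Set.Icc.coe_zero, sub_zero, one_mul, add_zero, zero_mul, neg_zero,
    Circle.exp_zero, Circle.coe_one, mul_one, Complex.ofReal_inv]
  field_simp

theorem toVertex_bdPt (a : ℝ) (s : I) : toVertex g (bdPt g a) s =
    bdPt g (a - s * (Complex.arg ((bdPt g a : ℂ) ^ (4 * g)) / (2 * π))) := by
  apply Subtype.ext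
  have hπ := Real.pi_ne_zero
  simp only [toVertex, norm_bdPt, mul_one, sub_add_cancel, Complex.ofReal_one, one_mul, inv_one]
  generalize Complex.arg _ = α
  rw [bdPt, bdPt, ← Circle.coe_mul, ← Circle.exp_add]
  congr 2
  field_simp
  ring

include hg in
/-- The argument of `z ^ (4 * g)` measures the distance from `z` to the nearest vertex, which is one
of the two end points of the edge towards which `z` points. -/
theorem arg_pow {z : Disc} (hz : z ∈ vertexStar g) {k : ℕ} {t : ℝ} (h0 : 0 ≤ t) (h1 : t < 1)
    (h : (z : ℂ) = ‖(z : ℂ)‖ * (bdPt g (k + t) : ℂ)) :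
    ∃ m : ℕ, m ≤ 1 ∧ Complex.arg ((z : ℂ) ^ (4 * g)) = 2 * π * (t - m) := by
  have hr := norm_pos_iff.2 (ne_zero_of_mem_vertexStar hg hz)
  have h2 : Complex.arg ((z : ℂ) ^ (4 * g)) = Complex.arg (Circle.exp (2 * π * t)) := by
    rw [h, mul_pow, bdPt_pow_natCast_add hg, ← Complex.ofReal_pow]
    exact Complex.arg_real_mul _ (pow_pos hr _)
  rw [h2]
  obtain ⟨m, hm⟩ := Circle.exp_eq_exp.1 (Circle.exp_arg (Circle.exp (2 * π * t)))
  have h3 := Complex.neg_pi_lt_arg (Circle.exp (2 * π * t))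
  have h4 := Complex.arg_le_pi (Circle.exp (2 * π * t))
  rw [hm] at h3 h4 ⊢
  have hπ := Real.pi_pos
  have h5 : (m : ℝ) < 1 := by nlinarith
  have h6 : (-2 : ℝ) < m := by nlinarith
  have h7 : m = 0 ∨ m = -1 := by
    have : m < 1 := by exact_mod_cast h5
    have : -2 < m := by exact_mod_cast h6
    omega
  rcases h7 with rfl | rfl
  · exact ⟨0, by omega, by simp⟩
  · exact ⟨1, le_rfl, by push_cast; ring⟩

include hg in
theorem proj_toVertex_one {z : Disc} (hz : z ∈ vertexStar g) :
    proj g (toVertex g z 1) = basePoint g := by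
  obtain ⟨k, hk, t, h0, h1, h⟩ := exists_polar hg z
  obtain ⟨m, -, hm⟩ := arg_pow hg hz h0 h1 h
  have hr := norm_ne_zero_iff.2 (ne_zero_of_mem_vertexStar hg hz)
  have hz1 : (z : ℂ) * ((‖(z : ℂ)‖⁻¹ : ℝ) : ℂ) = bdPt g (k + t) := by
    have hr' : ((‖(z : ℂ)‖ : ℝ) : ℂ) ≠ 0 := by exact_mod_cast hr
    rw [Complex.ofReal_inv]
    nth_rewrite 1 [h]
    field_simp
  have : toVertex g z 1 = bdPt g (k + m : ℕ) := by
    have hπ := Real.pi_ne_zero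
    have hg' : (g : ℝ) ≠ 0 := by positivity
    apply Subtype.ext
    simp only [toVertex]
    rw [hz1, hm, bdPt, bdPt, Set.Icc.coe_one, sub_self, zero_mul, zero_add, Complex.ofReal_one,
      one_mul, ← Circle.coe_mul, ← Circle.exp_add]
    congr 2
    push_cast
    field_simp
    ring
  rw [this, proj_bdPt hg]

include hg in
theorem proj_toVertex_eq {z z' : Disc} (hz : z ∈ vertexStar g) (h : proj g z = proj g z') (s : I) :
    proj g (toVertex g z s) = proj g (toVertex g z' s) := by
  have hπ := Real.pi_ne_zero
  rcases mk_eq_mk hg h with rfl | h | ⟨hv, hv'⟩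
  · rfl
  · have hp := h.pow_eq hg
    obtain ⟨k, hk, t, h0, h1, rfl, rfl⟩ := h
    obtain ⟨m, hm1, hm⟩ := arg_pow hg hz h0.le h1 (by rw [norm_bdPt, Complex.ofReal_one, one_mul])
    have h3 : Complex.arg ((bdPt g (opp k + (1 - t)) : ℂ) ^ (4 * g)) = -(2 * π * (t - m)) := by
      rw [hp, Complex.arg_conj, if_neg (Complex.mem_slitPlane_iff_arg.1 hz).1, hm]
    have hs0 := s.2.1
    have hs1 := s.2.2
    have hmem : t - s * (t - m) ∈ Set.Icc (0 : ℝ) 1 := by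
      interval_cases m
      · constructor <;> push_cast <;> nlinarith
      · constructor <;> push_cast <;> nlinarith
    rw [toVertex_bdPt, toVertex_bdPt, hm, h3]
    have := mk_edgePoint_opp hk ⟨_, hmem⟩
    rw [edgePoint_eq_bdPt, edgePoint_eq_bdPt, unitInterval.coe_symm_eq] at this
    refine Eq.trans (congrArg (proj g) ?_) (this.symm.trans (congrArg (proj g) ?_))
    · congr 1
      field_simp
      ring
    · congr 1
      field_simp
      ring
  · have hp := hv.pow_eq hg
    have hp' := hv'.pow_eq hg
    obtain ⟨k, rfl⟩ := hv
    obtain ⟨l, rfl⟩ := hv'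
    rw [toVertex_bdPt, toVertex_bdPt, hp, hp', Complex.arg_one, zero_div, mul_zero, sub_zero,
      sub_zero]
    exact h

end VertexStar

/-! ### Generators of the fundamental group of the surface -/

section Generation

open FundamentalGroup

variable {g : ℕ} (hg : 0 < g)

/-- The class of the image of a segment from the vertex `0` of the polygon to the point `z`. -/
noncomputable def radial {g : ℕ} (hg : 0 < g) (z : Disc) {x : Surface g} (hz : proj g z = x) :
    Path.Homotopic.Quotient (basePoint g) x :=
  ((Path.Homotopic.Quotient.mk (PathConnectedSpace.somePath (bdPt g (0 : ℕ)) z)).map (proj g)).cast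
    (proj_bdPt hg 0).symm hz.symm

theorem radial_trans {z z' : Disc} {x x' : Surface g} (hz : proj g z = x) (hz' : proj g z' = x')
    (p : Path z z') (q : Path x x') (h : ∀ t, q t = proj g (p t)) :
    (radial hg z hz).trans (Path.Homotopic.Quotient.mk q) = radial hg z' hz' := by
  subst hz hz'
  obtain rfl : q = p.map (proj g).continuous := Path.ext (funext h)
  have h1 : Path.Homotopic.Quotient.mk (PathConnectedSpace.somePath (bdPt g (0 : ℕ)) z') =
      (Path.Homotopic.Quotient.mk (PathConnectedSpace.somePath (bdPt g (0 : ℕ)) z)).trans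
        (Path.Homotopic.Quotient.mk p) :=
    Path.Homotopic.Quotient.eq.2 (SimplyConnectedSpace.paths_homotopic _ _)
  rw [radial, radial, h1]
  generalize_proofs h2 h3 h4
  clear h1 h
  revert h2 h3
  generalize basePoint g = b
  rintro rfl -
  generalize PathConnectedSpace.somePath (bdPt g (0 : ℕ)) z = r
  rw [← Path.Homotopic.Quotient.mk_trans, ← Path.Homotopic.Quotient.mk_map,
    ← Path.Homotopic.Quotient.mk_map, Path.map_trans]
  rfl

variable (H : Subgroup (PiOne g)) (ha : ∀ i, aClass g i ∈ H) (hb : ∀ i, bClass g i ∈ H)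

include ha hb

theorem chordCls_mem (k : ℕ) (hk : k ≤ 4 * g) : chordCls hg 0 k ∈ H := by
  induction k with
  | zero => rw [chordCls, pathCls_self]; exact H.one_mem
  | succ k ih =>
    rw [← chordCls_mul hg 0 k]
    refine H.mul_mem ?_ (ih (by omega))
    obtain ⟨m, r, hr, rfl⟩ : ∃ m r, r < 4 ∧ k = 4 * m + r := ⟨k / 4, k % 4, by omega, by omega⟩
    have hm : m < g := by omega
    interval_cases r
    · exact (chordCls_a hg ⟨m, hm⟩) ▸ ha _
    · exact (chordCls_b hg ⟨m, hm⟩) ▸ hb _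
    · exact (chordCls_a' hg ⟨m, hm⟩) ▸ H.inv_mem (ha _)
    · exact (chordCls_b' hg ⟨m, hm⟩) ▸ H.inv_mem (hb _)

theorem chordCls_mem' (k : ℕ) : chordCls hg 0 k ∈ H := by
  have h : chordCls hg 0 k = chordCls hg 0 (k % (4 * g)) := by
    unfold chordCls
    congr 1
    exact (bdPt_natCast_mod hg k).symm
  rw [h]
  exact chordCls_mem hg H ha hb _ (Nat.mod_lt _ (by omega)).le

/-- Modulo `H`, the radial class of a point of the surface is independent of the chosen preimage. -/
theorem radial_mem {z z' : Disc} {x : Surface g} (hz : proj g z = x) (hz' : proj g z' = x) :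
    fromPath ((radial hg z hz).trans (radial hg z' hz').symm) ∈ H := by
  rcases mk_eq_mk hg (hz.trans hz'.symm) with rfl | h | ⟨⟨k, rfl⟩, ⟨l, rfl⟩⟩
  · rw [Path.Homotopic.Quotient.trans_symm]; exact H.one_mem
  · obtain ⟨k, hk, t, h0, h1, rfl, rfl⟩ := h
    let e : Path (bdPt g k) (bdPt g (k + t)) :=
      { toFun := fun s => bdPt g (k + s * t), continuous_toFun := by fun_prop,
        source' := by simp, target' := by simp }
    let e' : Path (bdPt g (opp k + 1 : ℕ)) (bdPt g (opp k + (1 - t))) :=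
      { toFun := fun s => bdPt g (opp k + (1 - s * t)), continuous_toFun := by fun_prop,
        source' := by simp, target' := by simp }
    have hee : ∀ s, proj g (e s) = proj g (e' s) := fun s =>
      (mk_edgePoint_opp hk ⟨s * t, mul_nonneg s.2.1 h0.le, mul_le_one₀ s.2.2 h0.le h1.le⟩).symm
    let q : Path (basePoint g) x :=
      (e.map (proj g).continuous).cast (proj_bdPt hg k).symm hz.symm
    rw [← radial_trans hg (proj_bdPt hg k) hz e q fun _ => rfl,
      ← radial_trans hg (proj_bdPt hg (opp k + 1)) hz' e' q hee]
    rw [trans_trans_symm_trans]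
    have h := H.mul_mem (H.inv_mem (chordCls_mem' hg H ha hb (opp k + 1)))
      (chordCls_mem' hg H ha hb k)
    exact h
  · obtain rfl : basePoint g = x := (proj_bdPt hg k).symm.trans hz
    exact H.mul_mem (H.inv_mem (chordCls_mem' hg H ha hb l)) (chordCls_mem' hg H ha hb k)

/-- A path in the surface that is one side of a square whose two neighbouring sides can be lifted to
the polygon and whose fourth side is constant is trivial modulo `H`. -/
theorem radial_mem_of_square {x x' : Surface g} (q : Path x x') (Γ : C(I × I, Surface g))
    (c : Surface g) (hΓ : ∀ t, Γ (t, 0) = q t) (hc : ∀ t, Γ (t, 1) = c)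
    (hl : ∀ t, ∃ l : C(I, Disc), ∀ s, Γ (t, s) = proj g (l s)) {z z' : Disc} (hz : proj g z = x)
    (hz' : proj g z' = x') :
    fromPath (((radial hg z hz).trans (Path.Homotopic.Quotient.mk q)).trans
      (radial hg z' hz').symm) ∈ H := by
  obtain ⟨l, hl0⟩ := hl 0
  obtain ⟨l', hl1⟩ := hl 1
  let p : Path (l 0) (l 1) := ⟨l, rfl, rfl⟩
  let p' : Path (l' 0) (l' 1) := ⟨l', rfl, rfl⟩
  have h0 : proj g (l 0) = x := by rw [← hl0, hΓ, q.source]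
  have h1 : proj g (l 1) = c := by rw [← hl0, hc]
  have h0' : proj g (l' 0) = x' := by rw [← hl1, hΓ, q.target]
  have h1' : proj g (l' 1) = c := by rw [← hl1, hc]
  let m : Path x c := (p.map (proj g).continuous).cast h0.symm h1.symm
  let m' : Path x' c := (p'.map (proj g).continuous).cast h0'.symm h1'.symm
  -- The square itself shows that `q` is homotopic to `m` followed by the inverse of `m'`.
  have hq : (Path.Homotopic.Quotient.mk q).trans (Path.Homotopic.Quotient.mk m') =
      Path.Homotopic.Quotient.mk m := by
    refine Eq.trans ?_ (Path.Homotopic.Quotient.trans_refl _)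
    exact Path.Homotopic.Quotient.eq.2 (homotopic_of_square Γ q m' m (Path.refl c)
      (fun t => (hΓ t).symm) (fun s => (hl1 s).symm) (fun s => (hl0 s).symm) fun t => (hc t).symm)
  have hm := radial_trans hg h0 h1 p m fun _ => rfl
  have hm' := radial_trans hg h0' h1' p' m' fun _ => rfl
  refine trans_symm_mem (v := (radial hg (l 0) h0).trans (Path.Homotopic.Quotient.mk q)) ?_
    (trans_symm_mem (v := radial hg (l' 0) h0') ?_ (radial_mem hg H ha hb h0' hz'))
  · rw [trans_trans_symm_trans]
    exact radial_mem hg H ha hb hz h0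
  · have h2 : ((radial hg (l 0) h0).trans (Path.Homotopic.Quotient.mk q)).trans
        (Path.Homotopic.Quotient.mk m') = radial hg (l 1) h1 := by
      rw [Path.Homotopic.Quotient.trans_assoc, hq, hm]
    rw [← trans_trans_symm_trans _ _ (Path.Homotopic.Quotient.mk m'), h2, hm']
    exact radial_mem hg H ha hb h1 h1'

/-- Paths in an open set are trivial modulo `H` if the set has a contraction to a point which is
induced by a deformation of its preimage in the polygon. -/
theorem radial_mem_of_contraction {U : Set (Surface g)} (hU : IsOpen U)
    (f : C((proj g ⁻¹' U) × I, Disc))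
    (hf : ∀ z z' : proj g ⁻¹' U, proj g z = proj g z' → ∀ s, proj g (f (z, s)) = proj g (f (z', s)))
    (h0 : ∀ z, f (z, 0) = z) (c : Surface g) (h1 : ∀ z, proj g (f (z, 1)) = c)
    {x x' : Surface g} (q : Path x x') (hq : Set.range q ⊆ U) {z z' : Disc} (hz : proj g z = x)
    (hz' : proj g z' = x') :
    fromPath (((radial hg z hz).trans (Path.Homotopic.Quotient.mk q)).trans
      (radial hg z' hz').symm) ∈ H := by
  have hQ : Topology.IsQuotientMap ((proj g).restrictPreimage U) :=
    (isQuotientMap_proj g).restrictPreimage_isOpen hU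
  let F : C(proj g ⁻¹' U, C(I, Surface g)) := ((proj g).comp f).curry
  have hF : Function.FactorsThrough F ((proj g).restrictPreimage U) := fun z z' h =>
    ContinuousMap.ext (hf z z' (congrArg Subtype.val h))
  let G : C(U, C(I, Surface g)) := hQ.lift F hF
  have hG : ∀ z : proj g ⁻¹' U, ∀ s, G ⟨proj g z, z.2⟩ s = proj g (f (z, s)) := fun z s =>
    congrArg (fun k : C(I, Surface g) => k s) (ContinuousMap.congr_fun (hQ.lift_comp F hF) z)
  let q' : C(I, U) := ⟨fun t => ⟨q t, hq ⟨t, rfl⟩⟩, by fun_prop⟩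
  have hq' : ∀ t, ∃ z : proj g ⁻¹' U, ∀ s, (G.comp q').uncurry (t, s) = proj g (f (z, s)) := by
    intro t
    obtain ⟨z, hz⟩ := (isQuotientMap_proj g).surjective (q t)
    have hzU : z ∈ proj g ⁻¹' U := by
      change proj g z ∈ U
      rw [hz]
      exact hq ⟨t, rfl⟩
    refine ⟨⟨z, hzU⟩, fun s => ?_⟩
    rw [← hG]
    change G (q' t) s = _
    congr 2
    exact Subtype.ext hz.symm
  refine radial_mem_of_square hg H ha hb q (G.comp q').uncurry c (fun t => ?_) (fun t => ?_)
    (fun t => ?_) hz hz'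
  · obtain ⟨z, hz⟩ := (isQuotientMap_proj g).surjective (q t)
    have hzU : z ∈ proj g ⁻¹' U := by
      change proj g z ∈ U
      rw [hz]
      exact hq ⟨t, rfl⟩
    have : G (q' t) = G ⟨proj g z, hzU⟩ := congrArg G (Subtype.ext hz.symm)
    change G (q' t) 0 = _
    rw [this, hG ⟨z, hzU⟩, h0, hz]
  · obtain ⟨z, hz⟩ := hq' t
    rw [hz, h1]
  · obtain ⟨z, hz⟩ := hq' t
    exact ⟨f.comp ⟨fun s => (z, s), by fun_prop⟩, hz⟩

/-- The interior of the polygon is contracted to the centre. -/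
theorem radial_mem_interior : ∃ U : Set (Surface g), IsOpen U ∧
    (∀ z : Disc, ‖(z : ℂ)‖ < 1 → proj g z ∈ U) ∧
    ∀ (x x' : Surface g) (q : Path x x'), Set.range q ⊆ U → ∀ {z z' : Disc} (hz : proj g z = x)
    (hz' : proj g z' = x'), fromPath (((radial hg z hz).trans (Path.Homotopic.Quotient.mk q)).trans
      (radial hg z' hz').symm) ∈ H := by
  have hpre : proj g ⁻¹' (proj g '' {z : Disc | ‖(z : ℂ)‖ < 1}) = {z : Disc | ‖(z : ℂ)‖ < 1} := by
    ext z
    constructor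
    · rintro ⟨w, hw, h⟩
      rwa [← eq_of_mk_eq_mk hg hw h]
    · exact fun hz => ⟨z, hz, rfl⟩
  have hU : IsOpen (proj g '' {z : Disc | ‖(z : ℂ)‖ < 1}) := by
    rw [← (isQuotientMap_proj g).isOpen_preimage, hpre]
    exact isOpen_lt (by fun_prop) continuous_const
  refine ⟨_, hU, fun z hz => ⟨z, hz, rfl⟩, fun x x' q hq z z' hz hz' => ?_⟩
  let o : Disc := ⟨0, by simp⟩
  refine radial_mem_of_contraction hg H ha hb hU ⟨fun p => lerp p.1 o p.2, by fun_prop⟩ ?_ ?_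
    (proj g o) ?_ q hq hz hz'
  · rintro ⟨z, hz⟩ ⟨z', hz'⟩ h s
    rw [hpre] at hz
    obtain rfl := eq_of_mk_eq_mk hg hz h
    rfl
  · intro z; exact lerp_zero _ _
  · intro z; exact congrArg (proj g) (lerp_one _ _)

/-- The square around the midpoint of an edge is contracted to the centre. -/
theorem radial_mem_edge {e : ℕ} (he : e < 4 * g) (he4 : e % 4 < 2) : ∃ U : Set (Surface g),
    IsOpen U ∧ (∀ t : ℝ, 0 < t → t < 1 → proj g (bdPt g (e + t)) ∈ U) ∧
    ∀ (x x' : Surface g) (q : Path x x'), Set.range q ⊆ U → ∀ {z z' : Disc} (hz : proj g z = x)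
    (hz' : proj g z' = x'), fromPath (((radial hg z hz).trans (Path.Homotopic.Quotient.mk q)).trans
      (radial hg z' hz').symm) ∈ H := by
  let E := crossHomeo he he4
  have hE : ∀ x ∈ E.target, crossChart he he4 (E.symm x) = x := fun x hx => E.right_inv hx
  have hE' : ∀ x ∈ E.target, E.symm x ∈ crossSquare := fun x hx => E.map_target hx
  refine ⟨E.target, E.open_target, fun t h0 h1 => ?_, fun x x' q hq z z' hz hz' => ?_⟩
  · refine ⟨(0, t - 1 / 2), ⟨⟨by norm_num, by norm_num⟩, ?_, ?_⟩, ?_⟩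
    · change -(1 / 2) < t - 1 / 2; linarith
    · change t - 1 / 2 < 1 / 2; linarith
    · have h2 := singleAnnulus_proj he he4 ⟨t, h0.le, h1.le⟩ 1
      have h3 := (singleAnnulus he he4).periodic ⟨t, h0.le, h1.le⟩ 0
      rw [crossChart]
      simp only [add_sub_cancel]
      rw [Set.projIcc_of_mem zero_le_one ⟨h0.le, h1.le⟩, ← h3, zero_add]
      refine h2.symm.trans ?_
      rw [chord_one]
      congr 2
      change (e : ℝ) + 3 / 2 - (3 / 2 - t) = _
      ring
  · have hpc : ContinuousOn E.symm E.target := E.continuousOn_symm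
    let p : C(I, ℝ × ℝ) := ⟨fun t => E.symm (q t), hpc.comp_continuous q.continuous
      fun t => hq ⟨t, rfl⟩⟩
    refine radial_mem_of_square hg H ha hb q
      ⟨fun v => crossChart he he4 ((1 - (v.2 : ℝ)) • p v.1),
        (continuous_crossChart he he4).comp (by fun_prop)⟩ (crossChart he he4 0) (fun t => ?_)
      (fun t => ?_) (fun t => ?_) hz hz'
    · change crossChart he he4 ((1 - (0 : ℝ)) • p t) = _
      rw [sub_zero, one_smul]
      exact hE _ (hq ⟨t, rfl⟩)
    · change crossChart he he4 ((1 - (1 : ℝ)) • p t) = _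
      rw [sub_self, zero_smul]
    · have hpt : p t ∈ crossSquare := hE' _ (hq ⟨t, rfl⟩)
      obtain ⟨r, hr⟩ : ∃ r, p t = r := ⟨_, rfl⟩
      rw [hr] at hpt
      obtain ⟨⟨h1, h2⟩, h3, h4⟩ := hpt
      -- The scaled points stay on one side of the edge, so that the path lies in one strip.
      have : ∃ u : C(I, I), ∀ s : I, ((u s : ℝ) = (1 - (s : ℝ)) * r.1) ∨
          ((u s : ℝ) = (1 - (s : ℝ)) * r.1 + 1) := by
        rcases le_or_gt 0 r.1 with h | h
        · exact ⟨⟨fun s => ⟨(1 - s) * r.1, by have := s.2.1; have := s.2.2; nlinarith,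
            by have := s.2.1; have := s.2.2; nlinarith⟩, by fun_prop⟩, fun s => Or.inl rfl⟩
        · exact ⟨⟨fun s => ⟨(1 - s) * r.1 + 1, by have := s.2.1; have := s.2.2; nlinarith,
            by have := s.2.1; have := s.2.2; nlinarith⟩, by fun_prop⟩, fun s => Or.inr rfl⟩
      obtain ⟨u, hu⟩ := this
      refine ⟨⟨fun s => chord g (e + 3 / 2) (3 / 2 -
        (Set.projIcc 0 1 zero_le_one (1 / 2 + (1 - (s : ℝ)) * r.2) : I)) (u s), by fun_prop⟩,
        fun s => ?_⟩
      change _ = proj g (chord _ _ _ _)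
      rw [singleAnnulus_proj he he4]
      change crossChart he he4 ((1 - (s : ℝ)) • p t) = _
      rw [hr]
      rcases hu s with h | h
      · rw [h]; rfl
      · rw [h, (singleAnnulus he he4).periodic]; rfl

/-- The sectors around the vertices are contracted to the base point. -/
theorem radial_mem_vertex : ∃ U : Set (Surface g), IsOpen U ∧ basePoint g ∈ U ∧
    ∀ (x x' : Surface g) (q : Path x x'), Set.range q ⊆ U → ∀ {z z' : Disc} (hz : proj g z = x)
    (hz' : proj g z' = x'), fromPath (((radial hg z hz).trans (Path.Homotopic.Quotient.mk q)).trans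
      (radial hg z' hz').symm) ∈ H := by
  have hpre : proj g ⁻¹' (proj g '' vertexStar g) = vertexStar g := by
    ext z
    constructor
    · rintro ⟨w, hw, h⟩
      exact mem_vertexStar_of_mk_eq_mk hg hw h
    · exact fun hz => ⟨z, hz, rfl⟩
  have hU : IsOpen (proj g '' vertexStar g) := by
    rw [← (isQuotientMap_proj g).isOpen_preimage, hpre]
    exact isOpen_vertexStar g
  have hmem : ∀ z : proj g ⁻¹' (proj g '' vertexStar g), (z : Disc) ∈ vertexStar g := fun z =>
    hpre.subset z.2
  have h0 : IsVertex g (bdPt g (0 : ℕ)) := ⟨0, rfl⟩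
  have hb0 : basePoint g ∈ proj g '' vertexStar g := by
    refine ⟨_, ?_, proj_bdPt hg 0⟩
    unfold vertexStar
    rw [Set.mem_ofPred_eq, h0.pow_eq hg]
    exact Complex.one_mem_slitPlane
  refine ⟨_, hU, hb0, fun x x' q hq z z' hz hz' => ?_⟩
  refine radial_mem_of_contraction hg H ha hb hU ⟨fun p => toVertex g p.1 p.2, ?_⟩ ?_ ?_
    (basePoint g) ?_ q hq hz hz'
  · exact (continuousOn_toVertex hg).comp_continuous
      (f := fun p : (proj g ⁻¹' (proj g '' vertexStar g)) × I => ((p.1 : Disc), p.2))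
      (by fun_prop) fun p => ⟨hmem p.1, trivial⟩
  · exact fun z z' h s => proj_toVertex_eq hg (hmem z) h s
  · exact fun z => toVertex_zero hg (hmem z)
  · exact fun z => proj_toVertex_one hg (hmem z)

include hg in
/-- The loops `a_i` and `b_i` generate the fundamental group. -/
theorem eq_top_of_mem : H = ⊤ := by
  have hs := (isQuotientMap_proj g).surjective
  choose out hout using hs
  refine eq_top_of_locally_mem H (fun x => radial hg (out x) (hout x)) ?_ fun x => ?_
  · have h := radial_mem hg H ha hb (hout (basePoint g)) (proj_bdPt hg 0)
    have h1 : radial hg (bdPt g (0 : ℕ)) (proj_bdPt hg 0) =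
        Path.Homotopic.Quotient.refl (basePoint g) :=
      pathCls_self (proj g) (proj_bdPt hg 0) (proj_bdPt hg 0)
    have h2 : ∀ u v : Path.Homotopic.Quotient (basePoint g) (basePoint g),
        v = Path.Homotopic.Quotient.refl (basePoint g) → u.trans v.symm = u := by
      rintro u _ rfl
      exact Path.Homotopic.Quotient.trans_refl u
    rwa [h2 _ _ h1] at h
  · obtain ⟨z, rfl⟩ := (isQuotientMap_proj g).surjective x
    obtain ⟨k, hk, t, h0, h1, hz⟩ := exists_polar hg z
    rcases (norm_disc_le z).lt_or_eq with hn | hn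
    · obtain ⟨U, hU, hzU, h⟩ := radial_mem_interior hg H ha hb
      exact ⟨U, hU, hzU z hn, fun x x' q hq => h x x' q hq _ _⟩
    rw [hn, Complex.ofReal_one, one_mul] at hz
    obtain rfl := Subtype.ext hz
    rcases h0.eq_or_lt with rfl | h0
    · obtain ⟨U, hU, hzU, h⟩ := radial_mem_vertex hg H ha hb
      refine ⟨U, hU, ?_, fun x x' q hq => h x x' q hq _ _⟩
      rwa [add_zero, proj_bdPt hg]
    · by_cases hk4 : k % 4 < 2
      · obtain ⟨U, hU, hzU, h⟩ := radial_mem_edge hg H ha hb hk hk4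
        exact ⟨U, hU, hzU t h0 h1, fun x x' q hq => h x x' q hq _ _⟩
      · obtain ⟨U, hU, hzU, h⟩ := radial_mem_edge hg H ha hb (opp_lt hk)
          (by unfold opp; split_ifs; omega)
        refine ⟨U, hU, ?_, fun x x' q hq => h x x' q hq _ _⟩
        have h2 : proj g (bdPt g (k + t)) = proj g (bdPt g (opp k + (1 - t))) :=
          (mk_edgePoint_opp hk ⟨t, h0.le, h1.le⟩).symm
        rw [h2]
        exact hzU _ (by linarith) (by linarith)

end Generation

/-- `π₁(Σ_g)` is generated by the classes `a_i` and `b_i`. -/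
theorem piOne_hom_ext {g : ℕ} (hg : 0 < g) {G : Type*} [Group G] {φ ψ : PiOne g →* G}
    (ha : ∀ i, φ (aClass g i) = ψ (aClass g i)) (hb : ∀ i, φ (bClass g i) = ψ (bClass g i)) :
    φ = ψ :=
  MonoidHom.eq_of_eqOn_top (fun x _ => by
    have : x ∈ φ.eqLocus ψ := by
      rw [eq_top_of_mem hg (φ.eqLocus ψ) ha hb]; trivial
    exact this)

/-! ### The map onto a bouquet of circles -/

section Petals

open Topology

variable {g : ℕ}

/-- The function on the polygon which parametrises the `i`-th block of four edges as the loop `a_i`: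
on its first three edges it is `t`, `1` and `1 - t`, and it vanishes outside the cap which is cut
off by the chord under these three edges. -/
noncomputable def petal (g : ℕ) (i : ℕ) (z : Disc) : I :=
  Set.projIcc 0 1 zero_le_one (3 / 2 - halfAngle g (4 * i + 3 / 2) z)

@[fun_prop]
theorem continuous_petal (g i : ℕ) : Continuous (petal g i) := by
  unfold petal
  fun_prop

theorem petal_eq_zero_iff {i : ℕ} {z : Disc} :
    petal g i z = 0 ↔ 3 / 2 ≤ halfAngle g (4 * i + 3 / 2) z := by
  have := Set.projIcc_eq_left (a := (0 : ℝ)) (b := 1) (x := 3 / 2 - halfAngle g (4 * i + 3 / 2) z)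
    zero_lt_one
  rw [sub_nonpos] at this
  exact this

theorem rot_mul (μ ν : ℝ) (z : Disc) :
    rot g μ z = rot g ν z * (Circle.exp (2 * π * ((ν - μ) / (4 * g))) : ℂ) := by
  rw [rot, rot, mul_assoc (z : ℂ), ← Circle.coe_mul, ← Circle.exp_add]
  congr 3
  ring

/-- A cap is cut off by a half-plane. -/
theorem lt_rot_re (hg : 0 < g) {μ : ℝ} {z : Disc} (h : halfAngle g μ z < 3 / 2) :
    Real.cos (2 * π * (3 / 2 / (4 * g))) < (rot g μ z).re := by
  have hg' : (1 : ℝ) ≤ g := by exact_mod_cast hg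
  have h1 : |(rot g μ z).re| ≤ 1 :=
    (Complex.abs_re_le_norm _).trans ((norm_rot g μ z).le.trans (norm_disc_le z))
  rw [abs_le] at h1
  rw [← Real.cos_arccos h1.1 h1.2, ← angle_halfAngle hg]
  have h0 := halfAngle_nonneg g μ z
  have hπ := Real.pi_pos
  apply Real.cos_lt_cos_of_nonneg_of_le_pi (by positivity)
  · rw [← mul_div_assoc, div_le_iff₀ (by positivity)]
    nlinarith
  · gcongr

/-- The caps are disjoint. The axes of two caps are at angles `±δ` from the direction halfway
between them. If `w` is the coordinate of a common point with respect to this direction, then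
`cos (3π / 4g) < Re w * cos δ`, whereas `|cos δ| ≤ cos (π / g) ≤ cos (3π / 4g)`. -/
theorem petal_eq_zero_of_lt (hg : 0 < g) {i k : ℕ} (hik : i < k) (hk : k < g) (z : Disc)
    (hi : petal g i z ≠ 0) : petal g k z = 0 := by
  have hg' : (1 : ℝ) ≤ g := by exact_mod_cast hg
  have hπ := Real.pi_pos
  rw [petal_eq_zero_iff]
  rw [Ne, petal_eq_zero_iff, not_le] at hi
  by_contra! hk'
  have h1 := lt_rot_re hg hi
  have h2 := lt_rot_re hg hk'
  set ν : ℝ := 4 * i + 3 / 2 + 2 * (k - i) with hν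
  rw [rot_mul _ ν] at h1 h2
  set w := rot g ν z
  have hw : |w.re| ≤ 1 :=
    (Complex.abs_re_le_norm _).trans ((norm_rot g ν z).le.trans (norm_disc_le z))
  set δ : ℝ := π * ((k - i) / g) with hδ
  have e1 : 2 * π * ((ν - (4 * i + 3 / 2)) / (4 * g)) = δ := by
    rw [hδ, hν]; field_simp; ring
  have e2 : 2 * π * ((ν - (4 * k + 3 / 2)) / (4 * g)) = -δ := by
    rw [hδ, hν]; field_simp; ring
  rw [e1, Complex.mul_re, exp_re, exp_im] at h1
  rw [e2, Complex.mul_re, exp_re, exp_im, Real.cos_neg, Real.sin_neg] at h2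
  have h3 : Real.cos (2 * π * (3 / 2 / (4 * g))) < w.re * Real.cos δ := by linarith
  have hki : (1 : ℝ) ≤ k - i := by
    have : (i : ℝ) + 1 ≤ k := by exact_mod_cast hik
    linarith
  have hki' : (k : ℝ) - i ≤ g - 1 := by
    have : (k : ℝ) + 1 ≤ g := by exact_mod_cast hk
    have : (0 : ℝ) ≤ i := by positivity
    linarith
  have hd0 : π / g ≤ δ := by
    rw [hδ, ← mul_div_assoc]
    gcongr
    nlinarith
  have hd1 : δ ≤ π - π / g := by
    rw [hδ, ← mul_div_assoc, div_le_iff₀ (by positivity)]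
    field_simp
    nlinarith
  have hgpos : 0 < π / g := by positivity
  have h4 : Real.cos δ ≤ Real.cos (π / g) :=
    Real.cos_le_cos_of_nonneg_of_le_pi hgpos.le (by linarith) hd0
  have h5 : -Real.cos (π / g) ≤ Real.cos δ := by
    rw [← Real.cos_pi_sub]
    exact Real.cos_le_cos_of_nonneg_of_le_pi (by linarith) (by linarith) hd1
  have h6 : Real.cos (π / g) ≤ Real.cos (2 * π * (3 / 2 / (4 * g))) := by
    refine Real.cos_le_cos_of_nonneg_of_le_pi (by positivity) (by linarith) ?_
    rw [← mul_div_assoc, div_le_div_iff₀ (by positivity) (by positivity)]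
    nlinarith
  have h7 : w.re * Real.cos δ ≤ |Real.cos δ| := by
    refine (le_abs_self _).trans ?_
    rw [abs_mul]
    exact mul_le_of_le_one_left (abs_nonneg _) hw
  have h8 : |Real.cos δ| ≤ Real.cos (π / g) := abs_le.2 ⟨h5, h4⟩
  linarith

theorem petal_eq_zero (hg : 0 < g) {i k : Fin g} (hik : i ≠ k) (z : Disc)
    (hi : petal g i z ≠ 0) : petal g k z = 0 := by
  rcases lt_or_gt_of_ne hik with h | h
  · exact petal_eq_zero_of_lt hg h k.2 z hi
  · by_contra hk
    exact hi (petal_eq_zero_of_lt hg h i.2 z hk)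

theorem petal_edgePoint_of_ne {i k : Fin g} (hik : k ≠ i) {r : ℕ} (hr : r < 4) (t : I) :
    petal g k (edgePoint g (4 * i + r) t) = 0 := by
  have hg : 0 < g := i.pos
  have ht0 := t.2.1
  have ht1 := t.2.2
  have hr' : (r : ℝ) ≤ 3 := by exact_mod_cast Nat.le_of_lt_succ hr
  have hr0 : (0 : ℝ) ≤ r := by positivity
  have hi : (i : ℝ) + 1 ≤ g := by exact_mod_cast i.2
  have hk : (k : ℝ) + 1 ≤ g := by exact_mod_cast k.2
  have hi0 : (0 : ℝ) ≤ (i : ℕ) := by positivity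
  have hk0 : (0 : ℝ) ≤ (k : ℕ) := by positivity
  rw [petal_eq_zero_iff, edgePoint_eq_bdPt]
  have hcase : ((i : ℕ) : ℝ) + 1 ≤ (k : ℕ) ∨ ((k : ℕ) : ℝ) + 1 ≤ (i : ℕ) := by
    rcases lt_or_gt_of_ne hik with h | h
    · right; exact_mod_cast h
    · left; exact_mod_cast h
  push_cast
  set a : ℝ := 4 * i + r + t with ha
  rcases le_or_gt |a - (4 * k + 3 / 2)| (2 * g) with h | h
  · rw [halfAngle_bdPt hg _ h, le_abs]
    rcases hcase with h | h
    · right; linarith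
    · left; linarith
  · rcases lt_abs.1 h with h | h
    · have e : bdPt g a = bdPt g (a - 4 * g) := by
        rw [← bdPt_add_period hg (a - 4 * g), sub_add_cancel]
      rw [e, halfAngle_bdPt hg]
      · rw [le_abs]; right; linarith
      · rw [abs_le]; constructor <;> linarith
    · rw [← bdPt_add_period hg, halfAngle_bdPt hg]
      · rw [le_abs]; left; linarith
      · rw [abs_le]; constructor <;> linarith

theorem halfAngle_edgePoint (i : Fin g) {r : ℕ} (hr : r < 3) (t : I) :
    halfAngle g (4 * i + 3 / 2) (edgePoint g (4 * i + r) t) = |r + (t : ℝ) - 3 / 2| := by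
  have hg : (1 : ℝ) ≤ g := by exact_mod_cast i.pos
  have hr' : (r : ℝ) ≤ 2 := by exact_mod_cast Nat.le_of_lt_succ hr
  have hr0 : (0 : ℝ) ≤ r := by positivity
  have ht0 := t.2.1
  have ht1 := t.2.2
  rw [edgePoint_eq_bdPt, halfAngle_bdPt i.pos]
  · congr 1; push_cast; ring
  · push_cast; rw [abs_le]; constructor <;> linarith

theorem petal_edgePoint_zero (i : Fin g) (t : I) : petal g i (edgePoint g (4 * i) t) = t := by
  have ht0 := t.2.1
  have ht1 := t.2.2
  have h := halfAngle_edgePoint i (r := 0) (by omega) t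
  rw [add_zero] at h
  rw [petal, h, abs_of_nonpos (by push_cast; linarith)]
  convert Set.projIcc_val zero_le_one t using 2
  push_cast
  ring

theorem petal_edgePoint_one (i : Fin g) (t : I) : petal g i (edgePoint g (4 * i + 1) t) = 1 := by
  have ht0 := t.2.1
  have ht1 := t.2.2
  rw [petal, halfAngle_edgePoint i (by omega)]
  refine Set.projIcc_of_right_le _ ?_
  have : |((1 : ℕ) : ℝ) + t - 3 / 2| ≤ 1 / 2 := by
    rw [abs_le]; push_cast; constructor <;> linarith
  linarith

theorem petal_edgePoint_two (i : Fin g) (t : I) : petal g i (edgePoint g (4 * i + 2) t) = σ t := by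
  have ht0 := t.2.1
  have ht1 := t.2.2
  rw [petal, halfAngle_edgePoint i (by omega), abs_of_nonneg (by push_cast; linarith)]
  convert Set.projIcc_val zero_le_one (σ t) using 2
  rw [unitInterval.coe_symm_eq]
  push_cast
  ring

theorem petal_edgePoint_three (i : Fin g) (t : I) : petal g i (edgePoint g (4 * i + 3) t) = 0 := by
  have hg : (1 : ℝ) ≤ g := by exact_mod_cast i.pos
  have ht0 := t.2.1
  have ht1 := t.2.2
  rw [petal_eq_zero_iff, edgePoint_eq_bdPt]
  rcases le_or_gt |((4 * (i : ℕ) + 3 : ℕ) : ℝ) + t - (4 * (i : ℕ) + 3 / 2)| (2 * g) with h | h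
  · rw [halfAngle_bdPt i.pos _ h, le_abs]
    left; push_cast; linarith
  · rcases lt_abs.1 h with h | h
    · have e : bdPt g (((4 * (i : ℕ) + 3 : ℕ) : ℝ) + t) =
          bdPt g (((4 * (i : ℕ) + 3 : ℕ) : ℝ) + t - 4 * g) := by
        rw [← bdPt_add_period i.pos (_ - 4 * g), sub_add_cancel]
      push_cast at h e ⊢
      rw [e, halfAngle_bdPt i.pos]
      · rw [le_abs]; right; linarith
      · rw [abs_le]; constructor <;> linarith
    · push_cast at h
      linarith

variable {X : Type*} [TopologicalSpace X] {x : X} (γ : Fin g → Path x x)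

open Classical in
/-- The map from the polygon which is the loop `γ i` on the `i`-th cap, composed with `petal`. -/
noncomputable def petalFun (z : Disc) : X :=
  if h : ∃ i : Fin g, petal g i z ≠ 0 then γ h.choose (petal g h.choose z) else x

theorem petalFun_eq {i : Fin g} {z : Disc} (h : ∀ k : Fin g, k ≠ i → petal g k z = 0) :
    petalFun γ z = γ i (petal g i z) := by
  unfold petalFun
  split_ifs with h'
  · have : h'.choose = i := by
      by_contra hne
      exact h'.choose_spec (h _ hne)
    rw [this]
  · push Not at h'
    rw [h' i, Path.source]

theorem exists_petal_eq_zero (hg : 0 < g) (z : Disc) :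
    ∃ i : Fin g, ∀ k : Fin g, k ≠ i → petal g k z = 0 := by
  by_cases h : ∃ i : Fin g, petal g i z ≠ 0
  · obtain ⟨i, hi⟩ := h
    exact ⟨i, fun k hk => petal_eq_zero hg hk.symm z hi⟩
  · push Not at h
    exact ⟨⟨0, hg⟩, fun k _ => h k⟩

theorem continuous_petalFun (hg : 0 < g) : Continuous (petalFun γ) := by
  have hfin : LocallyFinite fun i : Fin g => {z : Disc | ∀ k : Fin g, k ≠ i → petal g k z = 0} :=
    locallyFinite_of_finite _
  refine hfin.continuous ?_ ?_ ?_
  · refine Set.eq_univ_of_forall fun z => Set.mem_iUnion.2 (exists_petal_eq_zero hg z)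
  · intro i
    simp only [Set.ofPred_forall]
    exact isClosed_iInter fun k => isClosed_iInter fun _ =>
      isClosed_eq (continuous_petal g k) continuous_const
  · intro i
    refine ContinuousOn.congr (f := fun z => γ i (petal g i z)) ?_ fun z hz => petalFun_eq γ hz
    exact Continuous.continuousOn (by fun_prop)

theorem petalFun_edgePoint (i : Fin g) {r : ℕ} (hr : r < 4) (t : I) :
    petalFun γ (edgePoint g (4 * i + r) t) = γ i (petal g i (edgePoint g (4 * i + r) t)) :=
  petalFun_eq γ fun _ hk => petal_edgePoint_of_ne hk hr t

/-- The map from the surface which takes the loops `a_i` to given loops and the loops `b_i` to a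
constant: a bouquet of `g` circles is a quotient of the surface. -/
noncomputable def petalMap (hg : 0 < g) : C(Surface g, X) where
  toFun := Quot.lift (petalFun γ) (by
    rintro _ _ (⟨i, t⟩ | ⟨i, t⟩)
    · rw [petalFun_edgePoint γ i (r := 2) (by omega), petal_edgePoint_two,
        unitInterval.symm_symm]
      refine (petalFun_edgePoint γ i (r := 0) (by omega) t).trans ?_
      rw [add_zero, petal_edgePoint_zero]
    · rw [petalFun_edgePoint γ i (r := 1) (by omega), petalFun_edgePoint γ i (r := 3) (by omega),
        petal_edgePoint_one, petal_edgePoint_three, Path.source, Path.target])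
  continuous_toFun := continuous_quot_lift _ (continuous_petalFun γ hg)

variable (hg : 0 < g)

theorem petalMap_aLoop (i : Fin g) (t : I) : petalMap γ hg (aLoop g i t) = γ i t := by
  change petalFun γ (edgePoint g (4 * i) t) = _
  refine (petalFun_edgePoint γ i (r := 0) (by omega) t).trans ?_
  rw [add_zero, petal_edgePoint_zero]

theorem petalMap_bLoop (i : Fin g) (t : I) : petalMap γ hg (bLoop g i t) = x := by
  change petalFun γ (edgePoint g (4 * i + 1) t) = _
  rw [petalFun_edgePoint γ i (r := 1) (by omega), petal_edgePoint_one, Path.target]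

theorem petalMap_basePoint : petalMap γ hg (basePoint g) = x := by
  have := petalMap_aLoop γ hg ⟨0, hg⟩ 0
  rwa [Path.source, Path.source] at this

end Petals

/-- The collapse is induced by a map `Σ_h → Σ_n` which factors through a bouquet of `h` circles and
takes the first `n` of them to the loops `a_j` and the other ones to the base point. -/
theorem exists_isCollapse {n h : ℕ} (hn : 0 < n) (hnh : n ≤ h) :
    ∃ Φ : PiOne h →* PiOne n, IsCollapse hnh Φ := by
  classical
  have hh : 0 < h := hn.trans_le hnh
  let γ : Fin h → Path (basePoint n) (basePoint n) := fun i =>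
    if hi : (i : ℕ) < n then aLoop n ⟨i, hi⟩ else Path.refl _
  let Φ := FundamentalGroup.mapOfEq (petalMap γ hh) (petalMap_basePoint γ hh)
  have key : ∀ (p : Path (basePoint h) (basePoint h)) (q : Path (basePoint n) (basePoint n)),
      (∀ t, petalMap γ hh (p t) = q t) → Φ (loopClass p) = loopClass q := by
    intro p q hpq
    refine (mapOfEq_fromPath _ _ p).trans ?_
    exact congrArg loopClass (Path.ext (funext hpq))
  have hrefl : loopClass (Path.refl (basePoint n)) = 1 := rfl
  refine ⟨Φ, fun j => ?_, fun j hj => ?_, fun j => ?_⟩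
  · refine key _ _ fun t => ?_
    rw [petalMap_aLoop]
    simp only [γ, Fin.val_castLE, Fin.is_lt, dif_pos]
  · rw [← hrefl]
    refine key _ _ fun t => ?_
    rw [petalMap_aLoop]
    simp only [γ, dif_neg (not_lt.2 hj)]
  · rw [← hrefl]
    exact key _ _ fun t => petalMap_bLoop γ hh j t

/-! ### A covering which detects freeness -/

section FreeCover

open Topology

variable {X : Type*} [TopologicalSpace X] {ι : Type*} {G : Type*} [Group G]
  (f : ι → C(X, Circle)) (y : ι → G)

/-- The open sets over which the covering is trivial: the complement of the preimages of `-1`, and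
the support of the `i`-th function. -/
def coverSet : Option ι → Set X
  | none => {x | ∀ i, f i x ≠ -1}
  | some i => {x | f i x ≠ 1}

open Classical in
/-- The coordinate change from the `a`-th chart of the covering to the chart `none`, as an element
of the group: crossing the preimage of `-1` under the `i`-th function multiplies by `y i`. -/
noncomputable def coverShift : Option ι → X → G
  | none, _ => 1
  | some i, x => if (f i x : ℂ).im < 0 then (y i)⁻¹ else 1

theorem neg_one_ne_one : (-1 : Circle) ≠ 1 := by
  intro h
  have := congrArg (fun z : Circle => (z : ℂ).re) h
  norm_num at this

theorem isOpen_coverSet [Finite ι] (a : Option ι) : IsOpen (coverSet f a) := by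
  cases a with
  | none =>
    have : coverSet f none = ⋂ i, {x | f i x ≠ -1} := by ext; simp [coverSet]
    rw [this]
    exact isOpen_iInter_of_finite fun i => isOpen_ne_fun (f i).continuous continuous_const
  | some i => exact isOpen_ne_fun (f i).continuous continuous_const

theorem im_coe_ne_zero {z : Circle} (h1 : z ≠ 1) (h2 : z ≠ -1) : (z : ℂ).im ≠ 0 := by
  intro h
  have h3 : (z : ℂ).re ^ 2 = 1 := by
    have := Circle.normSq_coe z
    rw [Complex.normSq_apply, h] at this
    linarith
  rcases mul_self_eq_one_iff.1 ((sq _).symm.trans h3) with h4 | h4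
  · exact h1 (Circle.ext (Complex.ext h4 h))
  · exact h2 (Circle.ext (Complex.ext (by simpa using h4) (by simpa using h)))

theorem eventually_coverShift_eq (i : ι) {x : X} (hx : (f i x : ℂ).im ≠ 0) :
    ∀ᶠ x' in 𝓝 x, coverShift f y (some i) x' = coverShift f y (some i) x := by
  have hc : Continuous fun x => (f i x : ℂ).im := by fun_prop
  rcases lt_or_gt_of_ne hx with h | h
  · filter_upwards [hc.continuousAt.eventually_lt continuousAt_const h] with x' hx'
    simp only [coverShift, if_pos h, if_pos hx']
  · filter_upwards [continuousAt_const.eventually_lt hc.continuousAt h] with x' hx'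
    simp only [coverShift, if_neg h.not_gt, if_neg hx'.not_gt]

variable [Finite ι] [TopologicalSpace G] [DiscreteTopology G]
  (hf : ∀ i j x, i ≠ j → f i x ≠ 1 → f j x = 1)

open Classical in
/-- The covering with fibre `G` whose monodromy is described by the functions `f i`, with disjoint
supports, and the elements `y i`. -/
noncomputable def cover : FiberBundleCore (Option ι) X G where
  baseSet := coverSet f
  isOpen_baseSet := isOpen_coverSet f
  indexAt x := if h : ∃ i, f i x = -1 then some h.choose else none
  mem_baseSet_at x := by
    split_ifs with h
    · change f _ x ≠ 1
      rw [h.choose_spec]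
      exact neg_one_ne_one
    · push Not at h
      exact h
  coordChange a b x v := coverShift f y b x * ((coverShift f y a x)⁻¹ * v)
  coordChange_self a x _ v := mul_inv_cancel_left _ _
  coordChange_comp a b c x _ v := by simp
  continuousOn_coordChange a b := by
    rintro ⟨x, v⟩ ⟨⟨ha, hb⟩, -⟩
    have key : ∀ i, x ∈ coverSet f none → x ∈ coverSet f (some i) →
        ∀ᶠ x' in 𝓝 x, coverShift f y (some i) x' = coverShift f y (some i) x := fun i h h' =>
      eventually_coverShift_eq f y i (im_coe_ne_zero h' (h i))
    suffices h : ∀ᶠ x' in 𝓝 x, coverShift f y b x' * (coverShift f y a x')⁻¹ =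
        coverShift f y b x * (coverShift f y a x)⁻¹ by
      have hc : Continuous fun p : X × G => coverShift f y b x * (coverShift f y a x)⁻¹ * p.2 :=
        (continuous_of_discreteTopology (f := fun v : G => _ * v)).comp continuous_snd
      refine (hc.continuousAt.congr ?_).continuousWithinAt
      filter_upwards [(continuous_fst.tendsto (x, v)).eventually h] with p hp
      rw [← hp, mul_assoc]
    cases a with
    | none =>
      cases b with
      | none => exact Filter.Eventually.of_forall fun _ => rfl
      | some j => filter_upwards [key j ha hb] with x' h; rw [h]; rfl
    | some i =>
      cases b with
      | none => filter_upwards [key i hb ha] with x' h; rw [h]; rfl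
      | some j =>
        by_cases hij : i = j
        · subst hij
          exact Filter.Eventually.of_forall fun _ => by rw [mul_inv_cancel, mul_inv_cancel]
        · exact absurd (hf i j x hij ha) hb

theorem isCoveringMap_cover : IsCoveringMap (cover f y hf).proj :=
  FiberBundle.isCoveringMap

open Classical in
theorem coverShift_indexAt (x : X) : coverShift f y ((cover f y hf).indexAt x) x = 1 := by
  change coverShift f y (dite _ _ _) x = 1
  split_ifs with h
  · simp [coverShift, h.choose_spec]
  · rfl

open Classical in
theorem indexAt_eq_none {x : X} (h : ∀ i, f i x ≠ -1) : (cover f y hf).indexAt x = none :=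
  dif_neg fun ⟨i, hi⟩ => h i hi

open Classical in
theorem indexAt_eq_some {x : X} {i : ι} (h : f i x = -1) : (cover f y hf).indexAt x = some i := by
  have h' : ∃ i, f i x = -1 := ⟨i, h⟩
  have : h'.choose = i := by
    by_contra hne
    have := hf _ _ x hne (by rw [h'.choose_spec]; exact neg_one_ne_one)
    rw [h] at this
    exact neg_one_ne_one this
  rw [← this]
  exact dif_pos h'

variable {b : X} (a : Path b b) {j : ι} (hj : ∀ t, f j (a t) = Circle.exp (2 * π * t))
  (hi : ∀ i t, i ≠ j → f i (a t) = 1)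

open Classical in
/-- The lift to the covering of a loop which crosses the preimage of `-1` once, at time `1 / 2`. -/
noncomputable def coverLift (v : G) (t : I) : (cover f y hf).TotalSpace :=
  ⟨a t, if (t : ℝ) ≤ 1 / 2 then v else y j * v⟩

theorem exp_two_pi_eq_neg_one {t : I} (h : Circle.exp (2 * π * t) = -1) : (t : ℝ) = 1 / 2 := by
  have h1 : Circle.exp (2 * π * t) = Circle.exp π := by
    rw [h]; exact Circle.ext (by rw [Circle.coe_exp, Complex.exp_pi_mul_I]; simp)
  obtain ⟨m, hm⟩ := Circle.exp_eq_exp.1 h1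
  have hπ := Real.pi_pos
  have h2 : (t : ℝ) = 1 / 2 + m := by
    have : π * (2 * t) = π * (1 + 2 * m) := by linarith
    have := mul_left_cancel₀ hπ.ne' this
    linarith
  have h0 := t.2.1
  have h1 := t.2.2
  have hm1 : (m : ℝ) < 1 := by linarith
  have hm2 : (-1 : ℝ) < m := by linarith
  have hm0 : m = 0 := by
    have h1 : m < 1 := by exact_mod_cast hm1
    have h2 : -1 < m := by exact_mod_cast hm2
    omega
  rw [h2, hm0]
  simp

include hj hi in
open Classical in
theorem continuous_coverLift (v : G) : Continuous (coverLift f y hf a (j := j) v) := by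
  rw [continuous_iff_continuousAt]
  intro t
  refine (FiberBundle.continuousAt_totalSpace G _).2 ⟨a.continuous.continuousAt, ?_⟩
  have hval : ∀ s : I, (trivializationAt G (cover f y hf).Fiber
      (coverLift f y hf a (j := j) v t).proj (coverLift f y hf a (j := j) v s)).2 =
        coverShift f y ((cover f y hf).indexAt (a t)) (a s) * if (s : ℝ) ≤ 1 / 2 then v else y j * v := by
    intro s
    change coverShift f y _ (a s) * ((coverShift f y ((cover f y hf).indexAt (a s)) (a s))⁻¹ *
      if (s : ℝ) ≤ 1 / 2 then v else y j * v) = _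
    rw [coverShift_indexAt, inv_one, one_mul]
    rfl
  simp only [hval]
  have hcoe : ContinuousAt (fun s : I => (s : ℝ)) t := continuous_subtype_val.continuousAt
  have hne : (t : ℝ) ≠ 1 / 2 → ∀ i, f i (a t) ≠ -1 := by
    intro ht i h
    rcases eq_or_ne i j with rfl | hij
    · rw [hj] at h
      exact ht (exp_two_pi_eq_neg_one h)
    · rw [hi i t hij] at h
      exact neg_one_ne_one h.symm
  rcases lt_trichotomy (t : ℝ) (1 / 2) with h | h | h
  · rw [indexAt_eq_none f y hf (hne h.ne)]
    refine (continuousAt_const (y := v)).congr ?_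
    filter_upwards [hcoe.eventually_lt continuousAt_const h] with s hs
    rw [if_pos hs.le]
    exact (one_mul v).symm
  · have ht : f j (a t) = -1 := by
      rw [hj, h]
      exact Circle.ext (by
        rw [Circle.coe_exp, mul_one_div, mul_div_cancel_left₀ _ two_ne_zero, Complex.exp_pi_mul_I]
        simp)
    rw [indexAt_eq_some f y hf ht]
    refine (continuousAt_const (y := v)).congr ?_
    have h1 : (t : ℝ) < 1 := by rw [h]; norm_num
    filter_upwards [hcoe.eventually_lt continuousAt_const h1] with s hs
    have hs0 := s.2.1
    have hπ := Real.pi_pos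
    simp only [coverShift, hj, exp_im]
    split_ifs with h2 h3 h3
    · refine absurd (Real.sin_nonneg_of_nonneg_of_le_pi (by positivity) ?_) h2.not_ge
      nlinarith
    · rw [inv_mul_cancel_left]
    · rw [one_mul]
    · refine absurd ?_ h2
      rw [← Real.sin_sub_two_pi]
      exact Real.sin_neg_of_neg_of_neg_pi_lt (by nlinarith) (by nlinarith)
  · rw [indexAt_eq_none f y hf (hne h.ne')]
    refine (continuousAt_const (y := y j * v)).congr ?_
    filter_upwards [continuousAt_const.eventually_lt hcoe h] with s hs
    rw [if_neg hs.not_ge]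
    exact (one_mul (y j * v)).symm

/-- The point of the fibre over `b` with coordinate `v`. -/
noncomputable def coverPoint (b : X) (v : G) : (cover f y hf).proj ⁻¹' {b} := ⟨⟨b, v⟩, rfl⟩

theorem coverPoint_injective (b : X) : Function.Injective (coverPoint f y hf b) := by
  intro v w h
  exact eq_of_heq (Bundle.TotalSpace.mk.inj (congrArg Subtype.val h)).2

include hj hi in
/-- The monodromy of a loop that crosses only the preimage of `-1` under `f j`, once, is the left
multiplication by `y j`. -/
theorem monodromyPerm_coverPoint (v : G) :
    (isCoveringMap_cover f y hf).monodromyPerm b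
      (FundamentalGroup.fromPath (Path.Homotopic.Quotient.mk a)) (coverPoint f y hf b v) =
        coverPoint f y hf b (y j * v) := by
  have haux : ∀ (x x' : X) (w w' : G), x = x' → w = w' →
      (⟨x, w⟩ : (cover f y hf).TotalSpace) = ⟨x', w'⟩ := by
    rintro x _ w _ rfl rfl; rfl
  have h0 : a 0 = (cover f y hf).proj (coverPoint f y hf b v).1 := a.source
  have hlift := ((isCoveringMap_cover f y hf).eq_liftPath_iff (γ := a)
    (e := (coverPoint f y hf b v).1) h0 (Γ := coverLift f y hf a (j := j) v)).2
    ⟨continuous_coverLift f y hf a hj hi v, rfl,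
      haux _ _ _ _ a.source (if_pos (by norm_num))⟩
  apply Subtype.ext
  refine (congrFun hlift 1).symm.trans ?_
  exact haux _ _ _ _ a.target (if_neg (by norm_num))

end FreeCover

/-- Loops `a j` which are detected by maps to the circle with disjoint supports freely generate a
free subgroup of the fundamental group: on the covering whose fibre is the free group itself, they
act by the left translations by the generators, and left translations are faithful. -/
theorem injective_lift_of_circle {X : Type*} [TopologicalSpace X] {ι : Type*} [Finite ι]
    (f : ι → C(X, Circle)) (hf : ∀ i j x, i ≠ j → f i x ≠ 1 → f j x = 1) {b : X}
    (a : ι → Path b b) (hj : ∀ j t, f j (a j t) = Circle.exp (2 * π * t))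
    (hi : ∀ i j t, i ≠ j → f i (a j t) = 1) :
    Function.Injective (FreeGroup.lift fun j =>
      FundamentalGroup.fromPath (Path.Homotopic.Quotient.mk (a j))) := by
  let τ : TopologicalSpace (FreeGroup ι) := ⊥
  have : DiscreteTopology (FreeGroup ι) := ⟨rfl⟩
  set ψ : FreeGroup ι →* FundamentalGroup X b := FreeGroup.lift fun j =>
      FundamentalGroup.fromPath (Path.Homotopic.Quotient.mk (a j)) with hψ
  let M := ((isCoveringMap_cover f FreeGroup.of hf).monodromyPerm b).comp ψ
  have hof : ∀ j v, M (FreeGroup.of j) (coverPoint f FreeGroup.of hf b v) =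
      coverPoint f FreeGroup.of hf b (FreeGroup.of j * v) := by
    intro j v
    change (isCoveringMap_cover f FreeGroup.of hf).monodromyPerm b (ψ (FreeGroup.of j)) _ = _
    rw [hψ, FreeGroup.lift_apply_of]
    exact monodromyPerm_coverPoint f _ hf (a j) (hj j) (fun i t hij => hi i j t hij) v
  have hM : ∀ w v, M w (coverPoint f FreeGroup.of hf b v) =
      coverPoint f FreeGroup.of hf b (w * v) := by
    intro w
    induction w using FreeGroup.induction_on with
    | C1 => intro v; rw [map_one, one_mul]; rfl
    | of j => exact hof j
    | inv_of j h =>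
      intro v
      rw [map_inv, Equiv.Perm.inv_eq_iff_eq]
      exact ((hof j _).trans (by rw [mul_inv_cancel_left])).symm
    | mul w w' h h' => intro v; rw [map_mul, Equiv.Perm.mul_apply, h', h, mul_assoc]
  intro w w' h
  have h1 : M w = M w' := congrArg ((isCoveringMap_cover f FreeGroup.of hf).monodromyPerm b) h
  have h2 := (hM w 1).symm.trans ((DFunLike.congr_fun h1 _).trans (hM w' 1))
  simpa using coverPoint_injective f FreeGroup.of hf b h2

/-- The loop which runs once around the circle. -/
noncomputable def circleLoop : Path (1 : Circle) 1 where
  toFun t := Circle.exp (2 * π * t)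
  continuous_toFun := by fun_prop
  source' := by simp
  target' := by simp

open Classical in
/-- The loops `a_i` are a basis of a free subgroup of the fundamental group of the surface. -/
theorem injective_lift_aClass {g : ℕ} (hg : 0 < g) :
    Function.Injective (FreeGroup.lift (aClass g)) := by
  let γ : Fin g → Fin g → Path (1 : Circle) 1 := fun i k =>
    if k = i then circleLoop else Path.refl 1
  refine injective_lift_of_circle (fun i => petalMap (γ i) hg) ?_ (aLoop g) ?_ ?_
  · intro i j x hij h
    obtain ⟨z, rfl⟩ := (isQuotientMap_proj g).surjective x
    change petalFun (γ j) z = 1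
    change petalFun (γ i) z ≠ 1 at h
    obtain ⟨k, hk⟩ := exists_petal_eq_zero hg z
    rw [petalFun_eq _ hk] at h ⊢
    have hki : k = i := by
      by_contra hne
      simp [γ, hne] at h
    subst hki
    simp [γ, hij]
  · intro j t
    rw [petalMap_aLoop]
    simp [γ, circleLoop]
  · intro i j t hij
    rw [petalMap_aLoop]
    simp [γ, hij.symm]

/-! ### Images of curves under homeomorphisms -/

section Transport

open Topology

theorem IsSimpleLoop.map {X Y : Type*} [TopologicalSpace X] [TopologicalSpace Y] {x : X}
    {p : Path x x} (hp : IsSimpleLoop p) (Ψ : X ≃ₜ Y) : IsSimpleLoop (p.map Ψ.continuous) :=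
  fun s t h => hp s t (Ψ.injective h)

theorem FreelyHomotopic.map {X Y : Type*} [TopologicalSpace X] [TopologicalSpace Y] {x x' : X}
    {p : Path x x} {q : Path x' x'} (h : FreelyHomotopic p q) (Ψ : X ≃ₜ Y) :
    FreelyHomotopic (p.map Ψ.continuous) (q.map Ψ.continuous) := by
  obtain ⟨H, h0, h1, h2⟩ := h
  exact ⟨(Ψ : C(X, Y)).comp H, fun t => congrArg Ψ (h0 t), fun t => congrArg Ψ (h1 t),
    fun s => congrArg Ψ (h2 s)⟩

theorem MeetTransverselyOnce.image {X Y : Type*} [TopologicalSpace X] [TopologicalSpace Y]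
    {A B : Set X} (h : MeetTransverselyOnce A B) (Ψ : X ≃ₜ Y) :
    MeetTransverselyOnce (Ψ '' A) (Ψ '' B) := by
  obtain ⟨z, hz, e, hze, he0, he⟩ := h
  refine ⟨Ψ z, by rw [← Set.image_inter Ψ.injective, hz, Set.image_singleton],
    Ψ.symm.transOpenPartialHomeomorph e, ?_, ?_, ?_⟩
  · simpa using hze
  · simpa using he0
  · intro y hy
    obtain ⟨x, rfl⟩ := Ψ.surjective y
    have hx : x ∈ e.source := by simpa using hy
    have := he x hx
    simpa [Ψ.injective.mem_set_image] using this

/-- The image of `b_i` under a homeomorphism which fixes the loop `a_i`: it is a simple loop, and it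
is freely homotopic to the image of the dual curve of `a_i`, which still crosses `a_i` once. -/
theorem exists_loop_of_homeomorph {g : ℕ} (i : Fin g) (Ψ : Surface g ≃ₜ Surface g)
    (hΨ : Ψ (basePoint g) = basePoint g) (hfix : ∀ t, Ψ (aLoop g i t) = aLoop g i t) :
    ∃ R : Path (basePoint g) (basePoint g), IsSimpleLoop R ∧
      (∃ (y : Surface g) (C : Path y y), IsSimpleLoop C ∧ FreelyHomotopic R C ∧
        MeetTransverselyOnce (Set.range C) (Set.range (aLoop g i))) ∧
      loopClass R = piOneMap Ψ hΨ (bClass g i) := by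
  obtain ⟨y, C, hC, hCb, hCa⟩ := exists_dual_curve i
  refine ⟨((bLoop g i).map Ψ.continuous).cast hΨ.symm hΨ.symm, (isSimpleLoop_bLoop i).map Ψ,
    ⟨Ψ y, C.map Ψ.continuous, hC.map Ψ, hCb.map Ψ, ?_⟩,
    (mapOfEq_fromPath (Ψ : C(Surface g, Surface g)) hΨ (bLoop g i)).symm⟩
  have h1 : Ψ '' Set.range (aLoop g i) = Set.range (aLoop g i) := by
    rw [← Set.range_comp]
    exact congrArg Set.range (funext hfix)
  have h2 : Set.range (C.map Ψ.continuous) = Ψ '' Set.range C := Set.range_comp Ψ C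
  rw [h2]
  nth_rewrite 1 [← h1]
  exact hCa.image Ψ

end Transport

/-! ### Realisation of words -/

section Realization

variable {n h : ℕ}

/-- The power `a_j ^ m` as the image of `b_i`, up to the collapse, under a homeomorphism which fixes
`a_i`. If `j = i`, this is a Dehn twist along `a_i`. Otherwise, a twist along an annulus that
crosses `a_j` and `b_i` multiplies `b_i` by an element which becomes `a_i * (a_j⁻¹ * b_j⁻¹ * a_j)`
as soon as `b_i` is trivial. A twist along `a_j` turns `b_j` into `a_j ^ (-m)` up to the collapse,
and a twist along `a_i` removes the factor `a_i`. -/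
theorem exists_homeomorph_pow (hnh : n ≤ h) (i : Fin h) (j : Fin n) (hji : (j : ℕ) ≤ i) (m : ℤ) :
    ∃ (Ψ : Surface h ≃ₜ Surface h) (hΨ : Ψ (basePoint h) = basePoint h),
      (∀ t, Ψ (aLoop h i t) = aLoop h i t) ∧
      ∀ Φ : PiOne h →* PiOne n, IsCollapse hnh Φ →
        Φ (piOneMap Ψ hΨ (bClass h i)) = aClass n j ^ m := by
  have hh : 0 < h := i.pos
  rcases eq_or_lt_of_le hji with hji | hji
  · obtain ⟨T, hT, hTa, -, hTb⟩ := exists_twist_a i m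
    refine ⟨T, hT, hTa i, fun Φ hΦ => ?_⟩
    have : i = Fin.castLE hnh j := Fin.ext hji.symm
    rw [hTb, map_mul, map_zpow, hΦ.2.2, mul_one, this, hΦ.1]
  · set j' : Fin h := Fin.castLE hnh j with hj'
    have hjv : (j' : ℕ) = j := rfl
    have hne : i ≠ j' := fun h => by rw [h] at hji; exact lt_irrefl _ hji
    obtain ⟨A, hA, hAa, -, hAb⟩ := exists_twist_a i (-1)
    obtain ⟨B, hB, hBfix, hBb, -⟩ := exists_twist_two hh (e := 4 * j') (f := 4 * i + 1) (by omega)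
      (by omega) (by omega) (by omega) 1
    obtain ⟨C, hC, hCa, hCb, hCj⟩ := exists_twist_a j' (-m)
    have hBa : ∀ t, B (aLoop h i t) = aLoop h i t :=
      hBfix (4 * i) (by omega) (by omega) (by omega) (by omega)
    have hAB : (A.trans B) (basePoint h) = basePoint h := by
      rw [Homeomorph.trans_apply, hA, hB]
    have hABC : ((A.trans B).trans C) (basePoint h) = basePoint h := by
      rw [Homeomorph.trans_apply, hAB, hC]
    refine ⟨(A.trans B).trans C, hABC, fun t => ?_, fun Φ hΦ => ?_⟩
    · rw [Homeomorph.trans_apply, Homeomorph.trans_apply, hAa, hBa, hCa]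
    · have hCa' : ∀ l, piOneMap C hC (aClass h l) = aClass h l := fun l =>
        piOneMap_loopClass_of_fixed C hC _ (hCa l)
      have hBai : piOneMap B hB (aClass h i) = aClass h i := piOneMap_loopClass_of_fixed B hB _ hBa
      rw [piOneMap_trans _ _ hAB hC, piOneMap_trans _ _ hA hB, hAb, map_mul, map_zpow, hBai]
      have hBi : piOneMap B hB (bClass h i) = _ := hBb (bLoop h i) fun t => rfl
      rw [hBi, show loopClass (bLoop h i) = bClass h i from rfl]
      let ρ : PiOne h →* PiOne n := Φ.comp (piOneMap C hC)
      have ha : ∀ l, ρ (aClass h l) = Φ (aClass h l) := fun l => congrArg Φ (hCa' l)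
      have hb : ∀ l, l ≠ j' → ρ (bClass h l) = 1 := fun l hl => by
        change Φ (piOneMap C hC _) = 1
        rw [hCb l hl, hΦ.2.2]
      have hbj : ρ (bClass h j') = aClass n j ^ (-m) := by
        change Φ (piOneMap C hC _) = _
        rw [hCj, map_mul, map_zpow, hΦ.2.2, mul_one, hj', hΦ.1]
      have haj : ρ (aClass h j') = aClass n j := by rw [ha, hj', hΦ.1]
      have hcomm : ∀ l, Commute (ρ (aClass h l)) (ρ (bClass h l)) := by
        intro l
        by_cases hl : l = j'
        · rw [hl, haj, hbj]
          exact (Commute.refl _).zpow_right _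
        · rw [hb l hl]
          exact Commute.one_right _
      change ρ _ = _
      rw [← chordCls_mul hh (4 * j' + 2) 0 (4 * i + 1 + 1), ← chordCls_inv hh 0 (4 * j' + 2),
        ← chordCls_mul hh (4 * i + 1 + 2) 0 (4 * j' + 1), ← chordCls_inv hh 0 (4 * i + 1 + 2)]
      simp only [map_mul, map_inv, map_zpow]
      have h1 := map_chordCls_two hh ρ i fun l _ => hcomm l
      have h2 := map_chordCls_three hh ρ i fun l _ => hcomm l
      have h3 := map_chordCls_one hh ρ j' fun l _ => hcomm l
      have h4 := map_chordCls_two hh ρ j' fun l _ => hcomm l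
      rw [show 4 * (i : ℕ) + 1 + 1 = 4 * i + 2 from rfl,
        show 4 * (i : ℕ) + 1 + 2 = 4 * i + 3 from rfl,
        h1, h2, h3, h4, hb i hne, hbj, haj]
      group

theorem piOneMap_refl {g : ℕ} (x : PiOne g) :
    piOneMap (Homeomorph.refl (Surface g)) rfl x = x := by
  induction x using Path.Homotopic.Quotient.ind with
  | mk L => exact (mapOfEq_fromPath _ _ L)

/-- The element `w` is the image of `b_i`, up to the collapse, under a homeomorphism `Ψ` which fixes
`a_i`. The condition on the other generators says that, up to the collapse, `Ψ` acts trivially on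
the `a_l` and keeps `a_l` and `b_l` commuting for `l < i`; this makes the effect of putting a
further twist in front of `Ψ` computable. -/
def Realizable (hnh : n ≤ h) (i : Fin h) (w : PiOne n) : Prop :=
  ∃ (Ψ : Surface h ≃ₜ Surface h) (hΨ : Ψ (basePoint h) = basePoint h),
    (∀ t, Ψ (aLoop h i t) = aLoop h i t) ∧
    ∀ Φ : PiOne h →* PiOne n, IsCollapse hnh Φ →
      (∀ l, Φ (piOneMap Ψ hΨ (aClass h l)) = Φ (aClass h l)) ∧
      (∀ l < i, Commute (Φ (aClass h l)) (Φ (piOneMap Ψ hΨ (bClass h l)))) ∧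
      Φ (piOneMap Ψ hΨ (bClass h i)) = w

/-- If `i ≥ n`, then every element of the free group is realizable. The word is built up letter by
letter: the `m`-fold twist along an annulus crossing `b_j` and `b_i`, put in front of `Ψ`, replaces
`w` by `w * a_j ^ m`, because the collapse kills `a_i`. -/
theorem realizable_of_mem_closure (hnh : n ≤ h) (i : Fin h) (hi : n ≤ i) {w : PiOne n}
    (hw : w ∈ Subgroup.closure (Set.range (aClass n))) : Realizable hnh i w := by
  have hh : 0 < h := i.pos
  have step : ∀ (j : Fin n) (m : ℤ) (w : PiOne n), Realizable hnh i w →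
      Realizable hnh i (w * aClass n j ^ m) := by
    rintro j m w ⟨Ψ, hΨ, hfix, H⟩
    set j' : Fin h := Fin.castLE hnh j with hj'
    have hjv : (j' : ℕ) = j := rfl
    have hji : j' < i := Fin.lt_def.2 (by omega)
    have hji' : (j' : ℕ) < i := hji
    obtain ⟨T, hT, hTfix, hTi, hTj⟩ := exists_twist_two hh (e := 4 * j' + 1) (f := 4 * i + 1)
      (by omega) (by omega) (by omega) (by omega) m
    have hTa : ∀ l t, T (aLoop h l t) = aLoop h l t := fun l =>
      hTfix (4 * l) (by omega) (by omega) (by omega) (by omega)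
    have hTa' : ∀ l, piOneMap T hT (aClass h l) = aClass h l := fun l =>
      piOneMap_loopClass_of_fixed T hT _ (hTa l)
    have hTb : ∀ l, l ≠ i → l ≠ j' → piOneMap T hT (bClass h l) = bClass h l := fun l hl hl' =>
      piOneMap_loopClass_of_fixed T hT _ (hTfix (4 * l + 1) (by omega) (by omega)
        (fun h => hl' (Fin.ext (by omega))) (fun h => hl (Fin.ext (by omega))))
    have hTbi : piOneMap T hT (bClass h i) = _ := hTi (bLoop h i) fun t => rfl
    have hTbj : piOneMap T hT (bClass h j') = _ := hTj (bLoop h j') fun t => rfl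
    have hTΨ : (T.trans Ψ) (basePoint h) = basePoint h := by rw [Homeomorph.trans_apply, hT, hΨ]
    refine ⟨T.trans Ψ, hTΨ, fun t => by rw [Homeomorph.trans_apply, hTa, hfix], fun Φ hΦ => ?_⟩
    obtain ⟨Ha, Hb, Hi⟩ := H Φ hΦ
    simp only [piOneMap_trans _ _ hT hΨ hTΨ, hTa']
    let ρ : PiOne h →* PiOne n := Φ.comp (piOneMap Ψ hΨ)
    have ha : ∀ l, ρ (aClass h l) = Φ (aClass h l) := Ha
    have hcomm : ∀ l < i, Commute (ρ (aClass h l)) (ρ (bClass h l)) := fun l hl => by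
      rw [ha]; exact Hb l hl
    have hai : ρ (aClass h i) = 1 := by rw [ha, hΦ.2.1 i hi]
    have haj : ρ (aClass h j') = aClass n j := by rw [ha, hj', hΦ.1]
    have hbi : ρ (bClass h i) = w := Hi
    have h1 := map_chordCls_two hh ρ i fun l hl => hcomm l hl
    have h2 := map_chordCls_three hh ρ i fun l hl => hcomm l hl
    have h3 := map_chordCls_two hh ρ j' fun l hl => hcomm l (lt_trans hl hji)
    have h4 := map_chordCls_three hh ρ j' fun l hl => hcomm l (lt_trans hl hji)
    rw [hai, hbi] at h1 h2
    rw [haj] at h3 h4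
    have hc := hcomm j' hji
    rw [haj] at hc
    have e1 : ρ (chordCls hh (4 * j' + 1 + 2) (4 * i + 1 + 1)) = w * (ρ (bClass h j'))⁻¹ := by
      rw [← chordCls_mul hh (4 * j' + 1 + 2) 0 (4 * i + 1 + 1),
        ← chordCls_inv hh 0 (4 * j' + 1 + 2), map_mul, map_inv]
      refine (congrArg₂ (fun u v => u * v⁻¹) h1 h4).trans ?_
      rw [mul_one, ← hc.eq, inv_mul_cancel_left]
    have e2 : ρ (chordCls hh (4 * i + 1 + 2) (4 * j' + 1 + 1)) =
        ρ (bClass h j') * aClass n j * w⁻¹ := by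
      rw [← chordCls_mul hh (4 * i + 1 + 2) 0 (4 * j' + 1 + 1),
        ← chordCls_inv hh 0 (4 * i + 1 + 2), map_mul, map_inv]
      refine (congrArg₂ (fun u v => u * v⁻¹) h3 h2).trans ?_
      rw [mul_one, inv_one, one_mul]
    refine ⟨Ha, fun l hl => ?_, ?_⟩
    · by_cases hlj : l = j'
      · subst hlj
        rw [hTbj]
        change Commute (Φ _) (ρ _)
        rw [map_mul, map_zpow, map_mul, e1, e2, ← ha, haj]
        have e3 : ρ (bClass h j') * aClass n j * w⁻¹ * (w * (ρ (bClass h j'))⁻¹) = aClass n j := by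
          rw [← hc.eq]; group
        rw [e3]
        exact ((Commute.refl _).zpow_right _).mul_right hc
      · rw [hTb l (ne_of_lt hl) hlj]
        exact Hb l hl
    · rw [hTbi, show loopClass (bLoop h i) = bClass h i from rfl]
      change ρ _ = _
      rw [map_mul, map_zpow, map_mul, e1, e2, hbi]
      have e3 : w * (ρ (bClass h j'))⁻¹ * (ρ (bClass h j') * aClass n j * w⁻¹) =
          w * aClass n j * w⁻¹ := by group
      rw [e3, conj_zpow, inv_mul_cancel_right]
  induction hw using Subgroup.closure_induction_right with
  | one =>
    refine ⟨Homeomorph.refl _, rfl, fun t => rfl, fun Φ hΦ => ⟨fun l => ?_, fun l _ => ?_, ?_⟩⟩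
    · rw [piOneMap_refl]
    · rw [piOneMap_refl, hΦ.2.2]; exact Commute.one_right _
    · rw [piOneMap_refl, hΦ.2.2]
  | mul_right w y hw hy ih =>
    obtain ⟨j, rfl⟩ := hy
    simpa using step j 1 w ih
  | mul_inv_cancel w y hw hy ih =>
    obtain ⟨j, rfl⟩ := hy
    simpa using step j (-1) w ih

end Realization

/-! ### Syllable length -/

section SyllableLength

variable {G : Type*} [Group G] {n : ℕ} {x : Fin n → G} {w : G}

/-- On the subgroup generated by `x`, the infimum in the definition of the syllable length is
attained. -/
theorem syllableLength_mem (hn : 0 < n) (hw : w ∈ Subgroup.closure (Set.range x)) :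
    1 ≤ syllableLength x w ∧ ∃ (i : Fin (syllableLength x w) → Fin n)
      (m : Fin (syllableLength x w) → ℤ), w = (List.ofFn fun j => x (i j) ^ m j).prod := by
  have step : ∀ (j : Fin n) (m : ℤ) (w : G), (∃ s, 1 ≤ s ∧ ∃ (i : Fin s → Fin n) (m : Fin s → ℤ),
      w = (List.ofFn fun j => x (i j) ^ m j).prod) → ∃ s, 1 ≤ s ∧ ∃ (i : Fin s → Fin n)
        (m' : Fin s → ℤ), x j ^ m * w = (List.ofFn fun j => x (i j) ^ m' j).prod := by
    rintro j m w ⟨s, hs, i, m', rfl⟩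
    exact ⟨s + 1, by omega, Fin.cons j i, Fin.cons m m', by simp [List.ofFn_succ]⟩
  have hne : {s | 1 ≤ s ∧ ∃ (i : Fin s → Fin n) (m : Fin s → ℤ),
      w = (List.ofFn fun j => x (i j) ^ m j).prod}.Nonempty := by
    induction hw using Subgroup.closure_induction_left with
    | one => exact ⟨1, le_rfl, fun _ => ⟨0, hn⟩, fun _ => 0, by simp⟩
    | mul_left y hy w hw ih =>
      obtain ⟨j, rfl⟩ := hy
      have := step j 1 w ih
      rwa [zpow_one] at this
    | inv_mul_cancel y hy w hw ih =>
      obtain ⟨j, rfl⟩ := hy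
      have := step j (-1) w ih
      rwa [zpow_neg_one] at this
  exact Nat.sInf_mem hne

theorem exists_eq_zpow_of_syllableLength_eq_one (hn : 0 < n)
    (hw : w ∈ Subgroup.closure (Set.range x)) (h : syllableLength x w = 1) :
    ∃ (j : Fin n) (m : ℤ), w = x j ^ m := by
  have h1 := (syllableLength_mem hn hw).2
  rw [h] at h1
  obtain ⟨i, m, hw⟩ := h1
  exact ⟨i 0, m 0, by simpa using hw⟩

end SyllableLength

end SurfaceLoops

theorem proposition4p2 (n k h : ℕ) (hn : 0 < n)
    (r : Fin k → SurfaceLoops.PiOne n)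
    (hr : ∀ i, r i ∈ Subgroup.closure (Set.range (SurfaceLoops.aClass n)))
    (hh : (h : ℤ) =
      n + ((∑ i, SurfaceLoops.syllableLength (SurfaceLoops.aClass n) (r i) : ℕ) : ℤ) - k) :
    Function.Injective (FreeGroup.lift (SurfaceLoops.aClass n)) ∧
    ∃ hnh : n ≤ h,
      (∃! Φ : SurfaceLoops.PiOne h →* SurfaceLoops.PiOne n, SurfaceLoops.IsCollapse hnh Φ) ∧
      ∃ R : Fin k → Path (SurfaceLoops.basePoint h) (SurfaceLoops.basePoint h),
        (∀ i, SurfaceLoops.IsSimpleLoop (R i)) ∧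
        (∀ i, ∃ (y : SurfaceLoops.Surface h) (C : Path y y),
          SurfaceLoops.IsSimpleLoop C ∧ SurfaceLoops.FreelyHomotopic (R i) C ∧
          SurfaceLoops.MeetTransverselyOnce (Set.range C)
            (Set.range (SurfaceLoops.aLoop h ⟨h - 1, by omega⟩))) ∧
        ∀ Φ : SurfaceLoops.PiOne h →* SurfaceLoops.PiOne n, SurfaceLoops.IsCollapse hnh Φ →
          ∀ i, Φ (SurfaceLoops.loopClass (R i)) = r i := by
  have hlen : ∀ i, 1 ≤ SurfaceLoops.syllableLength (SurfaceLoops.aClass n) (r i) := fun i =>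
    (SurfaceLoops.syllableLength_mem hn (hr i)).1
  have hsum : ∑ _i : Fin k, 1 ≤ ∑ i, SurfaceLoops.syllableLength (SurfaceLoops.aClass n) (r i) :=
    Finset.sum_le_sum fun i _ => hlen i
  have hk : ∑ _i : Fin k, 1 = k := by simp
  have hnh : n ≤ h := by omega
  have hh0 : 0 < h := by omega
  refine ⟨SurfaceLoops.injective_lift_aClass hn, hnh, ?_, ?_⟩
  · obtain ⟨Φ, hΦ⟩ := SurfaceLoops.exists_isCollapse hn hnh
    refine ⟨Φ, hΦ, fun Φ' hΦ' => SurfaceLoops.piOne_hom_ext hh0 (fun j => ?_) fun j => ?_⟩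
    · rcases lt_or_ge (j : ℕ) n with hj | hj
      · exact (hΦ'.1 ⟨j, hj⟩).trans (hΦ.1 ⟨j, hj⟩).symm
      · rw [hΦ.2.1 j hj, hΦ'.2.1 j hj]
    · rw [hΦ.2.2, hΦ'.2.2]
  · have key : ∀ i, ∃ R : Path (SurfaceLoops.basePoint h) (SurfaceLoops.basePoint h),
        SurfaceLoops.IsSimpleLoop R ∧
        (∃ (y : SurfaceLoops.Surface h) (C : Path y y),
          SurfaceLoops.IsSimpleLoop C ∧ SurfaceLoops.FreelyHomotopic R C ∧
          SurfaceLoops.MeetTransverselyOnce (Set.range C)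
            (Set.range (SurfaceLoops.aLoop h ⟨h - 1, by omega⟩))) ∧
        ∀ Φ : SurfaceLoops.PiOne h →* SurfaceLoops.PiOne n, SurfaceLoops.IsCollapse hnh Φ →
          Φ (SurfaceLoops.loopClass R) = r i := by
      intro i
      obtain ⟨Ψ, hΨ, hfix, hΨr⟩ : ∃ (Ψ : SurfaceLoops.Surface h ≃ₜ SurfaceLoops.Surface h)
          (hΨ : Ψ (SurfaceLoops.basePoint h) = SurfaceLoops.basePoint h),
          (∀ t, Ψ (SurfaceLoops.aLoop h ⟨h - 1, by omega⟩ t) =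
            SurfaceLoops.aLoop h ⟨h - 1, by omega⟩ t) ∧
          ∀ Φ : SurfaceLoops.PiOne h →* SurfaceLoops.PiOne n, SurfaceLoops.IsCollapse hnh Φ →
            Φ (SurfaceLoops.piOneMap Ψ hΨ (SurfaceLoops.bClass h ⟨h - 1, by omega⟩)) = r i := by
        rcases hnh.lt_or_eq with hlt | heq
        · obtain ⟨Ψ, hΨ, hfix, H⟩ := SurfaceLoops.realizable_of_mem_closure hnh ⟨h - 1, by omega⟩
            (Nat.le_sub_one_of_lt hlt) (hr i)
          exact ⟨Ψ, hΨ, hfix, fun Φ hΦ => (H Φ hΦ).2.2⟩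
        · -- If `h = n`, then all the words are powers of a single generator.
          have hone : SurfaceLoops.syllableLength (SurfaceLoops.aClass n) (r i) = 1 :=
            ((Finset.sum_eq_sum_iff_of_le fun i _ => hlen i).1 (by omega) i (Finset.mem_univ i)).symm
          obtain ⟨j, m, hjm⟩ :=
            SurfaceLoops.exists_eq_zpow_of_syllableLength_eq_one hn (hr i) hone
          rw [hjm]
          exact SurfaceLoops.exists_homeomorph_pow hnh ⟨h - 1, by omega⟩ j
            (Nat.le_sub_one_of_lt (j.2.trans_le hnh)) m
      obtain ⟨R, hR, hRC, hRΨ⟩ :=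
        SurfaceLoops.exists_loop_of_homeomorph ⟨h - 1, by omega⟩ Ψ hΨ hfix
      exact ⟨R, hR, hRC, fun Φ hΦ => by rw [hRΨ, hΨr Φ hΦ]⟩
    choose R hR hRC hRr using key
    exact ⟨R, hR, hRC, fun Φ hΦ i => hRr i Φ hΦ⟩
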